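/- **Setting.** Let $\mathcal X,\mathcal Z,\mathcal W$ be measurable spaces (in applications, compact subsets of Euclidean spaces), let $\mathcal D$ be a probability distribution on $\mathcal X\times\mathcal Z$ (the data distribution), and let $\mathcal F$ be a linear space of measurable functions $\mathcal W\to\mathbb R$. Let $\Phi(x,z;f)$ and $\Psi(x,z;f)$ be real-valued functionals of $f\in\mathcal F$, measurable in $(x,z)$, such that $f\mapsto\Phi(x,z;f)$ is affine and $f\mapsto\Psi(x,z;f)$ is convex, nonnegative and zero at $f=0$. They have first variations $\frac{\delta\Phi(x,z;f)}{\delta f}$ and $\frac{\delta\Psi(x,z;f)}{\delta f}$, which are finite signed measures on $\mathcal W$ satisfying $\frac{d}{d\varepsilon}\Phi(x,z;f+\varepsilon h)\big|_{\varepsilon=0}=\int h\,d\frac{\delta\Phi(x,z;f)}{\delta f}$ for all $f,h\in\mathcal F$, and likewise for $\Psi$; moreover $\frac{\delta\Psi}{\delta f}$ is linear in $f$. Write $\langle\kappa,G\rangle=\int G\,d\kappa$ and let $|\kappa|$ be the total variation of a signed measure $\kappa$. Let $\phi:\mathcal W\times\mathbb R^D\to\mathbb R$ and $\psi:\mathcal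 Z\times\mathbb R^D\to\mathbb R$ be neuron functions, measurable in the input and twice differentiable in the parameter, with $|\phi|\le B_0$, $\|\nabla_\theta\phi\|\le B_1$, $\|\nabla^2_{\theta\theta}\phi\|_F\le B_2$ and $|\psi|\le B_0$, $\|\nabla_\omega\psi\|\le B_1$, $\|\nabla^2_{\omega\omega}\psi\|_F\le B_2$ everywhere. Let $\alpha,\eta>0$ and $\lambda\ge0$. For probability measures $\mu,\nu$ on $\mathbb R^D$ put $f(\cdot;\mu)=\alpha\int\phi(\cdot;\theta)\,\mu(d\theta)$ and $g(\cdot;\nu)=\alpha\int\psi(\cdot;\omega)\,\nu(d\omega)$; for $\boldsymbol\theta,\boldsymbol\omega\in(\mathbb R^D)^N$ put $f(\cdot;\boldsymbol\theta)=\frac\alpha N\sum_i\phi(\cdot;\theta^i)$ and $g(\cdot;\boldsymbol\omega)=\frac\alpha N\sum_i\psi(\cdot;\omega^i)$. Assume that $f(\cdot;\mu)\in\mathcal F$ for every $\mu$ and that, for constants $C_0,C_2,C_\Psi>0$ and all $(x,z)$, $$|\Phi(x,z;0)|\le C_0,\qquad \Big|\tfrac{\delta\Phi(x,z;f)}{\delta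 f}\Big|(\mathcal W)\le C_2\quad(f\in\mathcal F),$$ and there is $w\in\mathcal W$, depending only on $(x,z)$, with $\big|\tfrac{\delta\Psi(x,z;f)}{\delta f}\big|(\mathcal W)\le C_\Psi|f(w)|$ for all $f\in\mathcal F$. For functions $f,g$ on $\mathcal W,\mathcal Z$ define $$V^f(x,z;f,g;\theta)=\alpha\Big[-g(z)\big\langle\tfrac{\delta\Phi(x,z;f)}{\delta f},\nabla_\theta\phi(\cdot;\theta)\big\rangle-\lambda\big\langle\tfrac{\delta\Psi(x,z;f)}{\delta f},\nabla_\theta\phi(\cdot;\theta)\big\rangle\Big],\qquad V^g(x,z;f,g;\omega)=\alpha\big[\Phi(x,z;f)-g(z)\big]\nabla_\omega\psi(z;\omega).$$ *SGDA.* Given a width $N\ge1$ and a stepsize scale $\epsilon>0$, let $\theta_0^i,\omega_0^i\sim\mathcal N(0,I_D)$ $(i\le N)$ and $(x_k,z_k)\sim\mathcal D$ $(k\ge0)$ all be independent, and let $$\theta^i_{k+1}=\theta^i_k+\eta\epsilon\,V^f(x_k,z_k;f(\cdot;\boldsymbol\theta_k),g(\cdot;\boldsymbol\omega_k);\theta^i_k),\qquad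 \omega^i_{k+1}=\omega^i_k+\eta\epsilon\,V^g(x_k,z_k;f(\cdot;\boldsymbol\theta_k),g(\cdot;\boldsymbol\omega_k);\omega^i_k),$$ with empirical distribution $\hat\rho_k=\frac1N\sum_{i=1}^N\delta_{(\theta_k^i,\omega_k^i)}$. *Mean-field limit.* Let $v^f(\theta;\mu,\nu)=\mathbb E_{\mathcal D}[V^f(X,Z;f(\cdot;\mu),g(\cdot;\nu);\theta)]$ and $v^g(\omega;\mu,\nu)=\mathbb E_{\mathcal D}[V^g(X,Z;f(\cdot;\mu),g(\cdot;\nu);\omega)]$, and let $\rho_t=\mu_t\otimes\nu_t$, where $(\mu_t,\nu_t)_{t\ge0}$ is a weak (distributional, narrowly continuous in $t$) solution, by probability measures on $\mathbb R^D$, of $$\partial_t\mu_t=-\eta\,\mathrm{div}_\theta\big(\mu_t\,v^f(\cdot;\mu_t,\nu_t)\big),\qquad\partial_t\nu_t=-\eta\,\mathrm{div}_\omega\big(\nu_t\,v^g(\cdot;\mu_t,\nu_t)\big),\qquad\mu_0=\nu_0=\mathcal N(0,I_D).$$ **Proposition.** There is a constant $B>0$ depending only on $\alpha,\eta,\lambda,B_0,B_1,B_2,C_0,C_2,C_\Psi$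 such that in every such setting the following hold. 1. As $\epsilon\to0^+$ and $N\to\infty$, $\hat\rho_{\lfloor t/\epsilon\rfloor}$ converges weakly to $\rho_t$, in probability, for every $t\ge0$: for every bounded continuous (in particular every bounded Lipschitz) $F:\mathbb R^D\times\mathbb R^D\to\mathbb R$, $\int F\,d\hat\rho_{\lfloor t/\epsilon\rfloor}\to\int F\,d\rho_t$ in probability. 2. For all $N\ge1$, $\epsilon>0$, $T>0$, $\delta>0$ and every $h:\mathbb R^D\times\mathbb R^D\to\mathbb R$ with $\|h\|_\infty\le1$ and $\mathrm{Lip}(h)\le1$ (Euclidean norm), with probability at least $1-5\delta$, $$\sup_{k\in\mathbb N,\;k\le T/\epsilon}\Big|\int h\,d\rho_{k\epsilon}-\int h\,d\hat\rho_k\Big|\le B\,e^{BT}\Big(\sqrt{\log(N/\delta)/N}+\sqrt{\epsilon\,(D+\log(N/\delta))}\Big).$$ (For $\delta\ge 1/5$ the claim is empty; a square root of a negative number, which can occur only then, is read as $0$.) -/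

import Mathlib

open MeasureTheory ProbabilityTheory Filter Topology
open scoped ENNReal

noncomputable section

namespace SGDAMeanField

/-- The parameter space `ℝ^D` of one neuron, with the Euclidean norm. -/
abbrev Param (D : ℕ) : Type := EuclideanSpace ℝ (Fin D)

/-- The signed measure `κ` is the first variation at `f` of the functional `G`, with test functions
in the function class `𝓕`: `d/dε G(f + ε h) = ∫ h dκ` at `ε = 0` for all `h ∈ 𝓕`.
(A variation that is a function is the signed measure with that density; a signed measure also
covers variations such as `2 f(x) δ_x`.) -/
def IsVariation {𝓦 : Type*} [MeasurableSpace 𝓦] (𝓕 : Submodule ℝ (𝓦 → ℝ))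
    (G : (𝓦 → ℝ) → ℝ) (f : 𝓦 → ℝ) (κ : SignedMeasure 𝓦) : Prop :=
  ∀ h ∈ 𝓕, κ.Integrable h ∧
    HasDerivAt (fun ε : ℝ => G (f + ε • h)) (∫ᵛ w, h w ∂<•κ) 0

/-- The functionals of a regularized functional conditional moment equation: a linear class `𝓕` of
measurable functions on `𝓦`, a moment functional `Φ(x, z; f)` that is affine in `f`, and a convex
nonnegative regularizer `Ψ(x, z; f)` vanishing at `f = 0`; `δΦ` and `δΨ` are their variations in
`f`, the second one being linear in `f`. -/
structure MomentProblem (𝓧 𝓩 𝓦 : Type*) [MeasurableSpace 𝓧] [MeasurableSpace 𝓩]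
    [MeasurableSpace 𝓦] where
  𝓕 : Submodule ℝ (𝓦 → ℝ)
  measurable_of_mem : ∀ f ∈ 𝓕, Measurable f
  Φ : 𝓧 → 𝓩 → (𝓦 → ℝ) → ℝ
  Ψ : 𝓧 → 𝓩 → (𝓦 → ℝ) → ℝ
  δΦ : 𝓧 → 𝓩 → (𝓦 → ℝ) → SignedMeasure 𝓦
  δΨ : 𝓧 → 𝓩 → (𝓦 → ℝ) → SignedMeasure 𝓦
  measurable_Φ : ∀ f ∈ 𝓕, Measurable fun u : 𝓧 × 𝓩 => Φ u.1 u.2 f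
  measurable_Ψ : ∀ f ∈ 𝓕, Measurable fun u : 𝓧 × 𝓩 => Ψ u.1 u.2 f
  affine_Φ : ∀ x z, ∀ f₁ ∈ 𝓕, ∀ f₂ ∈ 𝓕, ∀ a b : ℝ,
    Φ x z (a • f₁ + b • f₂) - Φ x z 0 = a * (Φ x z f₁ - Φ x z 0) + b * (Φ x z f₂ - Φ x z 0)
  convex_Ψ : ∀ x z, ConvexOn ℝ (𝓕 : Set (𝓦 → ℝ)) (Ψ x z)
  Ψ_zero : ∀ x z, Ψ x z 0 = 0
  Ψ_nonneg : ∀ x z, ∀ f ∈ 𝓕, 0 ≤ Ψ x z f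
  isVariation_Φ : ∀ x z, ∀ f ∈ 𝓕, IsVariation 𝓕 (Φ x z) f (δΦ x z f)
  isVariation_Ψ : ∀ x z, ∀ f ∈ 𝓕, IsVariation 𝓕 (Ψ x z) f (δΨ x z f)
  linear_δΨ : ∀ x z, ∀ f₁ ∈ 𝓕, ∀ f₂ ∈ 𝓕, ∀ a b : ℝ,
    δΨ x z (a • f₁ + b • f₂) = a • δΨ x z f₁ + b • δΨ x z f₂

/-- The neuron function `φ(s; θ)` is measurable in the input `s` and twice differentiable in the
parameter `θ`, and the function, its gradient (Euclidean norm) and its Hessian (Frobenius norm) are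
bounded by `B₀`, `B₁`, `B₂`. -/
structure RegularNeuron {S : Type*} [MeasurableSpace S] {D : ℕ} (B₀ B₁ B₂ : ℝ)
    (φ : S → Param D → ℝ) : Prop where
  measurable : ∀ θ, Measurable fun s => φ s θ
  differentiable : ∀ s, Differentiable ℝ (φ s)
  differentiable_gradient : ∀ s, Differentiable ℝ (gradient (φ s))
  bound : ∀ s θ, |φ s θ| ≤ B₀
  bound_gradient : ∀ s θ, ‖gradient (φ s) θ‖ ≤ B₁
  bound_hessian : ∀ s θ,
    √(∑ j, ‖fderiv ℝ (gradient (φ s)) θ (EuclideanSpace.single j (1 : ℝ))‖ ^ 2) ≤ B₂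

/-- The infinitely wide network `s ↦ α ∫ φ(s; θ) μ(dθ)`. -/
def wideNet {S : Type*} {D : ℕ} (α : ℝ) (φ : S → Param D → ℝ) (μ : Measure (Param D)) : S → ℝ :=
  fun s => α * ∫ θ, φ s θ ∂μ

/-- The network of width `N`, `s ↦ (α / N) ∑ i, φ(s; θ_i)`. -/
def finNet {S : Type*} {D N : ℕ} (α : ℝ) (φ : S → Param D → ℝ) (θ : Fin N → Param D) : S → ℝ :=
  fun s => α / N * ∑ i, φ s (θ i)

section Dynamics

variable {𝓧 𝓩 𝓦 : Type*} [MeasurableSpace 𝓧] [MeasurableSpace 𝓩] [MeasurableSpace 𝓦] {D : ℕ}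

/-- Integrability of the variations, boundedness of `Φ(·, ·; 0)`, and the networks are in the
function class. -/
structure BoundedFunctionals (P : MomentProblem 𝓧 𝓩 𝓦) (φ : 𝓦 → Param D → ℝ)
    (α C₀ C₂ CΨ : ℝ) : Prop where
  net_mem : ∀ μ : ProbabilityMeasure (Param D), wideNet α φ (μ : Measure (Param D)) ∈ P.𝓕
  bound_Φ_zero : ∀ x z, |P.Φ x z 0| ≤ C₀
  bound_δΦ : ∀ x z, ∀ f ∈ P.𝓕, (P.δΦ x z f).variation Set.univ ≤ ENNReal.ofReal C₂
  bound_δΨ : ∀ x z, ∃ w : 𝓦, ∀ f ∈ P.𝓕,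
    (P.δΨ x z f).variation Set.univ ≤ ENNReal.ofReal (CΨ * |f w|)

/-- The stochastic descent direction of a neuron `θ` of the primal network, at the data point
`(x, z)` and the current networks `f`, `g`. -/
def dirF (P : MomentProblem 𝓧 𝓩 𝓦) (φ : 𝓦 → Param D → ℝ) (α lam : ℝ) (u : 𝓧 × 𝓩)
    (f : 𝓦 → ℝ) (g : 𝓩 → ℝ) (θ : Param D) : Param D :=
  α • (-(g u.2 • ∫ᵛ w, gradient (φ w) θ ∂<•(P.δΦ u.1 u.2 f))
    - lam • ∫ᵛ w, gradient (φ w) θ ∂<•(P.δΨ u.1 u.2 f))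

/-- The stochastic ascent direction of a neuron `ω` of the dual network, at the data point `(x, z)`
and the current networks `f`, `g`. -/
def dirG (P : MomentProblem 𝓧 𝓩 𝓦) (ψ : 𝓩 → Param D → ℝ) (α : ℝ) (u : 𝓧 × 𝓩)
    (f : 𝓦 → ℝ) (g : 𝓩 → ℝ) (ω : Param D) : Param D :=
  α • (P.Φ u.1 u.2 f • gradient (ψ u.2) ω - g u.2 • gradient (ψ u.2) ω)

/-- The mean-field velocity `v^f(θ; μ, ν)`. -/
def velF (P : MomentProblem 𝓧 𝓩 𝓦) (𝓓 : Measure (𝓧 × 𝓩)) (φ : 𝓦 → Param D → ℝ)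
    (ψ : 𝓩 → Param D → ℝ) (α lam : ℝ) (μ ν : Measure (Param D)) (θ : Param D) : Param D :=
  ∫ u, dirF P φ α lam u (wideNet α φ μ) (wideNet α ψ ν) θ ∂𝓓

/-- The mean-field velocity `v^g(ω; μ, ν)`. -/
def velG (P : MomentProblem 𝓧 𝓩 𝓦) (𝓓 : Measure (𝓧 × 𝓩)) (φ : 𝓦 → Param D → ℝ)
    (ψ : 𝓩 → Param D → ℝ) (α : ℝ) (μ ν : Measure (Param D)) (ω : Param D) : Param D :=
  ∫ u, dirG P ψ α u (wideNet α φ μ) (wideNet α ψ ν) ω ∂𝓓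

/-- The narrowly continuous curve `m` of probability measures solves
`∂_t m_t = - η div (m_t v_t)` on `[0, ∞)` in the weak sense. -/
def IsWeakSolution (η : ℝ) (v : ℝ → Param D → Param D) (m : ℝ → ProbabilityMeasure (Param D)) :
    Prop :=
  ContinuousOn m (Set.Ici 0) ∧
    ∀ ζ : Param D → ℝ, ContDiff ℝ (⊤ : ℕ∞) ζ → HasCompactSupport ζ → ∀ t : ℝ, 0 ≤ t →
      ∫ θ, ζ θ ∂(m t : Measure (Param D)) = ∫ θ, ζ θ ∂(m 0 : Measure (Param D)) +
        η * ∫ s in (0 : ℝ)..t, ∫ θ, inner ℝ (gradient ζ θ) (v s θ) ∂(m s : Measure (Param D))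

/-- `(μ_t, ν_t)` solves the mean-field system
`∂_t μ_t = - η div (μ_t v^f(·; μ_t, ν_t))`, `∂_t ν_t = - η div (ν_t v^g(·; μ_t, ν_t))`
with standard Gaussian initial data. -/
structure IsMeanFieldSolution (P : MomentProblem 𝓧 𝓩 𝓦) (𝓓 : Measure (𝓧 × 𝓩))
    (φ : 𝓦 → Param D → ℝ) (ψ : 𝓩 → Param D → ℝ) (α lam η : ℝ)
    (μ ν : ℝ → ProbabilityMeasure (Param D)) : Prop where
  init_μ : (μ 0 : Measure (Param D)) = stdGaussian (Param D)
  init_ν : (ν 0 : Measure (Param D)) = stdGaussian (Param D)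
  pde_μ : IsWeakSolution η (fun t => velF P 𝓓 φ ψ α lam (μ t) (ν t)) μ
  pde_ν : IsWeakSolution η (fun t => velG P 𝓓 φ ψ α (μ t) (ν t)) ν

/-- The iterates `(θ_i(k), ω_i(k))`, `i < N`, of stochastic gradient descent-ascent with learning
rate `η` and stepsize scale `ε`, from the initial particles `s₀` and the data stream `u`. -/
def sgda {N : ℕ} (P : MomentProblem 𝓧 𝓩 𝓦) (φ : 𝓦 → Param D → ℝ) (ψ : 𝓩 → Param D → ℝ)
    (α lam η ε : ℝ) (s₀ : Fin N → Param D × Param D) (u : ℕ → 𝓧 × 𝓩) :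
    ℕ → Fin N → Param D × Param D
  | 0 => s₀
  | k + 1 => fun i =>
      let s := sgda P φ ψ α lam η ε s₀ u k
      let f := finNet α φ fun j => (s j).1
      let g := finNet α ψ fun j => (s j).2
      ((s i).1 + (η * ε) • dirF P φ α lam (u k) f g (s i).1,
        (s i).2 + (η * ε) • dirG P ψ α (u k) f g (s i).2)

/-- The joint law of the initial particles and the data stream: all `θ_i(0)`, `ω_i(0)` are standard
Gaussian, all `(x_k, z_k)` have law `𝓓`, and all of them are independent. -/
def sampleLaw (N D : ℕ) (𝓓 : Measure (𝓧 × 𝓩)) :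
    Measure ((Fin N → Param D × Param D) × (ℕ → 𝓧 × 𝓩)) :=
  (Measure.pi fun _ : Fin N => (stdGaussian (Param D)).prod (stdGaussian (Param D))).prod
    (Measure.infinitePi fun _ : ℕ => 𝓓)

end Dynamics

/-- The empirical distribution `N⁻¹ ∑ i, δ_{(θ_i, ω_i)}`. -/
def empirical {D N : ℕ} (s : Fin N → Param D × Param D) : Measure (Param D × Param D) :=
  (N : ℝ≥0∞)⁻¹ • ∑ i, Measure.dirac (s i)

end SGDAMeanField

end

/-! The proof is a coupling argument for a weakly interacting particle system. A direction of
stochastic gradient descent-ascent depends on the networks in an affine way: the pairing of `δΦ`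
with `∇φ` does not depend on `f`, the pairing of `δΨ` with `∇φ` is a multiple of a point evaluation
of `f`, and `Φ` is affine. Hence the direction at a network of width `N` is the average over `j` of
a pair interaction evaluated at single-neuron networks (`chain_eq_sgda`), and the mean-field
velocity is the average of the same interaction over the law (`integral_meanInteraction`). By the
bounds on neurons and functionals, this interaction is bounded and Lipschitz, uniformly in the data
(`lipschitzInteraction`).

The particles are compared with independent reference trajectories that start at the same Gaussian
points. The difference, an `N`-tuple with the `ℓ²` norm, has three sources, to which a discrete
Grönwall inequality applies (`norm_chain_sub_le`). The first is the martingale of the data noise.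
All neurons share each data point, so their noises are not independent, and the whole tuple is
treated as one vector of a Hilbert space; a maximal Azuma-Pinelis inequality, with constants
independent of the dimension, bounds it. The second is the fluctuation of averages over the
independent references, handled by Hoeffding-Pinelis and a union bound over the particles and a time
grid. The third is the consistency error of the reference trajectories.

The reference trajectories replace the characteristics of the mean-field equation. Only a weak
solution is given, and no uniqueness theorem is used. Instead, a fine Euler scheme for the velocity
along the solution is shown to push the Gaussian to within any prescribed accuracy of the solution,
tested on Lipschitz functions (`exists_flow`). The argument is dual: the mollified test function is
carried backwards through the Euler steps. It needs a velocity that is Lipschitz in time, which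
follows from the finite speed of the law in the equation.

The resulting error is `particleError`, valid outside an event of probability `3 * δ`. Its
polynomial factors in `T` are absorbed into an exponential for the quantitative bound. The dimension
enters only through `D ≥ 0`, which weakens the estimate. For the convergence statement, `T` and `δ`
are fixed while the error tends to zero; rescaling treats Lipschitz test functions, and Lipschitz
minorants of `F` and `-F` treat bounded continuous ones. -/

namespace SGDAMeanField

/-! ### Dimension-free martingale and i.i.d. concentration in Hilbert space. -/

section Concentration

/-- The power series of `cosh √r` in `r` has nonnegative coefficients, and each `r ^ n` is convex on
the half-line. -/
theorem cosh_sqrt_convex {s t a b : ℝ} (hs : 0 ≤ s) (ht : 0 ≤ t) (ha : 0 ≤ a) (hb : 0 ≤ b)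
    (hab : a + b = 1) :
    Real.cosh (√(a * s + b * t)) ≤ a * Real.cosh (√s) + b * Real.cosh (√t) := by
  have key : ∀ r : ℝ, 0 ≤ r → HasSum (fun n : ℕ => r ^ n / ((2 * n).factorial : ℝ))
      (Real.cosh (√r)) := by
    intro r hr
    have h := Real.hasSum_cosh (√r)
    simpa only [pow_mul, Real.sq_sqrt hr] using h
  have h1 := key (a * s + b * t) (by positivity)
  have h2 := ((key s hs).mul_left a).add ((key t ht).mul_left b)
  refine hasSum_le (fun n => ?_) h1 h2
  have hc := (convexOn_pow n).2 (x := s) (y := t) hs ht ha hb hab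
  simp only [smul_eq_mul] at hc
  calc (a * s + b * t) ^ n / ((2 * n).factorial : ℝ)
      ≤ (a * s ^ n + b * t ^ n) / ((2 * n).factorial : ℝ) := by gcongr
    _ = _ := by ring

variable {H : Type*} [NormedAddCommGroup H] [InnerProductSpace ℝ H]

/-- With `r = ‖x‖` and `τ = ⟪x, ξ⟫ / (r * c)`, the square of `‖x + ξ‖` is at most the mixture of `(r
+ c) ^ 2` and `(r - c) ^ 2` with weights `(1 ± τ) / 2`. Convexity of `cosh ∘ √` turns this into a
bound affine in `ξ`, whose linear part disappears for centred `ξ`. No smoothness of the norm is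
needed. -/
theorem exists_cosh_norm_add_le (x : H) {c : ℝ} (hc : 0 ≤ c) :
    ∃ ℓ : ℝ, ∀ ξ : H, ‖ξ‖ ≤ c →
      Real.cosh ‖x + ξ‖ ≤ Real.cosh ‖x‖ * Real.cosh c + ℓ * inner ℝ x ξ := by
  rcases hc.eq_or_lt with rfl | hc
  · refine ⟨0, fun ξ hξ => ?_⟩
    have : ξ = 0 := norm_le_zero_iff.mp hξ
    simp [this]
  rcases eq_or_ne x 0 with rfl | hx
  · refine ⟨0, fun ξ hξ => ?_⟩
    simpa [abs_of_pos hc] using Real.cosh_le_cosh.mpr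
      (by simpa [abs_of_pos hc] using hξ : |‖ξ‖| ≤ |c|)
  have hr : 0 < ‖x‖ := norm_pos_iff.mpr hx
  set r := ‖x‖
  refine ⟨Real.sinh r * Real.sinh c / (r * c), fun ξ hξ => ?_⟩
  set i := inner ℝ x ξ with hi
  have hi1 : |i| ≤ r * c := (abs_real_inner_le_norm x ξ).trans (by gcongr)
  set τ := i / (r * c) with hτ
  have hτ1 : |τ| ≤ 1 := by
    rw [hτ, abs_div, abs_of_pos (mul_pos hr hc)]
    exact div_le_one_of_le₀ hi1 (by positivity)
  have hτi : i = τ * (r * c) := by rw [hτ]; field_simp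
  have hb := abs_le.mp hτ1
  have hsq : ‖x + ξ‖ ^ 2 ≤ (1 + τ) / 2 * (r + c) ^ 2 + (1 - τ) / 2 * (r - c) ^ 2 := by
    rw [norm_add_sq_real, ← hi, hτi]
    nlinarith [pow_le_pow_left₀ (norm_nonneg ξ) hξ 2]
  have h1 : Real.cosh ‖x + ξ‖ ≤
      Real.cosh (√((1 + τ) / 2 * (r + c) ^ 2 + (1 - τ) / 2 * (r - c) ^ 2)) := by
    rw [Real.cosh_le_cosh, abs_of_nonneg (norm_nonneg _), abs_of_nonneg (Real.sqrt_nonneg _)]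
    exact Real.le_sqrt_of_sq_le hsq
  refine h1.trans ((cosh_sqrt_convex (sq_nonneg _) (sq_nonneg _) (by linarith) (by linarith)
    (by ring)).trans (le_of_eq ?_))
  rw [Real.sqrt_sq_eq_abs, Real.sqrt_sq_eq_abs, Real.cosh_abs, Real.cosh_abs, Real.cosh_add,
    Real.cosh_sub, hτ]
  field_simp
  ring

variable [MeasurableSpace H] [BorelSpace H] [SecondCountableTopology H] [CompleteSpace H]

/-- After integration only `cosh ‖x‖ * cosh c` survives, and `cosh c ≤ exp (c ^ 2 / 2)`. This is the
supermartingale step of Pinelis's method. -/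
theorem lintegral_cosh_norm_add_le {U : Type*} [MeasurableSpace U] (P : Measure U)
    [IsProbabilityMeasure P] {ξ : U → H} (hξ : Measurable ξ) {c : ℝ} (hc : ∀ u, ‖ξ u‖ ≤ c)
    (h0 : ∫ u, ξ u ∂P = 0) (x : H) :
    ∫⁻ u, ENNReal.ofReal (Real.cosh ‖x + ξ u‖) ∂P ≤
      ENNReal.ofReal (Real.exp (c ^ 2 / 2)) * ENNReal.ofReal (Real.cosh ‖x‖) := by
  obtain ⟨u₀⟩ := nonempty_of_isProbabilityMeasure P
  have hc0 : 0 ≤ c := (norm_nonneg _).trans (hc u₀)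
  obtain ⟨ℓ, hℓ⟩ := exists_cosh_norm_add_le x hc0
  have hint : Integrable ξ P :=
    Integrable.of_bound hξ.aestronglyMeasurable c (Eventually.of_forall hc)
  have hint2 : Integrable (fun u => Real.cosh ‖x‖ * Real.cosh c + ℓ * inner ℝ x (ξ u)) P :=
    (integrable_const _).add ((hint.const_inner x).const_mul ℓ)
  calc ∫⁻ u, ENNReal.ofReal (Real.cosh ‖x + ξ u‖) ∂P
      ≤ ∫⁻ u, ENNReal.ofReal (Real.cosh ‖x‖ * Real.cosh c + ℓ * inner ℝ x (ξ u)) ∂P :=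
        lintegral_mono fun u => ENNReal.ofReal_le_ofReal (hℓ _ (hc u))
    _ = ENNReal.ofReal (∫ u, Real.cosh ‖x‖ * Real.cosh c + ℓ * inner ℝ x (ξ u) ∂P) :=
        (ofReal_integral_eq_lintegral_ofReal hint2 (Eventually.of_forall fun u =>
          (Real.cosh_pos _).le.trans (hℓ _ (hc u)))).symm
    _ = ENNReal.ofReal (Real.cosh ‖x‖ * Real.cosh c) := by
        have hz : ∫ u, ℓ * inner ℝ x (ξ u) ∂P = 0 := by
          rw [integral_const_mul, integral_inner hint, h0, inner_zero_right, mul_zero]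
        rw [integral_add (integrable_const _) ((hint.const_inner x).const_mul ℓ), hz]
        simp
    _ ≤ ENNReal.ofReal (Real.exp (c ^ 2 / 2) * Real.cosh ‖x‖) := by
        apply ENNReal.ofReal_le_ofReal
        rw [mul_comm]
        gcongr
        exact Real.cosh_le_exp_half_sq c
    _ = _ := ENNReal.ofReal_mul (Real.exp_nonneg _)

variable {U : Type*} [MeasurableSpace U] {X : Type*}

/-- The trajectory of the random dynamical system `x ↦ step x u`, driven by the stream `u`. -/
def chain (step : X → U → X) (x : X) (u : ℕ → U) : ℕ → X
  | 0 => x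
  | k + 1 => step (chain step x u k) (u k)

-- Reading the recursion from the front allows an induction on the first draw instead of
-- conditioning on the past.
omit [MeasurableSpace U] in
theorem chain_succ_shift (step : X → U → X) (x : X) (u : ℕ → U) (k : ℕ) :
    chain step x u (k + 1) = chain step (step x (u 0)) (fun j => u (j + 1)) k := by
  induction k with
  | zero => rfl
  | succ k ih =>
    rw [chain, ih]
    rfl

theorem measurable_chain [MeasurableSpace X] {step : X → U → X}
    (hs : Measurable fun p : X × U => step p.1 p.2) (k : ℕ) :
    Measurable fun p : X × (ℕ → U) => chain step p.1 p.2 k := by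
  induction k with
  | zero => exact measurable_fst
  | succ k ih => exact hs.comp (ih.prodMk ((measurable_pi_apply k).comp measurable_snd))

/-- Splitting off the head of an i.i.d. sequence. -/
theorem infinitePi_map_cons (P : Measure U) [IsProbabilityMeasure P] :
    (P.prod (Measure.infinitePi fun _ : ℕ => P)).map
      (fun p : U × (ℕ → U) => fun k : ℕ => k.casesOn p.1 p.2) =
      Measure.infinitePi fun _ : ℕ => P := by
  have hm : Measurable (fun p : U × (ℕ → U) => fun k : ℕ =>
      (k.casesOn p.1 p.2 : U)) := by
    refine measurable_pi_lambda _ fun k => ?_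
    cases k with
    | zero => exact measurable_fst
    | succ k => exact (measurable_pi_apply k).comp measurable_snd
  refine Measure.eq_infinitePi _ fun s t ht => ?_
  classical
  obtain ⟨n, hn⟩ : ∃ n, s ⊆ Finset.range (n + 1) :=
    ⟨s.sup id, fun i hi => Finset.mem_range_succ_iff.mpr (Finset.le_sup (f := id) hi)⟩
  -- Padding with `univ` makes the index set an initial segment, from which coordinate `0` splits
  -- off.
  set t' : ℕ → Set U := fun i => if i ∈ s then t i else Set.univ with ht'
  have ht'm : ∀ i, MeasurableSet (t' i) := fun i => by
    simp only [ht']; split_ifs; exacts [ht i, MeasurableSet.univ]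
  have hset : Set.pi (s : Set ℕ) t = Set.pi (Finset.range (n + 1) : Set ℕ) t' := by
    ext x
    simp only [Set.mem_pi, Finset.mem_coe, ht']
    constructor
    · intro h i _
      by_cases hi : i ∈ s
      · simpa [hi] using h i hi
      · simp [hi]
    · intro h i hi
      simpa [hi] using h i (hn hi)
  have hprod : ∏ i ∈ s, P (t i) = ∏ i ∈ Finset.range (n + 1), P (t' i) := by
    rw [← Finset.prod_subset hn]
    · exact Finset.prod_congr rfl fun i hi => by simp [ht', hi]
    · intro i _ hi; simp [ht', hi]
  rw [hset, hprod, Finset.prod_range_succ', Measure.map_apply hm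
    (MeasurableSet.pi (Finset.countable_toSet _) fun i _ => ht'm i)]
  have hpre : (fun p : U × (ℕ → U) => fun k : ℕ => (k.casesOn p.1 p.2 : U)) ⁻¹'
      Set.pi (Finset.range (n + 1) : Set ℕ) t' =
      t' 0 ×ˢ Set.pi (Finset.range n : Set ℕ) (fun i => t' (i + 1)) := by
    ext ⟨a, b⟩
    simp only [Set.mem_preimage, Set.mem_pi, Finset.mem_coe, Finset.mem_range, Set.mem_prod]
    constructor
    · intro h
      exact ⟨h 0 (Nat.succ_pos n), fun i hi => h (i + 1) (by omega)⟩
    · rintro ⟨h0, h1⟩ i hi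
      cases i with
      | zero => exact h0
      | succ i => exact h1 i (by omega)
  rw [hpre, Measure.prod_prod, Measure.infinitePi_pi _ (fun i _ => ht'm (i + 1)), mul_comm]

/-- The first draw is independent of the rest, so the induction hypothesis, for an arbitrary
starting point, bounds the inner integral and `h` the outer one. This replaces conditional
expectations and filtrations. -/
theorem lintegral_chain_le [MeasurableSpace X] (P : Measure U) [IsProbabilityMeasure P]
    {step : X → U → X} (hs : Measurable fun p : X × U => step p.1 p.2) {G : X → ℝ≥0∞}
    (hG : Measurable G) {a : ℝ≥0∞} (h : ∀ x, ∫⁻ u, G (step x u) ∂P ≤ a * G x) (k : ℕ) (x : X) :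
    ∫⁻ u, G (chain step x u k) ∂(Measure.infinitePi fun _ : ℕ => P) ≤ a ^ k * G x := by
  induction k generalizing x with
  | zero => simp [chain]
  | succ k ih =>
    have hmc : Measurable (fun p : U × (ℕ → U) => fun k : ℕ => (k.casesOn p.1 p.2 : U)) := by
      refine measurable_pi_lambda _ fun k => ?_
      cases k with
      | zero => exact measurable_fst
      | succ k => exact (measurable_pi_apply k).comp measurable_snd
    have hm : Measurable fun u : ℕ → U => G (chain step x u (k + 1)) :=
      hG.comp ((measurable_chain hs (k + 1)).comp (measurable_const.prodMk measurable_id))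
    rw [← infinitePi_map_cons P, lintegral_map hm hmc]
    refine (lintegral_prod _ (hm.comp hmc).aemeasurable).trans_le ?_
    calc ∫⁻ v, ∫⁻ u, G (chain step x (fun k : ℕ => k.casesOn v u) (k + 1))
            ∂(Measure.infinitePi fun _ : ℕ => P) ∂P
        = ∫⁻ v, ∫⁻ u, G (chain step (step x v) u k) ∂(Measure.infinitePi fun _ : ℕ => P) ∂P := by
          simp only [chain_succ_shift]; rfl
      _ ≤ ∫⁻ v, a ^ k * G (step x v) ∂P := lintegral_mono fun v => ih _
      _ = a ^ k * ∫⁻ v, G (step x v) ∂P :=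
          lintegral_const_mul _ (hG.comp (hs.comp (measurable_const.prodMk measurable_id)))
      _ ≤ a ^ k * (a * G x) := by gcongr; exact h x
      _ = a ^ (k + 1) * G x := by ring

/-- **Maximal Azuma–Pinelis inequality** in a Hilbert space, for a martingale with increments
`ξ (x_k, u_k)` bounded by `c` along a random dynamical system. -/
theorem measure_exists_le_norm_sum_le [MeasurableSpace X] (P : Measure U) [IsProbabilityMeasure P]
    {step : X → U → X} (hs : Measurable fun p : X × U => step p.1 p.2)
    {ξ : X → U → H} (hξ : Measurable fun p : X × U => ξ p.1 p.2) {c : ℝ}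
    (hc : ∀ x u, ‖ξ x u‖ ≤ c) (h0 : ∀ x, ∫ u, ξ x u ∂P = 0) (x : X) (n : ℕ) {V r : ℝ}
    (hV : 0 < V) (hnV : n * c ^ 2 ≤ V) (hr : 0 < r) :
    (Measure.infinitePi fun _ : ℕ => P)
      {u | ∃ k ≤ n, r ≤ ‖∑ l ∈ Finset.range k, ξ (chain step x u l) (u l)‖} ≤
      ENNReal.ofReal (2 * Real.exp (-(r ^ 2) / (2 * V))) := by
  -- The state is enlarged by the partial sum, frozen once its norm reaches `r`. Its value at the
  -- final time then remembers any earlier crossing, so that Markov's inequality at time `n` yields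
  -- a maximal inequality.
  set step' : X × H → U → X × H := fun p u =>
    (step p.1 u, if r ≤ ‖p.2‖ then p.2 else p.2 + ξ p.1 u) with hstep'
  have hfr : MeasurableSet {p : (X × H) × U | r ≤ ‖p.1.2‖} :=
    measurableSet_le measurable_const (measurable_snd.comp measurable_fst).norm
  have hs' : Measurable fun p : (X × H) × U => step' p.1 p.2 := by
    refine Measurable.prodMk (hs.comp ((measurable_fst.comp measurable_fst).prodMk
      measurable_snd)) ?_
    refine Measurable.ite hfr (measurable_snd.comp measurable_fst) ?_
    exact (measurable_snd.comp measurable_fst).add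
      (hξ.comp ((measurable_fst.comp measurable_fst).prodMk measurable_snd))
  have hfirst : ∀ u k, (chain step' (x, 0) u k).1 = chain step x u k := by
    intro u k
    induction k with
    | zero => rfl
    | succ k ih => simp only [chain, hstep']; rw [ih]
  have hinv : ∀ u k, r ≤ ‖(chain step' (x, 0) u k).2‖ ∨
      ((chain step' (x, 0) u k).2 = ∑ l ∈ Finset.range k, ξ (chain step x u l) (u l) ∧
        ∀ j ≤ k, ‖∑ l ∈ Finset.range j, ξ (chain step x u l) (u l)‖ < r) := by
    intro u k
    have hsucc : ∀ k, (chain step' (x, 0) u (k + 1)).2 = if r ≤ ‖(chain step' (x, 0) u k).2‖ then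
        (chain step' (x, 0) u k).2 else (chain step' (x, 0) u k).2 +
          ξ (chain step' (x, 0) u k).1 (u k) := fun k => rfl
    induction k with
    | zero =>
      right
      refine ⟨by simp [chain], fun j hj => ?_⟩
      obtain rfl : j = 0 := by omega
      simpa using hr
    | succ k ih =>
      rcases ih with ih | ⟨ih1, ih2⟩
      · left
        rwa [hsucc, if_pos ih]
      · have hlt : ¬ r ≤ ‖(chain step' (x, 0) u k).2‖ := by
          rw [ih1]; exact not_le.mpr (ih2 k le_rfl)
        have hval : (chain step' (x, 0) u (k + 1)).2 =
            ∑ l ∈ Finset.range (k + 1), ξ (chain step x u l) (u l) := by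
          rw [hsucc, if_neg hlt, Finset.sum_range_succ, ih1, hfirst]
        by_cases hk : r ≤ ‖(chain step' (x, 0) u (k + 1)).2‖
        · exact Or.inl hk
        · refine Or.inr ⟨hval, fun j hj => ?_⟩
          rcases Nat.le_succ_iff.mp hj with hj | rfl
          · exact ih2 j hj
          · rw [← hval]; exact not_le.mp hk
  -- This choice minimizes the Chernoff exponent `V * θ ^ 2 / 2 - θ * r`.
  set θ := r / V with hθ
  have hθ0 : 0 < θ := by positivity
  set G : X × H → ℝ≥0∞ := fun p => ENNReal.ofReal (Real.cosh (θ * ‖p.2‖)) with hGdef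
  have hG : Measurable G :=
    (Real.continuous_cosh.measurable.comp (measurable_snd.norm.const_mul θ)).ennreal_ofReal
  set a := ENNReal.ofReal (Real.exp ((θ * c) ^ 2 / 2)) with ha
  have ha1 : 1 ≤ a := by
    rw [ha, ← ENNReal.ofReal_one]
    exact ENNReal.ofReal_le_ofReal (Real.one_le_exp (by positivity))
  have hstep : ∀ p, ∫⁻ u, G (step' p u) ∂P ≤ a * G p := by
    rintro ⟨y, m⟩
    by_cases hm : r ≤ ‖m‖
    · simp only [hGdef, hstep', if_pos hm]
      simp only [lintegral_const, measure_univ, mul_one]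
      exact le_mul_of_one_le_left zero_le ha1
    · simp only [hGdef, hstep', if_neg hm]
      have hmy : Measurable (fun u => θ • ξ y u) :=
        (hξ.comp (measurable_const.prodMk measurable_id)).const_smul θ
      have := lintegral_cosh_norm_add_le P hmy (c := θ * c) (fun u => by
        rw [norm_smul, Real.norm_of_nonneg hθ0.le]; gcongr; exact hc y u)
        (by rw [integral_smul, h0 y, smul_zero]) (θ • m)
      simpa only [← smul_add, norm_smul, Real.norm_of_nonneg hθ0.le] using this
  have hchain := lintegral_chain_le P hs' hG hstep n (x, 0)
  have hG0 : G (x, 0) = 1 := by simp [hGdef]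
  rw [hG0, mul_one] at hchain
  have hsub : {u | ∃ k ≤ n, r ≤ ‖∑ l ∈ Finset.range k, ξ (chain step x u l) (u l)‖} ⊆
      {u | ENNReal.ofReal (Real.cosh (θ * r)) ≤ G (chain step' (x, 0) u n)} := by
    rintro u ⟨k, hk, hrk⟩
    have : r ≤ ‖(chain step' (x, 0) u n).2‖ := by
      rcases hinv u n with h | ⟨-, h⟩
      · exact h
      · exact absurd hrk (not_le.mpr (h k hk))
    refine ENNReal.ofReal_le_ofReal (Real.cosh_le_cosh.mpr ?_)
    rw [abs_of_pos (by positivity), abs_of_nonneg (by positivity)]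
    gcongr
  have hmG : Measurable fun u : ℕ → U => G (chain step' (x, 0) u n) :=
    hG.comp ((measurable_chain hs' n).comp (measurable_const.prodMk measurable_id))
  have hcp : 0 < Real.cosh (θ * r) := Real.cosh_pos _
  calc _ ≤ (Measure.infinitePi fun _ : ℕ => P)
        {u | ENNReal.ofReal (Real.cosh (θ * r)) ≤ G (chain step' (x, 0) u n)} :=
        measure_mono hsub
    _ ≤ (∫⁻ u, G (chain step' (x, 0) u n) ∂(Measure.infinitePi fun _ : ℕ => P)) /
        ENNReal.ofReal (Real.cosh (θ * r)) :=
        meas_ge_le_lintegral_div hmG.aemeasurable (by simpa using hcp) ENNReal.ofReal_ne_top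
    _ ≤ a ^ n / ENNReal.ofReal (Real.cosh (θ * r)) := by gcongr
    _ = ENNReal.ofReal (Real.exp (n * ((θ * c) ^ 2 / 2)) / Real.cosh (θ * r)) := by
        rw [ENNReal.ofReal_div_of_pos hcp, Real.exp_nat_mul,
          ENNReal.ofReal_pow (Real.exp_nonneg _)]
    _ ≤ _ := by
        apply ENNReal.ofReal_le_ofReal
        have h1 : Real.exp (θ * r) / 2 ≤ Real.cosh (θ * r) := by
          rw [Real.cosh_eq]
          have := Real.exp_nonneg (-(θ * r))
          linarith
        have h2 : n * ((θ * c) ^ 2 / 2) ≤ θ * r + -(r ^ 2) / (2 * V) := by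
          have e1 : n * ((θ * c) ^ 2 / 2) = (n * c ^ 2) * (θ ^ 2 / 2) := by ring
          have e2 : θ * r + -(r ^ 2) / (2 * V) = V * (θ ^ 2 / 2) := by
            rw [hθ]; field_simp; ring
          rw [e1, e2]; gcongr
        rw [div_le_iff₀ hcp]
        calc Real.exp (n * ((θ * c) ^ 2 / 2)) ≤ Real.exp (θ * r + -(r ^ 2) / (2 * V)) :=
              Real.exp_le_exp.mpr h2
          _ = 2 * Real.exp (-(r ^ 2) / (2 * V)) * (Real.exp (θ * r) / 2) := by
              rw [Real.exp_add]; ring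
          _ ≤ _ := by gcongr

/-- **Hoeffding–Pinelis inequality** for i.i.d. centred bounded vectors of a Hilbert space. -/
theorem measure_pi_le_norm_sum_le {Q : Type*} [MeasurableSpace Q] (γ : Measure Q)
    [IsProbabilityMeasure γ] {ξ : Q → H} (hξ : Measurable ξ) {c : ℝ} (hc : ∀ q, ‖ξ q‖ ≤ c)
    (h0 : ∫ q, ξ q ∂γ = 0) (n : ℕ) {V r : ℝ} (hV : 0 < V) (hnV : n * c ^ 2 ≤ V) (hr : 0 < r) :
    (Measure.pi fun _ : Fin n => γ) {q | r ≤ ‖∑ j, ξ (q j)‖} ≤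
      ENNReal.ofReal (2 * Real.exp (-(r ^ 2) / (2 * V))) := by
  have hmap : (Measure.infinitePi fun _ : ℕ => γ).map (fun ω (i : Fin n) => ω (i : ℕ)) =
      Measure.pi fun _ : Fin n => γ := by
    rw [Measure.map_infinitePi_infinitePi_of_inj (P := fun _ : ℕ => γ) Fin.val_injective,
      Measure.infinitePi_eq_pi]
  have hmeas : MeasurableSet {q : Fin n → Q | r ≤ ‖∑ j, ξ (q j)‖} :=
    measurableSet_le measurable_const (Finset.measurable_sum _ fun j _ =>
      hξ.comp (measurable_pi_apply j)).norm
  rw [← hmap, Measure.map_apply (measurable_pi_lambda _ fun i => measurable_pi_apply _) hmeas]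
  -- An i.i.d. sum is a martingale driven by a system with a one-point state space.
  refine le_trans (measure_mono ?_) (measure_exists_le_norm_sum_le γ (X := Unit)
    (step := fun x _ => x) measurable_fst (ξ := fun _ q => ξ q) (hξ.comp measurable_snd)
    (fun _ q => hc q) (fun _ => h0) () n hV hnV hr)
  intro ω hω
  exact ⟨n, le_rfl, by simpa [← Fin.sum_univ_eq_sum_range (fun l => ξ (ω l)) n] using hω⟩

end Concentration

/-! ### Discrete Grönwall inequality and uniform fluctuations of empirical averages. -/

section InteractingParticles

/-- A discrete Grönwall inequality in summed form. -/
theorem le_mul_exp_of_le_add_sum {a : ℕ → ℝ} {A w z : ℝ} {n : ℕ} (hA : 0 ≤ A) (hw : 0 ≤ w)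
    (hz : 0 ≤ z) (h : ∀ k ≤ n, a k ≤ A + ∑ l ∈ Finset.range k, (w * a l + z)) :
    ∀ k ≤ n, a k ≤ (A + n * z) * Real.exp (w * n) := by
  have key : ∀ k ≤ n, A + ∑ l ∈ Finset.range k, (w * a l + z) ≤ (A + k * z) * (1 + w) ^ k := by
    intro k
    induction k with
    | zero => intro _; simp
    | succ k ih =>
      intro hk
      have h1 := ih (by omega)
      have h2 := h k (by omega)
      rw [Finset.sum_range_succ]
      have h3 : (1 : ℝ) ≤ (1 + w) ^ (k + 1) := one_le_pow₀ (by linarith)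
      push_cast
      calc A + (∑ l ∈ Finset.range k, (w * a l + z) + (w * a k + z))
          ≤ (1 + w) * (A + ∑ l ∈ Finset.range k, (w * a l + z)) + z := by nlinarith
        _ ≤ (1 + w) * ((A + k * z) * (1 + w) ^ k) + z * (1 + w) ^ (k + 1) := by
            gcongr
            exact le_mul_of_one_le_right hz h3
        _ = _ := by ring
  intro k hk
  refine (h k hk).trans ((key k hk).trans ?_)
  have hkn : (k : ℝ) ≤ n := by exact_mod_cast hk
  have h4 : (1 + w) ^ k ≤ Real.exp (w * n) := by
    calc (1 + w) ^ k ≤ (Real.exp w) ^ k := by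
          gcongr
          linarith [Real.add_one_le_exp w]
      _ = Real.exp (w * k) := by rw [← Real.exp_nat_mul, mul_comm]
      _ ≤ _ := by gcongr
  gcongr

variable {F : Type*} [NormedAddCommGroup F] [InnerProductSpace ℝ F]

omit [InnerProductSpace ℝ F] in
theorem norm_toLp_le {N : ℕ} {x : Fin N → F} {a : ℝ} (ha : 0 ≤ a) (h : ∀ i, ‖x i‖ ≤ a) :
    ‖WithLp.toLp 2 x‖ ≤ √N * a := by
  rw [PiLp.norm_eq_of_L2]
  refine Real.sqrt_le_iff.mpr ⟨by positivity, ?_⟩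
  calc ∑ i, ‖x i‖ ^ 2 ≤ ∑ _i : Fin N, a ^ 2 := by
        gcongr with i; exact h i
    _ = _ := by simp [mul_pow]

omit [InnerProductSpace ℝ F] in
theorem sum_norm_le {N : ℕ} (x : Fin N → F) : ∑ i, ‖x i‖ ≤ √N * ‖WithLp.toLp 2 x‖ := by
  rw [PiLp.norm_eq_of_L2, ← Real.sqrt_mul (by positivity)]
  refine Real.le_sqrt_of_sq_le ?_
  simpa using sq_sum_le_card_mul_sum_sq (s := Finset.univ) (f := fun i => ‖x i‖)

omit [InnerProductSpace ℝ F] in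
theorem norm_toLp_le_of_le_add {N : ℕ} {x y : Fin N → F} {a b : ℝ} (ha : 0 ≤ a) (hb : 0 ≤ b)
    (h : ∀ i, ‖y i‖ ≤ a * ‖x i‖ + b) :
    ‖WithLp.toLp 2 y‖ ≤ a * ‖WithLp.toLp 2 x‖ + √N * b := by
  have h1 : ‖WithLp.toLp 2 y‖ ≤ ‖WithLp.toLp 2 (fun i => a * ‖x i‖ + b)‖ := by
    rw [PiLp.norm_eq_of_L2, PiLp.norm_eq_of_L2]
    refine Real.sqrt_le_sqrt (Finset.sum_le_sum fun i _ => ?_)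
    simp only [Real.norm_eq_abs, sq_abs]
    exact pow_le_pow_left₀ (norm_nonneg _) (h i) 2
  have h2 : WithLp.toLp 2 (fun i => a * ‖x i‖ + b) =
      a • WithLp.toLp 2 (fun i => ‖x i‖) + WithLp.toLp 2 (fun _ : Fin N => b) := by
    ext i; simp
  have h3 : ‖WithLp.toLp 2 (fun i => ‖x i‖)‖ = ‖WithLp.toLp 2 x‖ := by
    rw [PiLp.norm_eq_of_L2, PiLp.norm_eq_of_L2]; simp
  calc _ ≤ _ := h1
    _ ≤ ‖a • WithLp.toLp 2 (fun i => ‖x i‖)‖ + ‖WithLp.toLp 2 (fun _ : Fin N => b)‖ := by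
        rw [h2]; exact norm_add_le _ _
    _ ≤ _ := by
        rw [norm_smul, h3, Real.norm_of_nonneg ha]
        gcongr
        exact norm_toLp_le hb fun i => by rw [Real.norm_of_nonneg hb]

variable {Q : Type*} [MeasurableSpace Q] (γ : Measure Q)

/-- The fluctuation of an empirical average of pair interactions around its mean. -/
noncomputable def fluct {N : ℕ} (g : Q → Q → F) (q : Fin N → Q) (i : Fin N) : F :=
  (N : ℝ)⁻¹ • ∑ j, g (q i) (q j) - ∫ q', g (q i) q' ∂γ

variable [IsProbabilityMeasure γ]

/-- Stability in the sup norm of the interaction; it transfers a fluctuation bound from a grid time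
to nearby times. -/
theorem norm_fluct_sub_le [CompleteSpace F] {N : ℕ} (hN : 0 < N) {g g' : Q → Q → F} {a : ℝ}
    (hg : ∀ q, Integrable (g q) γ) (hg' : ∀ q, Integrable (g' q) γ)
    (h : ∀ q q', ‖g q q' - g' q q'‖ ≤ a) (q : Fin N → Q) (i : Fin N) :
    ‖fluct γ g q i - fluct γ g' q i‖ ≤ 2 * a := by
  have e : fluct γ g q i - fluct γ g' q i =
      (N : ℝ)⁻¹ • ∑ j, (g (q i) (q j) - g' (q i) (q j)) -
        ∫ q', (g (q i) q' - g' (q i) q') ∂γ := by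
    rw [integral_sub (hg _) (hg' _), Finset.sum_sub_distrib, smul_sub, fluct, fluct]
    abel
  have hN' : (0 : ℝ) < N := by exact_mod_cast hN
  have h1 : ‖(N : ℝ)⁻¹ • ∑ j, (g (q i) (q j) - g' (q i) (q j))‖ ≤ a := by
    rw [norm_smul, Real.norm_of_nonneg (by positivity)]
    calc (N : ℝ)⁻¹ * ‖∑ j, (g (q i) (q j) - g' (q i) (q j))‖ ≤ (N : ℝ)⁻¹ * (N * a) := by
          gcongr
          exact (norm_sum_le_of_le _ fun j _ => h _ _).trans (by simp)
      _ = a := by field_simp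
  have h2 : ‖∫ q', (g (q i) q' - g' (q i) q') ∂γ‖ ≤ a := by
    simpa using norm_integral_le_of_norm_le_const (μ := γ) (Eventually.of_forall fun q' => h (q i) q')
  rw [e]
  exact (norm_sub_le _ _).trans (by linarith)

variable [MeasurableSpace F] [BorelSpace F] [SecondCountableTopology F] [CompleteSpace F]

/-- Given the value of particle `i`, the other `N - 1` terms are i.i.d. and centring makes
Hoeffding-Pinelis applicable. The self-interaction term contributes at most `2 * K / N`, which `4 *
K ≤ N * r` makes at most half of `r`. -/
theorem measure_le_norm_fluct_le {N : ℕ} {g : Q → Q → F}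
    (hg : Measurable fun p : Q × Q => g p.1 p.2) {K : ℝ} (hK : 0 < K)
    (hb : ∀ q q', ‖g q q'‖ ≤ K) (i : Fin N) {r : ℝ} (hr : 0 < r) (hrN : 4 * K ≤ N * r) :
    (Measure.pi fun _ : Fin N => γ) {q | r ≤ ‖fluct γ g q i‖} ≤
      ENNReal.ofReal (2 * Real.exp (-(N * r ^ 2) / (32 * K ^ 2))) := by
  obtain ⟨m, rfl⟩ : ∃ m, N = m + 1 := ⟨N - 1, by have := i.pos; omega⟩
  have hgm : Measurable fun x => ∫ q', g x q' ∂γ :=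
    (StronglyMeasurable.integral_prod_right' (f := fun p : Q × Q => g p.1 p.2)
      hg.stronglyMeasurable).measurable
  have hm0 : (0 : ℝ) < ((m + 1 : ℕ) : ℝ) := by positivity
  set A : Set (Q × (Fin m → Q)) := {p | r ≤ ‖(((m + 1 : ℕ) : ℝ))⁻¹ •
    (g p.1 p.1 + ∑ j, g p.1 (p.2 j)) - ∫ q', g p.1 q' ∂γ‖} with hA
  have hAm : MeasurableSet A := by
    refine measurableSet_le measurable_const (Measurable.norm (Measurable.sub (Measurable.const_smul
      (Measurable.add ?_ (Finset.measurable_sum _ fun j _ => ?_)) _) (hgm.comp measurable_fst)))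
    · exact hg.comp (measurable_fst.prodMk measurable_fst)
    · exact hg.comp (measurable_fst.prodMk ((measurable_pi_apply j).comp measurable_snd))
  have hmp := measurePreserving_piFinSuccAbove (fun _ : Fin (m + 1) => γ) i
  have hpre : {q : Fin (m + 1) → Q | r ≤ ‖fluct γ g q i‖} =
      (MeasurableEquiv.piFinSuccAbove (fun _ => Q) i) ⁻¹' A := by
    ext q
    simp only [Set.mem_ofPred_eq, Set.mem_preimage, hA, fluct, Fin.sum_univ_succAbove _ i]
    rfl
  rw [hpre, hmp.measure_preimage hAm.nullMeasurableSet, Measure.prod_apply hAm]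
  have hsec : ∀ x, (Measure.pi fun _ : Fin m => γ) (Prod.mk x ⁻¹' A) ≤
      ENNReal.ofReal (2 * Real.exp (-((m + 1 : ℕ) * r ^ 2) / (32 * K ^ 2))) := by
    intro x
    have hgx : Measurable (g x) := hg.comp (measurable_const.prodMk measurable_id)
    have hgi : Integrable (g x) γ :=
      Integrable.of_bound hgx.aestronglyMeasurable K (Eventually.of_forall (hb x))
    have hmean : ‖∫ q', g x q' ∂γ‖ ≤ K := by
      simpa using norm_integral_le_of_norm_le_const (μ := γ) (Eventually.of_forall (hb x))
    have hbd : ∀ y, ‖g x y - ∫ q', g x q' ∂γ‖ ≤ 2 * K := fun y =>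
      (norm_sub_le _ _).trans (by linarith [hb x y])
    refine le_trans (measure_mono ?_) ((measure_pi_le_norm_sum_le γ
      (hgx.sub_const (∫ q', g x q' ∂γ)) hbd (by
        rw [integral_sub hgi (integrable_const _)]; simp) m
      (V := ((m + 1 : ℕ) : ℝ) * (2 * K) ^ 2) (r := ((m + 1 : ℕ) : ℝ) * r / 2)
      (by positivity) (by gcongr; simp) (by positivity)).trans (le_of_eq ?_))
    · intro y hy
      simp only [hA, Set.mem_preimage, Set.mem_ofPred_eq] at hy ⊢
      have e : (((m + 1 : ℕ) : ℝ))⁻¹ • (g x x + ∑ j, g x (y j)) - ∫ q', g x q' ∂γ =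
          (((m + 1 : ℕ) : ℝ))⁻¹ • ((g x x - ∫ q', g x q' ∂γ) +
            ∑ j, (g x (y j) - ∫ q', g x q' ∂γ)) := by
        have : ∫ q', g x q' ∂γ = (((m + 1 : ℕ) : ℝ))⁻¹ •
            (((m + 1 : ℕ) : ℝ) • ∫ q', g x q' ∂γ) := by
          rw [smul_smul, inv_mul_cancel₀ hm0.ne', one_smul]
        rw [Finset.sum_sub_distrib, Finset.sum_const, Finset.card_univ, Fintype.card_fin]
        conv_lhs => rw [this]
        rw [← smul_sub]
        congr 1
        rw [← Nat.cast_smul_eq_nsmul ℝ]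
        push_cast
        rw [add_smul, one_smul]
        abel
      rw [e, norm_smul, Real.norm_of_nonneg (by positivity), inv_mul_eq_div,
        le_div_iff₀ hm0] at hy
      have := norm_add_le (g x x - ∫ q', g x q' ∂γ) (∑ j, (g x (y j) - ∫ q', g x q' ∂γ))
      linarith [hbd x]
    · congr 3
      field_simp
      ring
  calc _ ≤ ∫⁻ _x, ENNReal.ofReal (2 * Real.exp (-((m + 1 : ℕ) * r ^ 2) / (32 * K ^ 2))) ∂γ :=
        lintegral_mono hsec
    _ = _ := by simp

variable {E : Type*} [NormedAddCommGroup E] [InnerProductSpace ℝ E] [MeasurableSpace E]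
  [BorelSpace E] [SecondCountableTopology E] [CompleteSpace E]

/-- A grid of mesh `N^{-1/2}` in time: `p ε ≲ N^{-1/2}`, with few grid points. -/
theorem exists_grid {N : ℕ} (hN : 0 < N) {ε T : ℝ} (hε : 0 < ε) (hT : 0 ≤ T) {n : ℕ}
    (hn : n * ε ≤ T) :
    ∃ p : ℕ, 0 < p ∧ (p - 1 : ℝ) * ε ≤ 1 / √N ∧ ((n / p : ℕ) : ℝ) + 1 ≤ (2 * T + 1) * N := by
  have hN1 : (1 : ℝ) ≤ N := by exact_mod_cast hN
  have hs1 : 1 ≤ √(N : ℝ) := Real.one_le_sqrt.mpr hN1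
  have hsN : √(N : ℝ) ≤ N := by
    rw [Real.sqrt_le_left (by positivity)]; nlinarith
  -- The ideal number of steps per grid cell. Where it is below `1`, every step is a grid point and
  -- `p - 1 = 0`; this is why the mesh is measured by `(p - 1) * ε` and not by `p * ε`.
  set x : ℝ := 1 / (ε * √N) with hx
  have hx0 : 0 < x := by positivity
  have hxe : x * ε = 1 / √N := by rw [hx]; field_simp
  set p := max 1 ⌊x⌋₊ with hp
  have hp0 : 0 < p := by simp [hp]
  have hp0' : (0 : ℝ) < p := by exact_mod_cast hp0
  have hpx : x / 2 ≤ p := by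
    rcases le_or_gt 1 x with h | h
    · have h1 : 1 ≤ ⌊x⌋₊ := Nat.one_le_floor_iff x |>.mpr h
      have h2 := Nat.lt_floor_add_one x
      have h3 : ((⌊x⌋₊ : ℕ) : ℝ) ≤ p := by exact_mod_cast le_max_right _ _
      have h1' : (1 : ℝ) ≤ (⌊x⌋₊ : ℕ) := by exact_mod_cast h1
      linarith
    · have h3 : (1 : ℝ) ≤ p := by exact_mod_cast le_max_left _ _
      linarith
  refine ⟨p, hp0, ?_, ?_⟩
  · rw [← hxe]
    refine mul_le_mul_of_nonneg_right ?_ hε.le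
    rcases le_or_gt 1 ⌊x⌋₊ with h | h
    · have : p = ⌊x⌋₊ := max_eq_right h
      rw [this]
      linarith [Nat.floor_le hx0.le]
    · have : p = 1 := max_eq_left (by omega)
      rw [this]; push_cast; linarith
  · have h1 : ((n / p : ℕ) : ℝ) ≤ n / p := Nat.cast_div_le
    have h2 : (n : ℝ) / p ≤ 2 * T * √N := by
      rw [div_le_iff₀ hp0']
      have h3 : (n : ℝ) ≤ T / ε := by rw [le_div_iff₀ hε]; exact hn
      calc (n : ℝ) ≤ T / ε := h3
        _ = 2 * T * √N * (x / 2) := by rw [hx]; field_simp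
        _ ≤ _ := by gcongr
    nlinarith

omit [InnerProductSpace ℝ E] [MeasurableSpace E] [BorelSpace E]
  [SecondCountableTopology E] [CompleteSpace E] in
theorem norm_sub_le_of_speed {Q : Type*} {S : ℕ → Q → E} {a : ℝ} {n : ℕ}
    (hS : ∀ k < n, ∀ q, ‖S (k + 1) q - S k q‖ ≤ a) (q : Q) (l d : ℕ) (h : l + d ≤ n) :
    ‖S (l + d) q - S l q‖ ≤ d * a := by
  induction d with
  | zero => simp
  | succ d ih =>
    have h1 := ih (by omega)
    have h2 := hS (l + d) (by omega) q
    calc ‖S (l + (d + 1)) q - S l q‖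
        = ‖(S (l + d + 1) q - S (l + d) q) + (S (l + d) q - S l q)‖ := by
          rw [sub_add_sub_cancel, add_assoc]
      _ ≤ a + d * a := (norm_add_le _ _).trans (add_le_add h2 h1)
      _ = _ := by push_cast; ring

omit [InnerProductSpace ℝ E] [BorelSpace E] [SecondCountableTopology E] [CompleteSpace E] in
/-- Uniform in time and over the particles: the empirical averages of a bounded Lipschitz
interaction along the trajectories of independent labels concentrate around their means. -/
theorem measure_exists_lt_norm_fluct_le {N : ℕ} (hN : 0 < N) {β : E → E → F} {K L v : ℝ}
    (hK : 0 < K) (hL : 0 ≤ L) (hv : 0 ≤ v) (hb : ∀ s s', ‖β s s'‖ ≤ K)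
    (hlip : ∀ s s' t t', ‖β s s' - β t t'‖ ≤ L * (‖s - t‖ + ‖s' - t'‖))
    (hβ : Measurable fun p : E × E => β p.1 p.2) {ε T δ : ℝ} (hε : 0 < ε) (hT : 0 ≤ T)
    (hδ : 0 < δ) (hδ1 : δ ≤ 1) (hΛ : 1 ≤ Real.log (N / δ)) {n : ℕ} (hn : n * ε ≤ T)
    {S : ℕ → Q → E} (hSm : ∀ k, Measurable (S k))
    (hS : ∀ k < n, ∀ q, ‖S (k + 1) q - S k q‖ ≤ ε * v) :
    (Measure.pi fun _ : Fin N => γ) {q | ∃ l ≤ n, ∃ i,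
      4 * K * √(2 * (3 + 2 * T) * (Real.log (N / δ) / N)) + 4 * L * v / √N <
        ‖fluct γ (fun q q' => β (S l q) (S l q')) q i‖} ≤ ENNReal.ofReal δ := by
  obtain ⟨p, hp, hpε, hG⟩ := exists_grid hN hε hT hn
  have hN0 : (0 : ℝ) < N := by exact_mod_cast hN
  have hN1 : (1 : ℝ) ≤ N := by exact_mod_cast hN
  set Λ := Real.log (N / δ) with hΛdef
  -- This makes the Hoeffding exponent `N * r ^ 2 / (32 * K ^ 2)` equal to `(3 + 2 * T) * Λ`. Since
  -- `Λ ≥ 1`, two copies of `Λ` give `(δ / N) ^ 2`, which pays for `N` particles and a multiple of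
  -- `N` grid times, and the remaining `exp (-(1 + 2 * T))` pays for the factor `2 * T + 1` in the
  -- number of grid times.
  set r := 4 * K * √(2 * (3 + 2 * T) * (Λ / N)) with hr
  have hr0 : 0 < r := by positivity
  have hmeas : ∀ l, Measurable fun p : Q × Q => β (S l p.1) (S l p.2) := fun l =>
    hβ.comp (((hSm l).comp measurable_fst).prodMk ((hSm l).comp measurable_snd))
  have hint : ∀ l q, Integrable (fun q' => β (S l q) (S l q')) γ := fun l q =>
    Integrable.of_bound ((hmeas l).comp (measurable_const.prodMk
      measurable_id)).aestronglyMeasurable K (Eventually.of_forall fun _ => hb _ _)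
  have hsq : r ^ 2 = 32 * K ^ 2 * ((3 + 2 * T) * (Λ / N)) := by
    rw [hr, mul_pow, Real.sq_sqrt (by positivity)]; ring
  have hrN : 4 * K ≤ N * r := by
    have h1 : 1 / (N : ℝ) ≤ √(2 * (3 + 2 * T) * (Λ / N)) := by
      refine Real.le_sqrt_of_sq_le ?_
      have h2 : (1 : ℝ) ≤ 2 * (3 + 2 * T) * Λ := by nlinarith
      calc (1 / (N : ℝ)) ^ 2 = 1 / N * (1 / N) := by ring
        _ ≤ 1 * (1 / N) := by
            gcongr
            rw [div_le_one hN0]; exact hN1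
        _ ≤ 2 * (3 + 2 * T) * Λ * (1 / N) := by gcongr
        _ = _ := by ring
    rw [div_le_iff₀ hN0] at h1
    rw [hr]
    nlinarith
  set f : ℕ → (Fin N → Q) → Fin N → F := fun l => fluct γ (fun q q' => β (S l q) (S l q')) with hf
  -- Between grid times a reference point moves by at most `v / √N`. This changes the interaction by
  -- at most `2 * L * v / √N`, and the fluctuation by at most twice as much.
  have hsub : {q : Fin N → Q | ∃ l ≤ n, ∃ i, r + 4 * L * v / √N < ‖f l q i‖} ⊆
      ⋃ j ∈ Finset.range (n / p + 1), ⋃ i ∈ (Finset.univ : Finset (Fin N)),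
        {q | r ≤ ‖f (p * j) q i‖} := by
    rintro q ⟨l, hl, i, hli⟩
    simp only [Set.mem_iUnion, Finset.mem_range, Finset.mem_univ, Set.mem_ofPred_eq, exists_prop,
      true_and]
    refine ⟨l / p, Nat.lt_succ_iff.mpr (Nat.div_le_div_right hl), i, ?_⟩
    have hgap : ∀ q, ‖S l q - S (p * (l / p)) q‖ ≤ v / √N := by
      intro q
      have h1 := norm_sub_le_of_speed hS q (p * (l / p)) (l % p) (by rw [Nat.div_add_mod]; exact hl)
      rw [Nat.div_add_mod] at h1
      have h2 : ((l % p : ℕ) : ℝ) ≤ p - 1 := by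
        have : l % p + 1 ≤ p := Nat.mod_lt l hp
        have : ((l % p : ℕ) : ℝ) + 1 ≤ p := by exact_mod_cast this
        linarith
      calc _ ≤ _ := h1
        _ ≤ (p - 1 : ℝ) * (ε * v) := by gcongr
        _ = ((p - 1 : ℝ) * ε) * v := by ring
        _ ≤ (1 / √N) * v := by gcongr
        _ = _ := by ring
    have hd := norm_fluct_sub_le γ hN (hint l) (hint (p * (l / p))) (a := L * (2 * (v / √N)))
      (fun q q' => (hlip _ _ _ _).trans (by
        gcongr; linarith [hgap q, hgap q'])) q i
    have h3 := norm_le_insert' (f l q i) (f (p * (l / p)) q i)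
    have h4 : 2 * (L * (2 * (v / √N))) = 4 * L * v / √N := by ring
    rw [h4] at hd
    linarith
  have hexp : Real.exp (-(N * r ^ 2) / (32 * K ^ 2)) = Real.exp (-((3 + 2 * T) * Λ)) := by
    congr 1
    rw [hsq]
    field_simp
  have hΛe : Real.exp (-Λ) = δ / N := by
    rw [Real.exp_neg, hΛdef, Real.exp_log (by positivity), inv_div]
  have hfin : (2 * T + 1) * N * (N * (2 * Real.exp (-((3 + 2 * T) * Λ)))) ≤ δ := by
    have h1 : Real.exp (-((3 + 2 * T) * Λ)) ≤ (δ / N) ^ 2 * Real.exp (-(1 + 2 * T)) := by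
      rw [← hΛe, ← Real.exp_nat_mul, ← Real.exp_add]
      apply Real.exp_le_exp.mpr
      push_cast
      nlinarith
    have h2 : (2 * T + 1) * (2 * Real.exp (-(1 + 2 * T))) ≤ 1 := by
      have h3 : 2 * (1 + 2 * T) ≤ Real.exp (1 + 2 * T) := by
        have h4 := Real.add_one_le_exp (2 * T)
        have h5 : 2 ≤ Real.exp 1 := by linarith [Real.add_one_le_exp (1 : ℝ)]
        rw [Real.exp_add]
        nlinarith
      rw [Real.exp_neg]
      have h6 := Real.exp_pos (1 + 2 * T)
      have : (2 * T + 1) * (2 * (Real.exp (1 + 2 * T))⁻¹) =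
          (2 * (1 + 2 * T)) / Real.exp (1 + 2 * T) := by field_simp; ring
      rw [this, div_le_one h6]
      exact h3
    calc (2 * T + 1) * N * (N * (2 * Real.exp (-((3 + 2 * T) * Λ))))
        ≤ (2 * T + 1) * N * (N * (2 * ((δ / N) ^ 2 * Real.exp (-(1 + 2 * T))))) := by gcongr
      _ = ((2 * T + 1) * (2 * Real.exp (-(1 + 2 * T)))) * δ ^ 2 := by field_simp
      _ ≤ 1 * δ ^ 2 := by gcongr
      _ ≤ δ := by nlinarith
  calc _ ≤ _ := measure_mono hsub
    _ ≤ ∑ j ∈ Finset.range (n / p + 1), ∑ i : Fin N,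
        (Measure.pi fun _ : Fin N => γ) {q | r ≤ ‖f (p * j) q i‖} :=
        (measure_biUnion_finset_le _ _).trans
          (Finset.sum_le_sum fun j _ => measure_biUnion_finset_le _ _)
    _ ≤ ∑ j ∈ Finset.range (n / p + 1), ∑ i : Fin N,
        ENNReal.ofReal (2 * Real.exp (-((3 + 2 * T) * Λ))) := by
        refine Finset.sum_le_sum fun j _ => Finset.sum_le_sum fun i _ => ?_
        rw [← hexp]
        exact measure_le_norm_fluct_le γ (hmeas _) hK (fun _ _ => hb _ _) i hr0 hrN
    _ = ENNReal.ofReal ((((n / p : ℕ) : ℝ) + 1) *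
          (N * (2 * Real.exp (-((3 + 2 * T) * Λ))))) := by
        simp only [Finset.sum_const, Finset.card_univ, Fintype.card_fin, Finset.card_range,
          nsmul_eq_mul]
        rw [← Nat.cast_succ, ENNReal.ofReal_mul (Nat.cast_nonneg _),
          ENNReal.ofReal_mul (Nat.cast_nonneg _), ENNReal.ofReal_natCast, ENNReal.ofReal_natCast]
    _ ≤ ENNReal.ofReal δ := by
        apply ENNReal.ofReal_le_ofReal
        refine le_trans ?_ hfin
        gcongr

end InteractingParticles

/-! ### Propagation of chaos for stochastic gradient descent with a Lipschitz pair interaction. -/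

section InteractingSGD

set_option linter.unusedSectionVars false

variable {U : Type*} [MeasurableSpace U] {E : Type*} [NormedAddCommGroup E] [MeasurableSpace E]

/-- A stochastic pair interaction, bounded by `K` and `L`-Lipschitz in the two particles. -/
structure LipschitzInteraction (b : U → E → E → E) (K L : ℝ) : Prop where
  measurable : ∀ s s', Measurable fun u => b u s s'
  bound : ∀ u s s', ‖b u s s'‖ ≤ K
  lipschitz : ∀ u s s' t t', ‖b u s s' - b u t t'‖ ≤ L * (‖s - t‖ + ‖s' - t'‖)

variable [InnerProductSpace ℝ E]

/-- The mean of a stochastic pair interaction. -/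
noncomputable def meanInteraction (𝓓 : Measure U) (b : U → E → E → E) (s s' : E) : E :=
  ∫ u, b u s s' ∂𝓓

/-- One step of stochastic gradient descent for particles with pair interaction `b`. -/
noncomputable def interactStep {N : ℕ} (a : ℝ) (b : U → E → E → E) (s : Fin N → E) (u : U) :
    Fin N → E :=
  fun i => s i + a • ((N : ℝ)⁻¹ • ∑ j, b u (s i) (s j))

/-- The noise in one step of stochastic gradient descent. -/
noncomputable def interactNoise {N : ℕ} (𝓓 : Measure U) (a : ℝ) (b : U → E → E → E)
    (s : Fin N → E) (u : U) : PiLp 2 fun _ : Fin N => E :=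
  WithLp.toLp 2 fun i =>
    a • ((N : ℝ)⁻¹ • ∑ j, (b u (s i) (s j) - meanInteraction 𝓓 b (s i) (s j)))

variable [BorelSpace E] [SecondCountableTopology E] [CompleteSpace E]
  {𝓓 : Measure U} [IsProbabilityMeasure 𝓓] {b : U → E → E → E} {K L : ℝ}

theorem continuous_of_pair_lipschitz {F : Type*} [NormedAddCommGroup F] {β : E → E → F}
    (h : ∀ s s' t t', ‖β s s' - β t t'‖ ≤ L * (‖s - t‖ + ‖s' - t'‖)) :
    Continuous fun p : E × E => β p.1 p.2 := by
  have : LipschitzWith (Real.toNNReal (2 * L)) fun p : E × E => β p.1 p.2 := by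
    refine LipschitzWith.of_dist_le' fun p q => ?_
    rw [dist_eq_norm, dist_eq_norm]
    have h1 := norm_fst_le (p - q)
    have h2 := norm_snd_le (p - q)
    have h0 := h p.1 p.2 q.1 q.2
    rcases le_or_gt 0 L with hL | hL
    · refine h0.trans ?_
      simp only [Prod.fst_sub, Prod.snd_sub] at h1 h2
      nlinarith
    -- A negative `L` forces `E` to be a single point, so no sign condition is required.
    · have hz : ∀ s t : E, s = t := fun s t => by
        by_contra hne
        have h3 := h s s t s
        simp only [sub_self, norm_zero, add_zero] at h3
        have h4 : 0 < ‖s - t‖ := norm_pos_iff.mpr (sub_ne_zero.mpr hne)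
        nlinarith [norm_nonneg (β s s - β t s)]
      have : p = q := Prod.ext (hz _ _) (hz _ _)
      simp [this]
  exact this.continuous

namespace LipschitzInteraction

variable (hb : LipschitzInteraction b K L)
include hb

theorem continuous_pair (u : U) : Continuous fun p : E × E => b u p.1 p.2 :=
  continuous_of_pair_lipschitz (hb.lipschitz u)

/-- A Carathéodory function, continuous in the particles and measurable in the datum. -/
theorem measurable_joint : Measurable fun p : (E × E) × U => b p.2 p.1.1 p.1.2 :=
  measurable_uncurry_of_continuous_of_measurable (u := fun (p : E × E) u => b u p.1 p.2)
    hb.continuous_pair fun p => hb.measurable p.1 p.2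

theorem integrable (𝓓 : Measure U) [IsProbabilityMeasure 𝓓] (s s' : E) :
    Integrable (fun u => b u s s') 𝓓 :=
  Integrable.of_bound (hb.measurable s s').aestronglyMeasurable K
    (Eventually.of_forall fun u => hb.bound u s s')

theorem mean_bound (s s' : E) : ‖meanInteraction 𝓓 b s s'‖ ≤ K := by
  rw [meanInteraction]
  simpa using norm_integral_le_of_norm_le_const (μ := 𝓓)
    (Eventually.of_forall fun u => hb.bound u s s')

theorem mean_lipschitz (s s' t t' : E) :
    ‖meanInteraction 𝓓 b s s' - meanInteraction 𝓓 b t t'‖ ≤ L * (‖s - t‖ + ‖s' - t'‖) := by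
  rw [meanInteraction, meanInteraction, ← integral_sub (hb.integrable 𝓓 _ _) (hb.integrable 𝓓 _ _)]
  simpa using norm_integral_le_of_norm_le_const (μ := 𝓓)
    (Eventually.of_forall fun u => hb.lipschitz u s s' t t')

theorem measurable_mean : Measurable fun p : E × E => meanInteraction 𝓓 b p.1 p.2 :=
  (continuous_of_pair_lipschitz hb.mean_lipschitz).measurable

theorem measurable_interactStep {N : ℕ} (a : ℝ) :
    Measurable fun p : (Fin N → E) × U => interactStep a b p.1 p.2 := by
  refine measurable_pi_lambda _ fun i => ?_
  refine ((measurable_pi_apply i).comp measurable_fst).add (Measurable.const_smul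
    (Measurable.const_smul (Finset.measurable_sum _ fun j _ => ?_) _) _)
  have h1 : Measurable fun p : (Fin N → E) × U => (p.1 i, p.1 j) :=
    ((measurable_pi_apply i).comp measurable_fst).prodMk
      ((measurable_pi_apply j).comp measurable_fst)
  exact hb.measurable_joint.comp (h1.prodMk measurable_snd)

theorem measurable_interactNoise {N : ℕ} (a : ℝ) :
    Measurable fun p : (Fin N → E) × U => interactNoise 𝓓 a b p.1 p.2 := by
  refine (WithLp.measurable_toLp 2 _).comp (measurable_pi_lambda _ fun i => ?_)
  refine Measurable.const_smul (Measurable.const_smul (Finset.measurable_sum _ fun j _ => ?_) _) _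
  have h1 : Measurable fun p : (Fin N → E) × U => (p.1 i, p.1 j) :=
    ((measurable_pi_apply i).comp measurable_fst).prodMk
      ((measurable_pi_apply j).comp measurable_fst)
  exact (hb.measurable_joint.comp (h1.prodMk measurable_snd)).sub (hb.measurable_mean.comp h1)

/-- One datum drives all particles, so nothing is gained from independence between coordinates: the
noise has size `√N` times that of one coordinate. The normalization by `√N` in the final average
removes this factor. -/
theorem norm_interactNoise_le {N : ℕ} (hN : 0 < N) {a : ℝ} (ha : 0 ≤ a) (s : Fin N → E) (u : U) :
    ‖interactNoise 𝓓 a b s u‖ ≤ √N * (a * (2 * K)) := by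
  have hK : 0 ≤ K := (norm_nonneg _).trans (hb.bound u 0 0)
  refine norm_toLp_le (by positivity) fun i => ?_
  rw [norm_smul, norm_smul, Real.norm_of_nonneg ha, Real.norm_of_nonneg (by positivity)]
  refine mul_le_mul_of_nonneg_left ?_ ha
  have hN' : (0 : ℝ) < N := by exact_mod_cast hN
  calc (N : ℝ)⁻¹ * ‖∑ j, (b u (s i) (s j) - meanInteraction 𝓓 b (s i) (s j))‖
      ≤ (N : ℝ)⁻¹ * (N * (2 * K)) := by
        gcongr
        refine (norm_sum_le_of_le _ (fun j _ => (norm_sub_le _ _).trans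
          (add_le_add (hb.bound u _ _) (hb.mean_bound _ _)))).trans (le_of_eq ?_)
        simp
        ring
    _ = 2 * K := by field_simp

theorem integral_interactNoise {N : ℕ} (hN : 0 < N) {a : ℝ} (ha : 0 ≤ a) (s : Fin N → E) :
    ∫ u, interactNoise 𝓓 a b s u ∂𝓓 = 0 := by
  have hint : Integrable (interactNoise 𝓓 a b s) 𝓓 :=
    Integrable.of_bound ((hb.measurable_interactNoise a).comp
      (measurable_const.prodMk measurable_id)).aestronglyMeasurable _
      (Eventually.of_forall fun u => hb.norm_interactNoise_le hN ha s u)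
  ext i
  have h1 := (PiLp.proj 2 (𝕜 := ℝ) (fun _ : Fin N => E) i).integral_comp_comm hint
  simp only [PiLp.proj_apply] at h1
  rw [← h1]
  simp only [interactNoise, PiLp.zero_apply]
  have h2 : ∀ j ∈ Finset.univ, Integrable
      (fun u => b u (s i) (s j) - meanInteraction 𝓓 b (s i) (s j)) 𝓓 := fun j _ =>
    (hb.integrable 𝓓 _ _).sub (integrable_const _)
  rw [integral_smul, integral_smul, integral_finsetSum _ h2]
  rw [Finset.sum_eq_zero, smul_zero, smul_zero]
  intro j _
  rw [integral_sub (hb.integrable 𝓓 _ _) (integrable_const _)]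
  simp [meanInteraction]

variable {Q : Type*} [MeasurableSpace Q] {γ : Measure Q} [IsProbabilityMeasure γ]

/-- Pathwise stability: on the event that the martingale and the fluctuations are small, the
particles stay close to the independent reference trajectories `S k (q i)`. -/
theorem norm_chain_sub_le {N : ℕ} (hN : 0 < N) {a κ d m : ℝ} {n : ℕ} (ha : 0 ≤ a) (hL : 0 ≤ L)
    (hκ : 0 ≤ κ) (hd : 0 ≤ d) (hm : 0 ≤ m)
    {S : ℕ → Q → E}
    (hS : ∀ k < n, ∀ q, ‖S (k + 1) q - S k q -
      a • ∫ q', meanInteraction 𝓓 b (S k q) (S k q') ∂γ‖ ≤ a * κ)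
    {q : Fin N → Q} {u : ℕ → U}
    (hfl : ∀ k ≤ n, ∀ i,
      ‖fluct γ (fun q q' => meanInteraction 𝓓 b (S k q) (S k q')) q i‖ ≤ d)
    (hmart : ∀ k ≤ n, ‖∑ l ∈ Finset.range k,
      interactNoise 𝓓 a b (chain (interactStep a b) (fun i => S 0 (q i)) u l) (u l)‖ ≤ m) :
    ∀ k ≤ n, ‖WithLp.toLp 2 fun i => chain (interactStep a b) (fun i => S 0 (q i)) u k i -
      S k (q i)‖ ≤ (m + n * (√N * (a * (d + κ)))) * Real.exp (2 * L * a * n) := by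
  set p := chain (interactStep a b) (fun i => S 0 (q i)) u with hp
  set x : ℕ → Fin N → E := fun k i => p k i - S k (q i) with hx
  set β := meanInteraction 𝓓 b with hβ
  -- The predictable part of the increment of the difference; what is left of the increment is the
  -- centred noise.
  set e : ℕ → Fin N → E := fun l i =>
    a • ((N : ℝ)⁻¹ • ∑ j, β (p l i) (p l j)) - (S (l + 1) (q i) - S l (q i)) with he
  have hN' : (0 : ℝ) < N := by exact_mod_cast hN
  have hxk : ∀ k, WithLp.toLp 2 (x k) = ∑ l ∈ Finset.range k, interactNoise 𝓓 a b (p l) (u l) +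
      ∑ l ∈ Finset.range k, WithLp.toLp 2 (e l) := by
    intro k
    induction k with
    | zero => ext i; simp [hx, hp, chain]
    | succ k ih =>
      rw [Finset.sum_range_succ, Finset.sum_range_succ, add_add_add_comm, ← ih]
      ext i
      have : p (k + 1) i = p k i + a • ((N : ℝ)⁻¹ • ∑ j, b (u k) (p k i) (p k j)) := rfl
      simp only [hx, he, interactNoise, PiLp.add_apply, this, Finset.sum_sub_distrib, smul_sub]
      abel
  have hel : ∀ l < n, ‖WithLp.toLp 2 (e l)‖ ≤
      2 * L * a * ‖WithLp.toLp 2 (x l)‖ + √N * (a * (d + κ)) := by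
    intro l hl
    set avg := (N : ℝ)⁻¹ * ∑ j, ‖x l j‖ with havg
    have hcomp : ∀ i, ‖e l i‖ ≤ a * L * ‖x l i‖ + (a * L * avg + a * (d + κ)) := by
      intro i
      -- The drift of the difference splits into the Lipschitz response to the current difference,
      -- the fluctuation of the reference average, and the consistency error of the reference
      -- trajectory.
      have e1 : e l i = a • ((N : ℝ)⁻¹ • ∑ j, (β (p l i) (p l j) - β (S l (q i)) (S l (q j)))) +
          a • fluct γ (fun q q' => β (S l q) (S l q')) q i -
          (S (l + 1) (q i) - S l (q i) - a • ∫ q', β (S l (q i)) (S l q') ∂γ) := by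
        simp only [he, fluct, Finset.sum_sub_distrib, smul_sub]
        abel
      have h1 : ‖(N : ℝ)⁻¹ • ∑ j, (β (p l i) (p l j) - β (S l (q i)) (S l (q j)))‖ ≤
          L * (‖x l i‖ + avg) := by
        rw [norm_smul, Real.norm_of_nonneg (by positivity)]
        calc (N : ℝ)⁻¹ * ‖∑ j, (β (p l i) (p l j) - β (S l (q i)) (S l (q j)))‖
            ≤ (N : ℝ)⁻¹ * ∑ j, L * (‖x l i‖ + ‖x l j‖) := by
              gcongr
              exact norm_sum_le_of_le _ fun j _ => hb.mean_lipschitz _ _ _ _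
          _ = L * (‖x l i‖ + avg) := by
              rw [← Finset.mul_sum, Finset.sum_add_distrib, Finset.sum_const, Finset.card_univ,
                Fintype.card_fin, nsmul_eq_mul, havg]
              field_simp
      rw [e1]
      calc _ ≤ a * (L * (‖x l i‖ + avg)) + a * d + a * κ := by
            refine (norm_sub_le _ _).trans (add_le_add ((norm_add_le _ _).trans
              (add_le_add ?_ ?_)) (hS l hl _))
            · rw [norm_smul, Real.norm_of_nonneg ha]; gcongr
            · rw [norm_smul, Real.norm_of_nonneg ha]
              have := hfl l hl.le i
              gcongr
        _ = _ := by ring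
    have havg0 : 0 ≤ avg := by positivity
    have h2 := norm_toLp_le_of_le_add (by positivity) (by positivity) hcomp
    -- By Cauchy-Schwarz, the mean-field term is again controlled by the `ℓ²` norm; hence the
    -- constant `2 * L` in the Grönwall exponent.
    have h3 : √N * avg ≤ ‖WithLp.toLp 2 (x l)‖ := by
      have h4 := sum_norm_le (x l)
      have h5 : √(N : ℝ) * √N = N := Real.mul_self_sqrt hN'.le
      calc √N * avg ≤ √N * ((N : ℝ)⁻¹ * (√N * ‖WithLp.toLp 2 (x l)‖)) := by
            rw [havg]; gcongr
        _ = (√N * √N) * (N : ℝ)⁻¹ * ‖WithLp.toLp 2 (x l)‖ := by ring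
        _ = _ := by rw [h5]; field_simp
    calc _ ≤ _ := h2
      _ = a * L * ‖WithLp.toLp 2 (x l)‖ + a * L * (√N * avg) + √N * (a * (d + κ)) := by ring
      _ ≤ a * L * ‖WithLp.toLp 2 (x l)‖ + a * L * ‖WithLp.toLp 2 (x l)‖ +
          √N * (a * (d + κ)) := by gcongr
      _ = _ := by ring
  refine le_mul_exp_of_le_add_sum (a := fun k => ‖WithLp.toLp 2 (x k)‖) hm (by positivity)
    (by positivity) fun k hk => ?_
  show ‖WithLp.toLp 2 (x k)‖ ≤ _
  rw [hxk]
  refine (norm_add_le _ _).trans (add_le_add (hmart k hk) (norm_sum_le_of_le _ fun l hl => ?_))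
  exact hel l ((Finset.mem_range.mp hl).trans_le hk)

/-- The level solves `r ^ 2 / (2 * V) = log (2 / δ)`, where `V` is the number `T / ε` of steps times
the squared noise bound. -/
theorem measure_exists_lt_norm_sum_noise {N : ℕ} (hN : 0 < N) {η ε T δ : ℝ} (hK : 0 < K)
    (hη : 0 < η) (hε : 0 < ε) (hT : 0 < T) (hδ : 0 < δ) (hδ1 : δ ≤ 1) {n : ℕ} (hn : n * ε ≤ T)
    (s : Fin N → E) :
    (Measure.infinitePi fun _ : ℕ => 𝓓) {u | ∃ k ≤ n,
      √N * (2 * η * K * √(2 * T * (ε * Real.log (2 / δ)))) ≤ ‖∑ l ∈ Finset.range k,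
        interactNoise 𝓓 (η * ε) b (chain (interactStep (η * ε) b) s u l) (u l)‖} ≤
      ENNReal.ofReal δ := by
  have hN' : (0 : ℝ) < N := by exact_mod_cast hN
  have hlog : 0 < Real.log (2 / δ) := Real.log_pos (by rw [lt_div_iff₀ hδ]; linarith)
  refine (measure_exists_le_norm_sum_le 𝓓 (hb.measurable_interactStep (η * ε))
    (hb.measurable_interactNoise (η * ε)) (hb.norm_interactNoise_le hN (by positivity))
    (hb.integral_interactNoise hN (by positivity)) s n
    (V := T / ε * (√N * (η * ε * (2 * K))) ^ 2) (by positivity) ?_ (by positivity)).trans ?_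
  · gcongr
    rw [le_div_iff₀ hε]
    exact hn
  · apply ENNReal.ofReal_le_ofReal
    have : -((√N * (2 * η * K * √(2 * T * (ε * Real.log (2 / δ))))) ^ 2) /
        (2 * (T / ε * (√N * (η * ε * (2 * K))) ^ 2)) = - Real.log (2 / δ) := by
      simp only [mul_pow]
      rw [Real.sq_sqrt (by positivity), Real.sq_sqrt (by positivity)]
      field_simp
    rw [this, Real.exp_neg, Real.exp_log (by positivity)]
    apply le_of_eq
    field_simp

/-- The bound at a fixed starting configuration is uniform, so Fubini extends it to random initial
particles independent of the data. -/
theorem measure_prod_exists_lt_norm_sum_noise {N : ℕ} (hN : 0 < N) {η ε T δ : ℝ} (hK : 0 < K)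
    (hη : 0 < η) (hε : 0 < ε) (hT : 0 < T) (hδ : 0 < δ) (hδ1 : δ ≤ 1) {n : ℕ} (hn : n * ε ≤ T)
    {S₀ : Q → E} (hS₀ : Measurable S₀) :
    ((Measure.pi fun _ : Fin N => γ).prod (Measure.infinitePi fun _ : ℕ => 𝓓)) {ω | ∃ k ≤ n,
      √N * (2 * η * K * √(2 * T * (ε * Real.log (2 / δ)))) ≤ ‖∑ l ∈ Finset.range k,
        interactNoise 𝓓 (η * ε) b
          (chain (interactStep (η * ε) b) (fun i => S₀ (ω.1 i)) ω.2 l) (ω.2 l)‖} ≤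
      ENNReal.ofReal δ := by
  have hpm : ∀ l, Measurable fun ω : (Fin N → Q) × (ℕ → U) =>
      chain (interactStep (η * ε) b) (fun i => S₀ (ω.1 i)) ω.2 l := fun l =>
    (measurable_chain (hb.measurable_interactStep (η * ε)) l).comp
      ((measurable_pi_lambda _ fun i => hS₀.comp
        ((measurable_pi_apply i).comp measurable_fst)).prodMk measurable_snd)
  have hM : ∀ k, Measurable fun ω : (Fin N → Q) × (ℕ → U) => ‖∑ l ∈ Finset.range k,
      interactNoise 𝓓 (η * ε) b
        (chain (interactStep (η * ε) b) (fun i => S₀ (ω.1 i)) ω.2 l) (ω.2 l)‖ := fun k =>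
    (Finset.measurable_sum _ fun l _ => (hb.measurable_interactNoise (η * ε)).comp
      ((hpm l).prodMk ((measurable_pi_apply l).comp measurable_snd))).norm
  generalize hr : √(N : ℝ) * (2 * η * K * √(2 * T * (ε * Real.log (2 / δ)))) = r
  rw [Measure.prod_apply]
  · refine (lintegral_mono (g := fun _ => ENNReal.ofReal δ) fun q => ?_).trans_eq (by simp)
    have h := hb.measure_exists_lt_norm_sum_noise (𝓓 := 𝓓) hN hK hη hε hT hδ hδ1 hn
      (fun i => S₀ (q i))
    rw [hr] at h
    exact h
  · simp only [← exists_prop]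
    simp only [Set.ofPred_exists]
    exact MeasurableSet.iUnion fun k => MeasurableSet.iUnion fun _ =>
      measurableSet_le measurable_const (hM k)

/-- The deterministic part of the argument. The average over the independent references lies between
the two quantities: its distance to the mean is the sampling error `d'`, and its distance to the
particle average is controlled by the `ℓ²` stability estimate, since `h` is Lipschitz. -/
theorem abs_integral_sub_average_le {N : ℕ} (hN : 0 < N) {η ε T d d' m κ : ℝ}
    (hL : 0 ≤ L) (hη : 0 < η) (hε : 0 < ε) (hκ : 0 ≤ κ) (hd : 0 ≤ d) (hm : 0 ≤ m)
    {n : ℕ} (hn : n * ε ≤ T) {S : ℕ → Q → E}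
    (hS : ∀ k < n, ∀ q, ‖S (k + 1) q - S k q -
      (η * ε) • ∫ q', meanInteraction 𝓓 b (S k q) (S k q') ∂γ‖ ≤ η * ε * κ)
    {h : E → ℝ} (hlip : ∀ s t, |h s - h t| ≤ ‖s - t‖) {q : Fin N → Q} {u : ℕ → U}
    (hfl : ∀ k ≤ n, ∀ i,
      ‖fluct γ (fun q q' => meanInteraction 𝓓 b (S k q) (S k q')) q i‖ ≤ d)
    (hflh : ∀ k ≤ n, ∀ i, ‖fluct γ (fun _ q' => h (S k q')) q i‖ ≤ d')
    (hmart : ∀ k ≤ n, ‖∑ l ∈ Finset.range k, interactNoise 𝓓 (η * ε) b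
      (chain (interactStep (η * ε) b) (fun i => S 0 (q i)) u l) (u l)‖ ≤ √N * m)
    {k : ℕ} (hk : k ≤ n) :
    |(∫ q, h (S k q) ∂γ) - (N : ℝ)⁻¹ *
      ∑ i, h (chain (interactStep (η * ε) b) (fun i => S 0 (q i)) u k i)| ≤
      d' + (m + η * T * (d + κ)) * Real.exp (2 * L * η * T) := by
  have hN' : (0 : ℝ) < N := by exact_mod_cast hN
  have hst := hb.norm_chain_sub_le hN (a := η * ε) (by positivity) hL hκ hd (by positivity) hS
    hfl hmart k hk
  generalize chain (interactStep (η * ε) b) (fun i => S 0 (q i)) u k = p at hst ⊢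
  set x : Fin N → E := fun i => p i - S k (q i) with hx
  set R := (m + η * T * (d + κ)) * Real.exp (2 * L * η * T) with hR
  have hst' : ‖WithLp.toLp 2 x‖ ≤ √N * R := by
    refine hst.trans ?_
    have e1 : √N * m + n * (√N * (η * ε * (d + κ))) =
        √N * (m + η * (n * ε) * (d + κ)) := by ring
    have e2 : 2 * L * (η * ε) * n = 2 * L * η * (n * ε) := by ring
    have hT : 0 ≤ T := le_trans (by positivity) hn
    rw [e1, e2, mul_assoc, hR]
    gcongr
  have hfl' := hflh k hk (⟨0, hN⟩ : Fin N)
  simp only [fluct, smul_eq_mul, Real.norm_eq_abs] at hfl'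
  have hdiff : |(N : ℝ)⁻¹ * ∑ i, h (S k (q i)) - (N : ℝ)⁻¹ * ∑ i, h (p i)| ≤ R := by
    rw [← mul_sub, ← Finset.sum_sub_distrib, abs_mul, abs_of_nonneg (by positivity)]
    have h5 : √(N : ℝ) * √N = N := Real.mul_self_sqrt hN'.le
    calc (N : ℝ)⁻¹ * |∑ i, (h (S k (q i)) - h (p i))| ≤ (N : ℝ)⁻¹ * ∑ i, ‖x i‖ := by
          gcongr
          refine (Finset.abs_sum_le_sum_abs _ _).trans (Finset.sum_le_sum fun i _ => ?_)
          rw [abs_sub_comm]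
          exact hlip _ _
      _ ≤ (N : ℝ)⁻¹ * (√N * (√N * R)) := by
          gcongr
          exact (sum_norm_le x).trans (by gcongr)
      _ = (N : ℝ)⁻¹ * (√N * √N) * R := by ring
      _ = R := by rw [h5]; field_simp
  have htri := abs_sub_le (∫ q, h (S k q) ∂γ) ((N : ℝ)⁻¹ * ∑ i, h (S k (q i)))
    ((N : ℝ)⁻¹ * ∑ i, h (p i))
  rw [abs_sub_comm] at hfl'
  linarith

/-- **Propagation of chaos** with explicit constants for stochastic gradient descent of pairwise
interacting particles. -/
theorem measure_exists_lt_abs_sub_le {N : ℕ} (hN : 0 < N) {η ε T δ κ : ℝ} (hK : 0 < K)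
    (hL : 0 ≤ L) (hη : 0 < η) (hε : 0 < ε) (hT : 0 < T) (hδ : 0 < δ) (hδ1 : δ ≤ 1)
    (hΛ : 1 ≤ Real.log (N / δ)) (hκ : 0 ≤ κ) {n : ℕ} (hn : n * ε ≤ T) {S : ℕ → Q → E}
    (hSm : ∀ k, Measurable (S k))
    (hS : ∀ k < n, ∀ q, ‖S (k + 1) q - S k q‖ ≤ ε * (η * K))
    (hS' : ∀ k < n, ∀ q, ‖S (k + 1) q - S k q -
      (η * ε) • ∫ q', meanInteraction 𝓓 b (S k q) (S k q') ∂γ‖ ≤ η * ε * κ)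
    {h : E → ℝ} (hh : ∀ s, |h s| ≤ 1) (hlip : ∀ s t, |h s - h t| ≤ ‖s - t‖) :
    ((Measure.pi fun _ : Fin N => γ).prod (Measure.infinitePi fun _ : ℕ => 𝓓)) {ω | ∃ k ≤ n,
      4 * 1 * √(2 * (3 + 2 * T) * (Real.log (N / δ) / N)) + 4 * 1 * (η * K) / √N +
      (2 * η * K * √(2 * T * (ε * Real.log (2 / δ))) +
        η * T * (4 * K * √(2 * (3 + 2 * T) * (Real.log (N / δ) / N)) + 4 * L * (η * K) / √N + κ)) *
        Real.exp (2 * L * η * T) <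
      |(∫ q, h (S k q) ∂γ) -
        (N : ℝ)⁻¹ * ∑ i, h (chain (interactStep (η * ε) b) (fun i => S 0 (ω.1 i)) ω.2 k i)|} ≤
      ENNReal.ofReal (3 * δ) := by
  have hhc : Continuous h := by
    have : LipschitzWith 1 h := LipschitzWith.of_dist_le_mul fun s t => by
      simpa [Real.dist_eq, dist_eq_norm] using hlip s t
    exact this.continuous
  have hP₂ := measure_exists_lt_norm_fluct_le γ hN hK hL (by positivity) (hb.mean_bound (𝓓 := 𝓓))
    hb.mean_lipschitz hb.measurable_mean hε hT.le hδ hδ1 hΛ hn hSm hS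
  -- The test function is viewed as an interaction that ignores its first argument, so its sampling
  -- error is covered by the same uniform estimate.
  have hP₃ := measure_exists_lt_norm_fluct_le γ (β := fun (_ : E) (s' : E) => h s') hN one_pos
      zero_le_one (by positivity) (fun _ s' => hh s') (fun s s' t t' => by
        rw [one_mul]; exact (hlip s' t').trans (le_add_of_nonneg_left (norm_nonneg (s - t))))
      (hhc.measurable.comp measurable_snd) hε hT.le hδ hδ1 hΛ hn hSm hS
  have hP₁ := hb.measure_prod_exists_lt_norm_sum_noise (𝓓 := 𝓓) (γ := γ) hN hK hη hε hT hδ hδ1 hn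
    (hSm 0)
  have hd0 : 0 ≤ 4 * K * √(2 * (3 + 2 * T) * (Real.log (N / δ) / N)) +
    4 * L * (η * K) / √N := by positivity
  have hm0 : 0 ≤ 2 * η * K * √(2 * T * (ε * Real.log (2 / δ))) := by positivity
  generalize 4 * K * √(2 * (3 + 2 * T) * (Real.log (N / δ) / N)) + 4 * L * (η * K) / √N = d
    at hP₂ hd0 ⊢
  generalize 4 * 1 * √(2 * (3 + 2 * T) * (Real.log (N / δ) / N)) + 4 * 1 * (η * K) / √N = d'
    at hP₃ ⊢
  generalize 2 * η * K * √(2 * T * (ε * Real.log (2 / δ))) = m at hP₁ hm0 ⊢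
  have hprod : ∀ A : Set (Fin N → Q), ((Measure.pi fun _ : Fin N => γ).prod
      (Measure.infinitePi fun _ : ℕ => 𝓓)) (A ×ˢ Set.univ) =
      (Measure.pi fun _ : Fin N => γ) A := fun A => by
    rw [Measure.prod_prod, measure_univ, mul_one]
  refine le_trans (measure_mono ?_) ((measure_union_le _ _).trans ((add_le_add hP₁
    ((measure_union_le _ _).trans (add_le_add ((hprod _).le.trans hP₂)
      ((hprod _).le.trans hP₃)))).trans_eq ?_))
  · rintro ω ⟨k, hk, hlt⟩
    by_contra hω
    simp only [Set.mem_union, Set.mem_prod, Set.mem_univ, and_true, not_or, Set.mem_ofPred_eq,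
      not_exists, not_and, not_le, not_lt] at hω
    exact absurd hlt (not_lt.mpr (hb.abs_integral_sub_average_le hN hL hη hε hκ hd0 hm0 hn hS' hlip
      hω.2.1 hω.2.2 (fun k hk => (hω.1 k hk).le) hk))
  · rw [← ENNReal.ofReal_add hδ.le hδ.le, ← ENNReal.ofReal_add hδ.le (by positivity)]
    congr 1; ring

end LipschitzInteraction

end InteractingSGD

/-! ### Mollified Lipschitz test functions. -/

section Mollification

variable {D : ℕ}

/-- `ζ` is compactly supported and `A`-Lipschitz. -/
structure IsLipschitzBump (A : ℝ) (ζ : Param D → ℝ) : Prop where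
  nonneg : 0 ≤ A
  lipschitz : ∀ x y, |ζ x - ζ y| ≤ A * ‖x - y‖
  hasCompactSupport : HasCompactSupport ζ

theorem continuous_of_abs_sub_le {X : Type*} [PseudoMetricSpace X] {ζ : X → ℝ} {A : ℝ}
    (h : ∀ x y, |ζ x - ζ y| ≤ A * dist x y) : Continuous ζ :=
  (LipschitzWith.of_dist_le' fun x y => by rw [Real.dist_eq]; exact h x y).continuous

theorem IsLipschitzBump.continuous {A : ℝ} {ζ : Param D → ℝ} (h : IsLipschitzBump A ζ) :
    Continuous ζ :=
  continuous_of_abs_sub_le fun x y => by rw [dist_eq_norm]; exact h.lipschitz x y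

/-- A smooth probability density supported in the ball of radius `κ`. -/
noncomputable def mollifier (D : ℕ) (κ : ℝ) (hκ : 0 < κ) : ContDiffBump (0 : Param D) :=
  ⟨κ / 2, κ, half_pos hκ, half_lt_self hκ⟩

/-- The convolution of `ζ` with `mollifier D κ`. -/
noncomputable def mollify {κ : ℝ} (hκ : 0 < κ) (ζ : Param D → ℝ) : Param D → ℝ :=
  convolution ((mollifier D κ hκ).normed volume) ζ (ContinuousLinearMap.lsmul ℝ ℝ) volume

theorem integrable_mollifier_mul {κ : ℝ} (hκ : 0 < κ) {f : Param D → ℝ} (hf : Continuous f) :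
    Integrable fun t => (mollifier D κ hκ).normed volume t * f t :=
  ((mollifier D κ hκ).continuous_normed.mul hf).integrable_of_hasCompactSupport
    (mollifier D κ hκ).hasCompactSupport_normed.mul_right

theorem abs_integral_mollifier_sub_le {κ : ℝ} (hκ : 0 < κ) {f g : Param D → ℝ} {a : ℝ}
    (hf : Continuous f) (hg : Continuous g) (h : ∀ t, ‖t‖ < κ → |f t - g t| ≤ a) :
    |(∫ t, (mollifier D κ hκ).normed volume t * f t) -
      ∫ t, (mollifier D κ hκ).normed volume t * g t| ≤ a := by
  rw [← integral_sub (integrable_mollifier_mul hκ hf) (integrable_mollifier_mul hκ hg)]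
  calc |∫ t, ((mollifier D κ hκ).normed volume t * f t -
          (mollifier D κ hκ).normed volume t * g t)|
      ≤ ∫ t, (mollifier D κ hκ).normed volume t * a := by
        rw [← Real.norm_eq_abs]
        refine norm_integral_le_of_norm_le (integrable_mollifier_mul hκ continuous_const)
          (Eventually.of_forall fun t => ?_)
        rw [← mul_sub, norm_mul, Real.norm_of_nonneg ((mollifier D κ hκ).nonneg_normed t)]
        by_cases ht : ‖t‖ < κ
        · exact mul_le_mul_of_nonneg_left (h t ht) ((mollifier D κ hκ).nonneg_normed t)
        · have : (mollifier D κ hκ).normed volume t = 0 := by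
            rw [← Function.notMem_support, (mollifier D κ hκ).support_normed_eq, Metric.mem_ball,
              dist_zero_right]
            exact ht
          simp [this]
    _ = a := by rw [integral_mul_const, (mollifier D κ hκ).integral_normed, one_mul]

namespace IsLipschitzBump

variable {A : ℝ} {ζ : Param D → ℝ} {κ : ℝ} (hκ : 0 < κ) (hζ : IsLipschitzBump A ζ)
include hζ

theorem abs_mollify_sub_self_le (x : Param D) : |mollify hκ ζ x - ζ x| ≤ A * κ := by
  have h := abs_integral_mollifier_sub_le hκ (f := fun t => ζ (x - t)) (g := fun _ => ζ x)
    (a := A * κ) (hζ.continuous.comp (continuous_const.sub continuous_id)) continuous_const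
    (fun t ht => (hζ.lipschitz _ _).trans
      (mul_le_mul_of_nonneg_left (by simpa using ht.le) hζ.nonneg))
  rwa [integral_mul_const, (mollifier D κ hκ).integral_normed, one_mul] at h

theorem abs_mollify_sub_le (x y : Param D) :
    |mollify hκ ζ x - mollify hκ ζ y| ≤ A * ‖x - y‖ :=
  abs_integral_mollifier_sub_le hκ (f := fun t => ζ (x - t)) (g := fun t => ζ (y - t))
    (hζ.continuous.comp (continuous_const.sub continuous_id))
    (hζ.continuous.comp (continuous_const.sub continuous_id))
    (fun t _ => (hζ.lipschitz _ _).trans (by simp))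

theorem contDiff_mollify : ContDiff ℝ (⊤ : ℕ∞) (mollify hκ ζ) :=
  HasCompactSupport.contDiff_convolution_left _ (mollifier D κ hκ).hasCompactSupport_normed
    (mollifier D κ hκ).contDiff_normed hζ.continuous.locallyIntegrable

theorem isLipschitzBump_mollify : IsLipschitzBump A (mollify hκ ζ) :=
  ⟨hζ.nonneg, hζ.abs_mollify_sub_le hκ,
    (mollifier D κ hκ).hasCompactSupport_normed.convolution _ hζ.hasCompactSupport⟩

/-- Mollification almost commutes with a perturbation of a translation-invariant map. -/
theorem abs_mollify_apply_sub_mollify_comp_le {e : Param D → Param D} (he : Continuous e) {c : ℝ}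
    (hc : 0 ≤ c) (h : ∀ x y, ‖e (x - y) - (e x - y)‖ ≤ c * ‖y‖) (x : Param D) :
    |mollify hκ ζ (e x) - mollify hκ (ζ ∘ e) x| ≤ A * (c * κ) :=
  abs_integral_mollifier_sub_le hκ (f := fun t => ζ (e x - t)) (g := fun t => ζ (e (x - t)))
    (hζ.continuous.comp (continuous_const.sub continuous_id))
    (hζ.continuous.comp (he.comp (continuous_const.sub continuous_id)))
    (fun t ht => (hζ.lipschitz _ _).trans (mul_le_mul_of_nonneg_left (by
      rw [norm_sub_rev]
      exact (h x t).trans (mul_le_mul_of_nonneg_left ht.le hc)) hζ.nonneg))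

/-- Bounded displacement is what preserves compact support: a point mapped into the ball of radius
`R` lies in the ball of radius `R + b`. -/
theorem comp {e : Param D → Param D} {a b : ℝ} (ha : 0 ≤ a)
    (he : ∀ x y, ‖e x - e y‖ ≤ a * ‖x - y‖) (hb : ∀ x, ‖e x - x‖ ≤ b) :
    IsLipschitzBump (A * a) (ζ ∘ e) := by
  refine ⟨mul_nonneg hζ.nonneg ha, fun x y => ?_, ?_⟩
  · refine (hζ.lipschitz _ _).trans ?_
    rw [mul_assoc]
    exact mul_le_mul_of_nonneg_left (he x y) hζ.nonneg
  · obtain ⟨R, hR⟩ := hζ.hasCompactSupport.isCompact.isBounded.subset_closedBall (0 : Param D)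
    refine HasCompactSupport.intro (isCompact_closedBall (0 : Param D) (R + b)) fun x hx => ?_
    by_contra hne
    have h1 : e x ∈ Metric.closedBall (0 : Param D) R := hR (subset_tsupport _ hne)
    simp only [Metric.mem_closedBall, dist_zero_right] at h1 hx
    have h2 : ‖x‖ ≤ ‖e x‖ + ‖e x - x‖ := norm_le_norm_add_norm_sub _ _
    linarith [hb x]

theorem norm_gradient_le (x : Param D) : ‖gradient ζ x‖ ≤ A := by
  have h : LipschitzWith (Real.toNNReal A) ζ := LipschitzWith.of_dist_le' fun x y => by
    rw [Real.dist_eq, dist_eq_norm]; exact hζ.lipschitz x y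
  have := norm_fderiv_le_of_lipschitz ℝ (x₀ := x) h
  rwa [Real.coe_toNNReal _ hζ.nonneg, ← (InnerProductSpace.toDual ℝ (Param D)).symm.norm_map]
    at this

end IsLipschitzBump

theorem norm_gradient_sub_gradient (f g : Param D → ℝ) (x y : Param D) :
    ‖gradient f x - gradient g y‖ = ‖fderiv ℝ f x - fderiv ℝ g y‖ := by
  rw [gradient, gradient, ← map_sub, LinearIsometryEquiv.norm_map]

/-- The derivative falls on the mollifier, so `C` is the integral of `‖fderiv ℝ ρ‖`. It depends on
`D` and `κ` but on the test function only through `A`; the mollification scale can therefore be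
fixed before the Euler step, for all transported test functions at once. -/
theorem exists_gradient_mollify_lipschitz (D : ℕ) {κ : ℝ} (hκ : 0 < κ) :
    ∃ C : ℝ, 0 ≤ C ∧ ∀ (A : ℝ) (ζ : Param D → ℝ), IsLipschitzBump A ζ → ∀ x y,
      ‖gradient (mollify hκ ζ) x - gradient (mollify hκ ζ) y‖ ≤ A * C * ‖x - y‖ := by
  set ρ := (mollifier D κ hκ).normed volume with hρ
  set L : (Param D →L[ℝ] ℝ) →L[ℝ] ℝ →L[ℝ] (Param D →L[ℝ] ℝ) :=
    (ContinuousLinearMap.lsmul ℝ ℝ : ℝ →L[ℝ] ℝ →L[ℝ] ℝ).precompL (Param D) with hL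
  have hρc : ContDiff ℝ 1 ρ := (mollifier D κ hκ).contDiff_normed
  have hρs : HasCompactSupport ρ := (mollifier D κ hκ).hasCompactSupport_normed
  have hdc : Continuous (fderiv ℝ ρ) := hρc.continuous_fderiv one_ne_zero
  have hds : HasCompactSupport (fderiv ℝ ρ) := hρs.fderiv ℝ
  have hLn : ∀ a b, ‖L a b‖ ≤ ‖a‖ * ‖b‖ := fun a b => by
    refine ContinuousLinearMap.opNorm_le_bound _ (by positivity) fun v => ?_
    have : L a b v = a v * b := by simp [hL]
    rw [this, norm_mul]
    calc ‖a v‖ * ‖b‖ ≤ ‖a‖ * ‖v‖ * ‖b‖ := by gcongr; exact a.le_opNorm v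
      _ = _ := by ring
  refine ⟨∫ t, ‖fderiv ℝ ρ t‖, by positivity, fun A ζ hζ x y => ?_⟩
  have hfd : ∀ x, fderiv ℝ (mollify hκ ζ) x = ∫ t, L (fderiv ℝ ρ t) (ζ (x - t)) := fun x =>
    (hρs.hasFDerivAt_convolution_left (ContinuousLinearMap.lsmul ℝ ℝ) hρc
      hζ.continuous.locallyIntegrable x).fderiv
  have hint : ∀ x, Integrable fun t => L (fderiv ℝ ρ t) (ζ (x - t)) := fun x => by
    refine Continuous.integrable_of_hasCompactSupport ?_ ?_
    · exact (L.continuous.comp hdc).clm_apply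
        (hζ.continuous.comp (continuous_const.sub continuous_id))
    · refine hds.mono fun t ht => ?_
      contrapose! ht
      rw [Function.notMem_support] at ht ⊢
      simp [ht]
  have hdn : Integrable fun t => ‖fderiv ℝ ρ t‖ :=
    (hdc.integrable_of_hasCompactSupport hds).norm
  rw [norm_gradient_sub_gradient, hfd, hfd, ← integral_sub (hint x) (hint y)]
  calc ‖∫ t, (L (fderiv ℝ ρ t) (ζ (x - t)) - L (fderiv ℝ ρ t) (ζ (y - t)))‖
      ≤ ∫ t, ‖fderiv ℝ ρ t‖ * (A * ‖x - y‖) := by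
        refine norm_integral_le_of_norm_le (hdn.mul_const _)
          (Eventually.of_forall fun t => ?_)
        rw [← map_sub]
        refine (hLn _ _).trans ?_
        gcongr
        rw [Real.norm_eq_abs]
        exact (hζ.lipschitz _ _).trans (by simp)
    _ = _ := by rw [integral_mul_const]; ring

theorem abs_sub_sub_inner_gradient_le {w : Param D → ℝ} (hw : Differentiable ℝ w) {M : ℝ}
    (hM : 0 ≤ M) (h : ∀ x y, ‖gradient w x - gradient w y‖ ≤ M * ‖x - y‖) (x d : Param D) :
    |w (x + d) - w x - inner ℝ (gradient w x) d| ≤ M * ‖d‖ ^ 2 := by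
  have h1 := (convex_closedBall x ‖d‖).norm_image_sub_le_of_norm_fderiv_le' (𝕜 := ℝ)
    (f := w) (x := x) (y := x + d) (φ := fderiv ℝ w x) (C := M * ‖d‖)
    (fun y _ => hw y) (fun y hy => by
      rw [← norm_gradient_sub_gradient]
      refine (h y x).trans (mul_le_mul_of_nonneg_left ?_ hM)
      simpa [dist_eq_norm] using hy) (by simp) (by simp [dist_eq_norm])
  have h2 : inner ℝ (gradient w x) d = fderiv ℝ w x d := by
    rw [gradient, InnerProductSpace.toDual_symm_apply]
  rw [h2]
  simpa [pow_two, mul_assoc] using h1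

end Mollification

/-! ### Weak solutions: finite speed and one Euler step. -/

section WeakSolution

variable {D : ℕ}

theorem integrable_of_abs_le {X : Type*} [MeasurableSpace X] [TopologicalSpace X]
    [OpensMeasurableSpace X] {m : Measure X} [IsFiniteMeasure m] {f : X → ℝ} {b : ℝ}
    (hf : Continuous f) (hb : ∀ x, |f x| ≤ b) : Integrable f m :=
  Integrable.of_bound hf.measurable.aestronglyMeasurable b (Eventually.of_forall hb)

theorem abs_integral_sub_integral_le {X : Type*} [MeasurableSpace X] {m : Measure X}
    [IsProbabilityMeasure m] {f g : X → ℝ} {a : ℝ} (hf : Integrable f m) (hg : Integrable g m)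
    (h : ∀ x, |f x - g x| ≤ a) : |(∫ x, f x ∂m) - ∫ x, g x ∂m| ≤ a := by
  rw [← integral_sub hf hg]
  simpa using norm_integral_le_of_norm_le_const (μ := m) (f := fun x => f x - g x)
    (Eventually.of_forall fun x => (Real.norm_eq_abs _).trans_le (h x))

theorem abs_integral_le {X : Type*} [MeasurableSpace X] {m : Measure X}
    [IsProbabilityMeasure m] {f : X → ℝ} {a : ℝ} (h : ∀ x, |f x| ≤ a) : |∫ x, f x ∂m| ≤ a := by
  simpa using norm_integral_le_of_norm_le_const (μ := m) (f := f)
    (Eventually.of_forall fun x => (Real.norm_eq_abs _).trans_le (h x))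

/-- Estimates for compactly supported Lipschitz test functions extend to bounded ones. -/
theorem abs_integral_sub_integral_comp_le_of_bump {m₁ m₂ : Measure (Param D)}
    [IsProbabilityMeasure m₁] [IsProbabilityMeasure m₂] {Y : Param D → Param D}
    (hY : Measurable Y) {c : ℝ}
    (h : ∀ A ζ, IsLipschitzBump A ζ → |(∫ x, ζ x ∂m₁) - ∫ x, ζ (Y x) ∂m₂| ≤ A * c)
    {ζ : Param D → ℝ} {A b : ℝ} (hA : 0 ≤ A) (hb : ∀ x, |ζ x| ≤ b)
    (hζ : ∀ x y, |ζ x - ζ y| ≤ A * ‖x - y‖) :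
    |(∫ x, ζ x ∂m₁) - ∫ x, ζ (Y x) ∂m₂| ≤ A * c := by
  have hb0 : 0 ≤ b := (abs_nonneg _).trans (hb 0)
  have hζc : Continuous ζ := continuous_of_abs_sub_le fun x y => by
    rw [dist_eq_norm]; exact hζ x y
  -- Cut-offs with slope `1 / (R + 1)`: the product with `ζ` has Lipschitz constant at most `A + b /
  -- (R + 1)`, so `A` itself is recovered in the limit.
  set χ : ℕ → Param D → ℝ := fun R x => max 0 (1 - ‖x‖ / (R + 1)) with hχ
  have hχ0 : ∀ R x, 0 ≤ χ R x := fun R x => le_max_left _ _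
  have hχ1 : ∀ R x, χ R x ≤ 1 := fun R x =>
    max_le zero_le_one (by linarith [show 0 ≤ ‖x‖ / ((R : ℝ) + 1) by positivity])
  have hχl : ∀ R x y, |χ R x - χ R y| ≤ 1 / ((R : ℝ) + 1) * ‖x - y‖ := fun R x y => by
    refine (abs_max_sub_max_le_max _ _ _ _).trans ?_
    have e : 1 - ‖x‖ / ((R : ℝ) + 1) - (1 - ‖y‖ / (R + 1)) =
        1 / ((R : ℝ) + 1) * (‖y‖ - ‖x‖) := by ring
    rw [sub_self, abs_zero, e, abs_mul, abs_of_nonneg (by positivity)]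
    refine max_le (by positivity) ?_
    gcongr
    rw [norm_sub_rev]
    exact abs_norm_sub_norm_le _ _
  have hχt : ∀ x, Tendsto (fun R => χ R x) atTop (𝓝 1) := fun x => by
    have h1 : Tendsto (fun R : ℕ => 1 - ‖x‖ / ((R : ℝ) + 1)) atTop (𝓝 (1 - 0)) :=
      tendsto_const_nhds.sub (tendsto_const_nhds.div_atTop
        (tendsto_atTop_add_const_right _ _ tendsto_natCast_atTop_atTop))
    simpa [hχ] using (tendsto_const_nhds (x := (0 : ℝ))).max h1
  have hbump : ∀ R : ℕ, IsLipschitzBump (A + b * (1 / ((R : ℝ) + 1)))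
      fun x => ζ x * χ R x := fun R => by
    refine ⟨by positivity, fun x y => ?_, ?_⟩
    · have e : ζ x * χ R x - ζ y * χ R y = (ζ x - ζ y) * χ R x + ζ y * (χ R x - χ R y) := by ring
      rw [e]
      calc _ ≤ |ζ x - ζ y| * |χ R x| + |ζ y| * |χ R x - χ R y| := by
            rw [← abs_mul, ← abs_mul]; exact abs_add_le _ _
        _ ≤ A * ‖x - y‖ * 1 + b * (1 / ((R : ℝ) + 1) * ‖x - y‖) := by
            gcongr
            · exact hζ x y
            · rw [abs_of_nonneg (hχ0 R x)]; exact hχ1 R x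
            · exact hb y
            · exact hχl R x y
        _ = _ := by ring
    · refine HasCompactSupport.intro (isCompact_closedBall (0 : Param D) (R + 1)) fun x hx => ?_
      rw [Metric.mem_closedBall, dist_zero_right, not_le] at hx
      have : χ R x = 0 := by
        refine max_eq_left ?_
        rw [sub_nonpos, le_div_iff₀ (by positivity)]
        linarith
      rw [this, mul_zero]
  have hbd : ∀ R x, ‖ζ x * χ R x‖ ≤ b := fun R x => by
    rw [norm_mul, Real.norm_eq_abs, Real.norm_of_nonneg (hχ0 R x)]
    exact (mul_le_mul (hb x) (hχ1 R x) (hχ0 R x) hb0).trans (by simp)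
  have hlim : ∀ x, Tendsto (fun R => ζ x * χ R x) atTop (𝓝 (ζ x)) := fun x => by
    simpa using (hχt x).const_mul (ζ x)
  have ht1 : Tendsto (fun R => ∫ x, ζ x * χ R x ∂m₁) atTop (𝓝 (∫ x, ζ x ∂m₁)) :=
    tendsto_integral_of_dominated_convergence (fun _ => b)
      (fun R => (hbump R).continuous.aestronglyMeasurable) (integrable_const _)
      (fun R => Eventually.of_forall (hbd R)) (Eventually.of_forall hlim)
  have ht2 : Tendsto (fun R => ∫ x, ζ (Y x) * χ R (Y x) ∂m₂) atTop (𝓝 (∫ x, ζ (Y x) ∂m₂)) :=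
    tendsto_integral_of_dominated_convergence (fun _ => b)
      (fun R => ((hbump R).continuous.measurable.comp hY).aestronglyMeasurable)
      (integrable_const _) (fun R => Eventually.of_forall fun x => hbd R (Y x))
      (Eventually.of_forall fun x => hlim (Y x))
  have ht3 : Tendsto (fun R : ℕ => (A + b * (1 / ((R : ℝ) + 1))) * c) atTop (𝓝 (A * c)) := by
    have := ((tendsto_one_div_add_atTop_nhds_zero_nat (𝕜 := ℝ)).const_mul b).const_add A
    simpa using this.mul_const c
  exact le_of_tendsto_of_tendsto' (ht1.sub ht2).abs ht3 fun R => h _ _ (hbump R)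

variable {η K L K' : ℝ} {v : ℝ → Param D → Param D} {m : ℝ → ProbabilityMeasure (Param D)}

/-- Replacing `r` by `max r 0` extends a curve on the half-line to one continuous on all of `ℝ`. -/
theorem continuous_integral_of_continuousOn (hm : ContinuousOn m (Set.Ici 0))
    {f : Param D → ℝ} (hf : Continuous f) {b : ℝ} (hb : ∀ x, |f x| ≤ b) :
    Continuous fun r => ∫ x, f x ∂(m (max r 0) : Measure (Param D)) := by
  have hm' : Continuous fun r : ℝ => m (max r 0) :=
    hm.comp_continuous (by fun_prop) fun r => Set.mem_Ici.mpr (le_max_right _ _)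
  exact (ProbabilityMeasure.continuous_integral_boundedContinuousFunction
    (BoundedContinuousFunction.ofNormedAddCommGroup f hf b hb)).comp hm'

theorem intervalIntegrable_integral_inner (hm : ContinuousOn m (Set.Ici 0))
    (hvb : ∀ t x, ‖v t x‖ ≤ K) (hvx : ∀ t, Continuous (v t))
    (hvt : ∀ x, ContinuousOn (fun t => v t x) (Set.Ici 0)) {g : Param D → Param D}
    (hg : Continuous g) {A : ℝ} (hgA : ∀ x, ‖g x‖ ≤ A) {s t : ℝ} (hs : 0 ≤ s) (ht : 0 ≤ t) :
    IntervalIntegrable (fun r => ∫ x, inner ℝ (g x) (v r x) ∂(m r : Measure (Param D)))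
      volume s t := by
  have hA : 0 ≤ A := (norm_nonneg _).trans (hgA 0)
  have hbd : ∀ r x, |inner ℝ (g x) (v r x)| ≤ A * K := fun r x =>
    (abs_real_inner_le_norm _ _).trans (mul_le_mul (hgA x) (hvb r x) (norm_nonneg _) hA)
  have hgv : ∀ r, Continuous fun x => inner ℝ (g x) (v r x) := fun r => hg.inner (hvx r)
  -- Time enters through both the law and the velocity. With the two times separated, the function
  -- is continuous in each of them, hence jointly measurable, and may be restricted to the diagonal.
  set H : ℝ → ℝ → ℝ := fun r' r =>
    ∫ x, inner ℝ (g x) (v (max r 0) x) ∂(m (max r' 0) : Measure (Param D)) with hH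
  have hH1 : ∀ r, Continuous fun r' => H r' r := fun r =>
    continuous_integral_of_continuousOn hm (hgv _) (hbd _)
  have hH2 : ∀ r', Continuous (H r') := fun r' =>
    continuous_of_dominated (bound := fun _ => A * K)
      (fun r => (hgv _).aestronglyMeasurable) (fun r => Eventually.of_forall (hbd _))
      (integrable_const _) (Eventually.of_forall fun x => continuous_const.inner
        ((hvt x).comp_continuous (by fun_prop) fun r => Set.mem_Ici.mpr (le_max_right _ _)))
  have hmeas : Measurable fun r => H r r :=
    (measurable_uncurry_of_continuous_of_measurable hH1 fun r' => (hH2 r').measurable).comp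
      (measurable_id.prodMk measurable_id)
  have hint : IntervalIntegrable (fun r => H r r) volume s t := by
    refine (intervalIntegrable_const (c := A * K)).mono_fun hmeas.aestronglyMeasurable
      (Eventually.of_forall fun r => ?_)
    exact (abs_integral_le (hbd _)).trans (le_abs_self _)
  refine hint.congr fun r hr => ?_
  have hr0 : 0 ≤ r := by
    rcases Set.mem_uIoc.mp hr with h | h
    · exact hs.trans h.1.le
    · exact ht.trans h.1.le
  simp only [hH, max_eq_left hr0]

namespace IsWeakSolution

variable (hw : IsWeakSolution η v m) (hη : 0 ≤ η)
  (hvb : ∀ t x, ‖v t x‖ ≤ K) (hvx : ∀ t, Continuous (v t))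
  (hvt : ∀ x, ContinuousOn (fun t => v t x) (Set.Ici 0))
include hw hvb hvx hvt

theorem integral_sub {A : ℝ} {ζ : Param D → ℝ} (hζ : IsLipschitzBump A ζ)
    (hζs : ContDiff ℝ (⊤ : ℕ∞) ζ) {s t : ℝ} (hs : 0 ≤ s) (ht : 0 ≤ t) :
    (∫ θ, ζ θ ∂(m t : Measure (Param D))) - ∫ θ, ζ θ ∂(m s : Measure (Param D)) =
      η * ∫ r in s..t, ∫ θ, inner ℝ (gradient ζ θ) (v r θ) ∂(m r : Measure (Param D)) := by
  have hgc : Continuous (gradient ζ) := (LinearIsometryEquiv.continuous _).comp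
    (hζs.continuous_fderiv (by simp))
  have hi : ∀ a b : ℝ, 0 ≤ a → 0 ≤ b → IntervalIntegrable
      (fun r => ∫ x, inner ℝ (gradient ζ x) (v r x) ∂(m r : Measure (Param D))) volume a b :=
    fun a b ha hb => intervalIntegrable_integral_inner hw.1 hvb hvx hvt hgc
      hζ.norm_gradient_le ha hb
  rw [hw.2 ζ hζs hζ.hasCompactSupport t ht, hw.2 ζ hζs hζ.hasCompactSupport s hs,
    ← intervalIntegral.integral_add_adjacent_intervals (hi 0 s le_rfl hs) (hi s t hs ht)]
  ring

include hη

/-- A weak solution moves at speed at most `η * K` in the Lipschitz dual distance. For smooth test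
functions this is the equation with `‖∇ζ‖ ≤ A`; mollification and then cut-offs remove smoothness
and compact support. -/
theorem abs_integral_sub_le {s t : ℝ} (hs : 0 ≤ s) (ht : 0 ≤ t) {ζ : Param D → ℝ} {A b : ℝ}
    (hA : 0 ≤ A) (hb : ∀ x, |ζ x| ≤ b) (hζ : ∀ x y, |ζ x - ζ y| ≤ A * ‖x - y‖) :
    |(∫ θ, ζ θ ∂(m t : Measure (Param D))) - ∫ θ, ζ θ ∂(m s : Measure (Param D))| ≤
      A * (η * K * |t - s|) := by
  have hsmooth : ∀ A ζ, IsLipschitzBump A ζ → ContDiff ℝ (⊤ : ℕ∞) ζ →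
      |(∫ θ, ζ θ ∂(m t : Measure (Param D))) - ∫ θ, ζ θ ∂(m s : Measure (Param D))| ≤
        A * (η * K * |t - s|) := by
    intro A ζ hζ hζs
    rw [hw.integral_sub hvb hvx hvt hζ hζs hs ht, abs_mul, abs_of_nonneg hη]
    have := intervalIntegral.norm_integral_le_of_norm_le_const (a := s) (b := t) (C := A * K)
      (f := fun r => ∫ θ, inner ℝ (gradient ζ θ) (v r θ) ∂(m r : Measure (Param D)))
      fun r _ => abs_integral_le fun x => (abs_real_inner_le_norm _ _).trans
        (mul_le_mul (hζ.norm_gradient_le x) (hvb r x) (norm_nonneg _) hζ.nonneg)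
    rw [Real.norm_eq_abs] at this
    nlinarith
  refine abs_integral_sub_integral_comp_le_of_bump measurable_id (fun A ζ hζ => ?_) hA hb hζ
  refine le_of_forall_pos_le_add fun e he => ?_
  have hA0 := hζ.nonneg
  -- Mollification errs by at most `A * κ` at each of the two times, so the total is at most `e`;
  -- the summand `1` covers `A = 0`.
  set κ := e / (2 * (A + 1)) with hκdef
  have hκ : 0 < κ := by positivity
  have h1 := hsmooth A _ (hζ.isLipschitzBump_mollify hκ) (hζ.contDiff_mollify hκ)
  have hi : ∀ (q : ℝ) {f : Param D → ℝ}, IsLipschitzBump A f →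
      Integrable f (m q : Measure (Param D)) := fun q f hf =>
    hf.continuous.integrable_of_hasCompactSupport hf.hasCompactSupport
  have h2 : ∀ q, |(∫ θ, mollify hκ ζ θ ∂(m q : Measure (Param D))) -
      ∫ θ, ζ θ ∂(m q : Measure (Param D))| ≤ A * κ := fun q =>
    abs_integral_sub_integral_le (hi q (hζ.isLipschitzBump_mollify hκ)) (hi q hζ)
      (hζ.abs_mollify_sub_self_le hκ)
  have h3 : 2 * (A * κ) ≤ e := by
    rw [hκdef]
    have : 2 * (A * (e / (2 * (A + 1)))) = e * (A / (A + 1)) := by field_simp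
    rw [this]
    exact mul_le_of_le_one_right he.le (by rw [div_le_one (by positivity)]; linarith)
  have h4 := abs_le.mp (h2 t)
  have h5 := abs_le.mp (h2 s)
  have h6 := abs_le.mp h1
  simp only [id]
  rw [abs_le]
  constructor <;> linarith

end IsWeakSolution

/-- A velocity field bounded by `K`, `L`-Lipschitz in space and `K'`-Lipschitz in time. -/
structure RegularVelocity (v : ℝ → Param D → Param D) (K L K' : ℝ) : Prop where
  bound : ∀ t x, ‖v t x‖ ≤ K
  lipschitz : ∀ t x y, ‖v t x - v t y‖ ≤ L * ‖x - y‖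
  time : ∀ s t x, 0 ≤ s → 0 ≤ t → ‖v t x - v s x‖ ≤ K' * |t - s|

namespace RegularVelocity

variable (hv : RegularVelocity v K L K')
include hv

theorem continuous_space (t : ℝ) : Continuous (v t) :=
  (LipschitzWith.of_dist_le' fun x y => by
    rw [dist_eq_norm, dist_eq_norm]; exact hv.lipschitz t x y).continuous

theorem continuousOn_time (x : Param D) : ContinuousOn (fun t => v t x) (Set.Ici 0) :=
  (LipschitzOnWith.of_dist_le_mul (K := Real.toNNReal K') fun t ht s hs => by
    rw [dist_eq_norm, Real.dist_eq]
    exact (hv.time s t x hs ht).trans (by gcongr; exact Real.le_coe_toNNReal _)).continuousOn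

theorem bound_nonneg : 0 ≤ K := (norm_nonneg _).trans (hv.bound 0 0)

theorem time_nonneg : 0 ≤ K' := by
  have := hv.time 0 1 0 le_rfl zero_le_one
  simp only [sub_zero, abs_one, mul_one] at this
  exact (norm_nonneg _).trans this

/-- One explicit Euler step transports a weak solution up to a quadratic error. -/
theorem abs_integral_mollify_sub_euler_le (hw : IsWeakSolution η v m) (hη : 0 ≤ η) (hL : 0 ≤ L)
    {κ C : ℝ} (hκ : 0 < κ) (hC0 : 0 ≤ C)
    (hC : ∀ (A : ℝ) (ζ : Param D → ℝ), IsLipschitzBump A ζ → ∀ x y,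
      ‖gradient (mollify hκ ζ) x - gradient (mollify hκ ζ) y‖ ≤ A * C * ‖x - y‖)
    {A : ℝ} {ζ : Param D → ℝ} (hζ : IsLipschitzBump A ζ) {s τ : ℝ} (hs : 0 ≤ s) (hτ : 0 ≤ τ) :
    |(∫ x, mollify hκ ζ x ∂(m (s + τ) : Measure (Param D))) -
      ∫ x, mollify hκ ζ (x + (η * τ) • v s x) ∂(m s : Measure (Param D))| ≤
      A * (τ ^ 2 * (η * (K' + (C * K + L) * (η * K)) + C * (η * K) ^ 2)) := by
  have hK := hv.bound_nonneg
  have hA := hζ.nonneg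
  set w := mollify hκ ζ with hwdef
  have hwb : IsLipschitzBump A w := hζ.isLipschitzBump_mollify hκ
  have hws : ContDiff ℝ (⊤ : ℕ∞) w := hζ.contDiff_mollify hκ
  have hwd : Differentiable ℝ w := hws.differentiable (by simp)
  have hgc : Continuous (gradient w) := (LinearIsometryEquiv.continuous _).comp
    (hws.continuous_fderiv (by simp))
  have hgn := hwb.norm_gradient_le
  obtain ⟨b, hb⟩ : ∃ b, ∀ x, |w x| ≤ b := by
    obtain ⟨b, hb⟩ := hwb.continuous.bounded_above_of_compact_support hwb.hasCompactSupport
    exact ⟨b, hb⟩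
  set G : Param D → ℝ := fun x => inner ℝ (gradient w x) (v s x) with hG
  have hGb : ∀ r x, |inner ℝ (gradient w x) (v r x)| ≤ A * K := fun r x =>
    (abs_real_inner_le_norm _ _).trans (mul_le_mul (hgn x) (hv.bound r x) (norm_nonneg _) hA)
  have hGc : ∀ r, Continuous fun x => inner ℝ (gradient w x) (v r x) := fun r =>
    hgc.inner (hv.continuous_space r)
  have hGl : ∀ x y, |G x - G y| ≤ (A * C * K + A * L) * ‖x - y‖ := fun x y => by
    have e : G x - G y = inner ℝ (gradient w x - gradient w y) (v s x) +
        inner ℝ (gradient w y) (v s x - v s y) := by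
      simp only [hG, inner_sub_left, inner_sub_right]; ring
    rw [e]
    calc _ ≤ ‖gradient w x - gradient w y‖ * ‖v s x‖ + ‖gradient w y‖ * ‖v s x - v s y‖ :=
          (abs_add_le _ _).trans (add_le_add (abs_real_inner_le_norm _ _)
            (abs_real_inner_le_norm _ _))
      _ ≤ (A * C * ‖x - y‖) * K + A * (L * ‖x - y‖) := by
          gcongr
          · exact hC A ζ hζ x y
          · exact hv.bound s x
          · exact hgn y
          · exact hv.lipschitz s x y
      _ = _ := by ring
  set I := ∫ x, G x ∂(m s : Measure (Param D)) with hI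
  set Φ : ℝ → ℝ := fun r => ∫ x, inner ℝ (gradient w x) (v r x) ∂(m r : Measure (Param D)) with hΦ
  have hst : 0 ≤ s + τ := add_nonneg hs hτ
  have hΦi : IntervalIntegrable Φ volume s (s + τ) :=
    intervalIntegrable_integral_inner hw.1 hv.bound hv.continuous_space hv.continuousOn_time hgc
      hgn hs hst
  -- Freezing the integrand at time `s` costs the time variation `K'` of the velocity, plus the
  -- motion of the law: `G` has Lipschitz constant `A * (C * K + L)` and the law has speed `η * K`.
  have hΦI : ∀ r, s ≤ r → r ≤ s + τ →
      |Φ r - I| ≤ A * (τ * (K' + (C * K + L) * (η * K))) := by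
    intro r hr1 hr2
    have hr0 : 0 ≤ r := hs.trans hr1
    have hrs : |r - s| ≤ τ := by rw [abs_of_nonneg (by linarith)]; linarith
    have h1 : |Φ r - ∫ x, G x ∂(m r : Measure (Param D))| ≤ A * (K' * τ) :=
      abs_integral_sub_integral_le (integrable_of_abs_le (hGc r) (hGb r))
        (integrable_of_abs_le (hGc s) (hGb s)) fun x => by
          simp only [hG]
          rw [← inner_sub_right]
          refine (abs_real_inner_le_norm _ _).trans (mul_le_mul (hgn x)
            ((hv.time s r x hs hr0).trans ?_) (norm_nonneg _) hA)
          exact mul_le_mul_of_nonneg_left hrs hv.time_nonneg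
    have h2 := hw.abs_integral_sub_le hη hv.bound hv.continuous_space hv.continuousOn_time hs hr0
      (by positivity) (hGb s) hGl
    have h3 : (A * C * K + A * L) * (η * K * |r - s|) ≤ (A * C * K + A * L) * (η * K * τ) := by
      gcongr
    calc |Φ r - I| ≤ _ := abs_sub_le _ (∫ x, G x ∂(m r : Measure (Param D))) _
      _ ≤ A * (K' * τ) + (A * C * K + A * L) * (η * K * τ) := add_le_add h1 (h2.trans h3)
      _ = _ := by ring
  have hpart1 : |((∫ x, w x ∂(m (s + τ) : Measure (Param D))) -
      ∫ x, w x ∂(m s : Measure (Param D))) - η * τ * I| ≤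
      η * (A * (τ * (K' + (C * K + L) * (η * K))) * τ) := by
    rw [hw.integral_sub hv.bound hv.continuous_space hv.continuousOn_time hwb hws hs hst]
    have e : η * (∫ r in s..(s + τ), Φ r) - η * τ * I = η * ∫ r in s..(s + τ), (Φ r - I) := by
      rw [intervalIntegral.integral_sub hΦi intervalIntegrable_const,
        intervalIntegral.integral_const]
      simp only [add_sub_cancel_left, smul_eq_mul]
      ring
    rw [show (∫ r in s..(s + τ), ∫ x, inner ℝ (gradient w x) (v r x) ∂(m r : Measure (Param D))) =
      ∫ r in s..(s + τ), Φ r from rfl, e, abs_mul, abs_of_nonneg hη]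
    gcongr
    have := intervalIntegral.norm_integral_le_of_norm_le_const (a := s) (b := s + τ)
      (f := fun r => Φ r - I) (C := A * (τ * (K' + (C * K + L) * (η * K)))) fun r hr => by
        rw [Set.uIoc_of_le (by linarith)] at hr
        exact hΦI r hr.1.le hr.2
    simpa [abs_of_nonneg hτ] using this
  -- The frozen drift is the first-order Taylor term of the Euler displacement; the remainder
  -- involves the Lipschitz constant `A * C` of the gradient.
  have hpart2 : |(∫ x, w (x + (η * τ) • v s x) ∂(m s : Measure (Param D))) -
      ∫ x, (w x + η * τ * G x) ∂(m s : Measure (Param D))| ≤ A * C * (η * τ * K) ^ 2 := by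
    refine abs_integral_sub_integral_le ?_ ?_ fun x => ?_
    · exact integrable_of_abs_le (hwb.continuous.comp (continuous_id.add
        ((hv.continuous_space s).fun_const_smul _))) fun x => hb _
    · exact (integrable_of_abs_le hwb.continuous hb).add
        ((integrable_of_abs_le (hGc s) (hGb s)).const_mul _)
    · have h1 := abs_sub_sub_inner_gradient_le hwd (M := A * C) (by positivity) (hC A ζ hζ) x
        ((η * τ) • v s x)
      rw [inner_smul_right, norm_smul, Real.norm_of_nonneg (by positivity)] at h1
      have e : w (x + (η * τ) • v s x) - (w x + η * τ * G x) =
          w (x + (η * τ) • v s x) - w x - η * τ * inner ℝ (gradient w x) (v s x) := by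
        simp only [hG]; ring
      rw [e]
      refine h1.trans ?_
      gcongr
      exact hv.bound s x
  rw [integral_add (integrable_of_abs_le hwb.continuous hb)
    ((integrable_of_abs_le (hGc s) (hGb s)).const_mul _), integral_const_mul] at hpart2
  have h1 := abs_le.mp hpart1
  have h2 := abs_le.mp hpart2
  have e : A * (τ ^ 2 * (η * (K' + (C * K + L) * (η * K)) + C * (η * K) ^ 2)) =
      η * (A * (τ * (K' + (C * K + L) * (η * K))) * τ) + A * C * (η * τ * K) ^ 2 := by ring
  rw [e, abs_le]
  constructor <;> linarith

end RegularVelocity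

end WeakSolution

/-! ### Euler maps that approximately transport a weak solution. -/

section EulerFlow

variable {D : ℕ}

/-- The explicit Euler scheme for `x' = η v_t(x)` with stepsize `τ`. -/
noncomputable def eulerFlow (η τ : ℝ) (v : ℝ → Param D → Param D) : ℕ → Param D → Param D
  | 0 => id
  | j + 1 => fun x => eulerFlow η τ v j x + (η * τ) • v (j * τ) (eulerFlow η τ v j x)

namespace RegularVelocity

variable {η τ K L K' : ℝ} {v : ℝ → Param D → Param D} {m : ℝ → ProbabilityMeasure (Param D)}
  (hv : RegularVelocity v K L K') (hη : 0 ≤ η) (hL : 0 ≤ L) (hτ : 0 ≤ τ)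
include hv hη hτ

theorem norm_eulerFlow_add_sub_le (j i : ℕ) (x : Param D) :
    ‖eulerFlow η τ v (j + i) x - eulerFlow η τ v j x‖ ≤ i * (η * τ * K) := by
  induction i with
  | zero => simp
  | succ i ih =>
    have e : eulerFlow η τ v (j + (i + 1)) x - eulerFlow η τ v j x =
        (eulerFlow η τ v (j + i) x - eulerFlow η τ v j x) +
          (η * τ) • v ((j + i : ℕ) * τ) (eulerFlow η τ v (j + i) x) := by
      rw [← add_assoc, eulerFlow]; module
    rw [e]
    refine (norm_add_le _ _).trans ?_
    rw [norm_smul, Real.norm_of_nonneg (by positivity)]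
    have := mul_le_mul_of_nonneg_left
      (hv.bound ((j + i : ℕ) * τ) (eulerFlow η τ v (j + i) x)) (by positivity : 0 ≤ η * τ)
    push_cast at this ⊢
    linarith

include hL

/-- A block of fine steps is compared with a single coarse step whose velocity is frozen at the
start. Within the block the velocity drifts by at most `K' * (p * τ)` in time, and by `L` times the
travelled distance in space. -/
theorem norm_eulerFlow_add_sub_sub_le (j p i : ℕ) (hi : i ≤ p) (x : Param D) :
    ‖eulerFlow η τ v (j + i) x - eulerFlow η τ v j x -
      (i * (η * τ)) • v (j * τ) (eulerFlow η τ v j x)‖ ≤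
      i * (η * τ * (p * τ * (K' + L * (η * K)))) := by
  have hK := hv.bound_nonneg
  have hK' := hv.time_nonneg
  induction i with
  | zero => simp
  | succ i ih =>
    have hip : (i : ℝ) ≤ p := by exact_mod_cast (Nat.le_succ i).trans hi
    have e : eulerFlow η τ v (j + (i + 1)) x - eulerFlow η τ v j x -
        ((i + 1 : ℕ) * (η * τ)) • v (j * τ) (eulerFlow η τ v j x) =
        (eulerFlow η τ v (j + i) x - eulerFlow η τ v j x -
          (i * (η * τ)) • v (j * τ) (eulerFlow η τ v j x)) +
        (η * τ) • ((v ((j + i : ℕ) * τ) (eulerFlow η τ v (j + i) x) -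
            v (j * τ) (eulerFlow η τ v (j + i) x)) +
          (v (j * τ) (eulerFlow η τ v (j + i) x) - v (j * τ) (eulerFlow η τ v j x))) := by
      rw [← add_assoc, eulerFlow]
      push_cast
      module
    rw [e]
    refine (norm_add_le _ _).trans ?_
    rw [norm_smul, Real.norm_of_nonneg (by positivity)]
    have h1 := hv.time (j * τ) ((j + i : ℕ) * τ) (eulerFlow η τ v (j + i) x) (by positivity)
      (by positivity)
    have h2 : |((j + i : ℕ) : ℝ) * τ - j * τ| ≤ p * τ := by
      have : ((j + i : ℕ) : ℝ) * τ - j * τ = i * τ := by push_cast; ring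
      rw [this, abs_of_nonneg (by positivity)]
      gcongr
    have h3 := hv.lipschitz (j * τ) (eulerFlow η τ v (j + i) x) (eulerFlow η τ v j x)
    have h4 : ‖eulerFlow η τ v (j + i) x - eulerFlow η τ v j x‖ ≤ p * (η * τ * K) :=
      (hv.norm_eulerFlow_add_sub_le hη hτ j i x).trans (by gcongr)
    have h5 : ‖(v ((j + i : ℕ) * τ) (eulerFlow η τ v (j + i) x) -
            v (j * τ) (eulerFlow η τ v (j + i) x)) +
          (v (j * τ) (eulerFlow η τ v (j + i) x) - v (j * τ) (eulerFlow η τ v j x))‖ ≤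
        p * τ * (K' + L * (η * K)) :=
      calc _ ≤ K' * (p * τ) + L * (p * (η * τ * K)) :=
            (norm_add_le _ _).trans (add_le_add
              (h1.trans (mul_le_mul_of_nonneg_left h2 hK'))
              (h3.trans (mul_le_mul_of_nonneg_left h4 hL)))
        _ = _ := by ring
    have h6 := mul_le_mul_of_nonneg_left h5 (by positivity : 0 ≤ η * τ)
    have h7 := ih ((Nat.le_succ i).trans hi)
    rw [Nat.cast_succ, add_mul, one_mul]
    exact add_le_add h7 h6

omit hL in
theorem norm_euler_step_sub_le (s : ℝ) (x y : Param D) :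
    ‖(x + (η * τ) • v s x) - (y + (η * τ) • v s y)‖ ≤ (1 + η * τ * L) * ‖x - y‖ := by
  have e : (x + (η * τ) • v s x) - (y + (η * τ) • v s y) =
      (x - y) + (η * τ) • (v s x - v s y) := by module
  rw [e]
  refine (norm_add_le _ _).trans ?_
  rw [norm_smul, Real.norm_of_nonneg (by positivity)]
  have := mul_le_mul_of_nonneg_left (hv.lipschitz s x y) (by positivity : 0 ≤ η * τ)
  linarith

theorem norm_eulerFlow_sub_le (j : ℕ) (x y : Param D) :
    ‖eulerFlow η τ v j x - eulerFlow η τ v j y‖ ≤ (1 + η * τ * L) ^ j * ‖x - y‖ := by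
  induction j with
  | zero => simp [eulerFlow]
  | succ j ih =>
    rw [pow_succ', mul_assoc]
    exact (hv.norm_euler_step_sub_le hη hτ _ _ _).trans (by gcongr)

theorem continuous_eulerFlow (j : ℕ) : Continuous (eulerFlow η τ v j) :=
  (LipschitzWith.of_dist_le' fun x y => by
    rw [dist_eq_norm, dist_eq_norm]; exact hv.norm_eulerFlow_sub_le hη hL hτ j x y).continuous

theorem isLipschitzBump_comp_eulerFlow {A : ℝ} {ζ : Param D → ℝ} (hζ : IsLipschitzBump A ζ)
    (j : ℕ) : IsLipschitzBump (A * (1 + η * τ * L) ^ j) (ζ ∘ eulerFlow η τ v j) :=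
  hζ.comp (by positivity) (hv.norm_eulerFlow_sub_le hη hL hτ j)
    (b := j * (η * τ * K)) fun x => by
      simpa [eulerFlow] using hv.norm_eulerFlow_add_sub_le hη hτ 0 j x

/-- The induction removes the last Euler step and lets the test function absorb it: `ζ` becomes `ζ ∘
e`, again a Lipschitz bump with constant enlarged by `1 + η * τ * L`. Mollification is not undone at
each step, which would cost `A * κ` every time. It is commuted with the step, and the commutator
carries a factor `τ`, so the errors over `J` steps sum to a quantity governed by `J * τ`. -/
theorem abs_integral_mollify_sub_eulerFlow_le (hw : IsWeakSolution η v m) {κ C : ℝ} (hκ : 0 < κ)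
    (hC0 : 0 ≤ C)
    (hC : ∀ (A : ℝ) (ζ : Param D → ℝ), IsLipschitzBump A ζ → ∀ x y,
      ‖gradient (mollify hκ ζ) x - gradient (mollify hκ ζ) y‖ ≤ A * C * ‖x - y‖)
    (J : ℕ) {A : ℝ} {ζ : Param D → ℝ} (hζ : IsLipschitzBump A ζ) :
    |(∫ x, mollify hκ ζ x ∂(m (J * τ) : Measure (Param D))) -
      ∫ x, mollify hκ (ζ ∘ eulerFlow η τ v J) x ∂(m 0 : Measure (Param D))| ≤
      A * (J * (η * τ * L * κ +
        τ ^ 2 * (η * (K' + (C * K + L) * (η * K)) + C * (η * K) ^ 2)) *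
          (1 + η * τ * L) ^ J) := by
  have hK := hv.bound_nonneg
  have hK' := hv.time_nonneg
  set c := τ ^ 2 * (η * (K' + (C * K + L) * (η * K)) + C * (η * K) ^ 2) with hc
  have hc0 : 0 ≤ c := by positivity
  induction J generalizing A ζ with
  | zero => simp [eulerFlow]
  | succ J ih =>
    have hA := hζ.nonneg
    set e : Param D → Param D := fun x => x + (η * τ) • v (J * τ) x with he
    have hec : Continuous e := continuous_id.add ((hv.continuous_space _).fun_const_smul _)
    have hζe : IsLipschitzBump (A * (1 + η * τ * L)) (ζ ∘ e) :=
      hζ.comp (by positivity) (hv.norm_euler_step_sub_le hη hτ _) (b := η * τ * K) fun x => by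
        simp only [he, add_sub_cancel_left]
        rw [norm_smul, Real.norm_of_nonneg (by positivity)]
        exact mul_le_mul_of_nonneg_left (hv.bound _ _) (by positivity)
    have h1 := hv.abs_integral_mollify_sub_euler_le hw hη hL hκ hC0 hC hζ
      (s := J * τ) (by positivity) hτ
    have hi : ∀ {A f} (q : ℝ), IsLipschitzBump A f →
        Integrable (mollify hκ f) (m q : Measure (Param D)) := fun q hf =>
      (hf.isLipschitzBump_mollify hκ).continuous.integrable_of_hasCompactSupport
        (hf.isLipschitzBump_mollify hκ).hasCompactSupport
    obtain ⟨b, hb⟩ := (hζ.isLipschitzBump_mollify hκ).continuous.bounded_above_of_compact_support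
      (hζ.isLipschitzBump_mollify hκ).hasCompactSupport
    have h2 : |(∫ x, mollify hκ ζ (e x) ∂(m (J * τ) : Measure (Param D))) -
        ∫ x, mollify hκ (ζ ∘ e) x ∂(m (J * τ) : Measure (Param D))| ≤ A * (η * τ * L * κ) :=
      abs_integral_sub_integral_le
        (integrable_of_abs_le ((hζ.isLipschitzBump_mollify hκ).continuous.comp hec) fun x => hb _)
        (hi _ hζe) (hζ.abs_mollify_apply_sub_mollify_comp_le hκ hec (by positivity) fun x y => by
          have : e (x - y) - (e x - y) = (η * τ) • (v (J * τ) (x - y) - v (J * τ) x) := by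
            simp only [he]; module
          rw [this, norm_smul, Real.norm_of_nonneg (by positivity), mul_assoc (η * τ)]
          exact mul_le_mul_of_nonneg_left ((hv.lipschitz _ _ _).trans_eq (by simp))
            (by positivity))
    have h3 := ih hζe
    have h4 : (ζ ∘ e) ∘ eulerFlow η τ v J = ζ ∘ eulerFlow η τ v (J + 1) := rfl
    rw [h4] at h3
    have h5 : ((J + 1 : ℕ) : ℝ) * τ = J * τ + τ := by push_cast; ring
    rw [h5]
    set r := η * τ * L * κ + c with hr
    have hr0 : 0 ≤ r := by positivity
    have h6 : 1 ≤ (1 + η * τ * L) ^ (J + 1) :=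
      one_le_pow₀ (by linarith [show 0 ≤ η * τ * L by positivity])
    have h7 : A * r ≤ A * r * (1 + η * τ * L) ^ (J + 1) := le_mul_of_one_le_right (by positivity) h6
    calc _ ≤ A * c + A * (η * τ * L * κ) + A * (1 + η * τ * L) * (J * r * (1 + η * τ * L) ^ J) := by
          refine (abs_sub_le _ (∫ x, mollify hκ (ζ ∘ e) x ∂(m (J * τ) : Measure (Param D))) _).trans
            (add_le_add ?_ h3)
          exact (abs_sub_le _ _ _).trans (add_le_add h1 h2)
      _ = A * r + A * (1 + η * τ * L) * (J * r * (1 + η * τ * L) ^ J) := by rw [hr]; ring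
      _ ≤ A * r * (1 + η * τ * L) ^ (J + 1) +
          A * (1 + η * τ * L) * (J * r * (1 + η * τ * L) ^ J) := by linarith
      _ = _ := by push_cast; ring

omit hτ in
/-- A weak solution is approximated, to any accuracy, by the push-forward of its initial datum under
maps that follow the velocity field. -/
theorem exists_flow (hw : IsWeakSolution η v m) {ε : ℝ} (hε : 0 < ε) (n : ℕ) {a : ℝ} (ha : 0 < a) :
    ∃ X : ℕ → Param D → Param D, (∀ k, Continuous (X k)) ∧ X 0 = id ∧
      (∀ k x, ‖X (k + 1) x - X k x‖ ≤ ε * (η * K)) ∧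
      (∀ k x, ‖X (k + 1) x - X k x - (η * ε) • v (k * ε) (X k x)‖ ≤
        η * ε * (ε * (K' + L * (η * K)))) ∧
      ∀ k ≤ n, ∀ (ζ : Param D → ℝ) (A b : ℝ), 0 ≤ A → (∀ x, |ζ x| ≤ b) →
        (∀ x y, |ζ x - ζ y| ≤ A * ‖x - y‖) →
        |(∫ x, ζ x ∂(m (k * ε) : Measure (Param D))) -
          ∫ x, ζ (X k x) ∂(m 0 : Measure (Param D))| ≤ A * a := by
  have hK := hv.bound_nonneg
  have hK' := hv.time_nonneg
  set T : ℝ := n * ε with hT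
  have hT0 : 0 ≤ T := by positivity
  set M := Real.exp (η * L * T) with hM
  have hM0 : 0 < M := Real.exp_pos _
  -- The scale `κ` is fixed first, so that both outer mollification errors and all commutators
  -- together use half of the budget `a`. Only then is `C` known, and the number `p` of fine steps
  -- per interval `ε` is taken so large that the quadratic Euler errors use the other half.
  set κ := a / (2 * (M * (2 + T * (η * L)))) with hκd
  have hκ : 0 < κ := by positivity
  obtain ⟨C, hC0, hC⟩ := exists_gradient_mollify_lipschitz D hκ
  set c := η * (K' + (C * K + L) * (η * K)) + C * (η * K) ^ 2 with hc
  have hc0 : 0 ≤ c := by positivity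
  obtain ⟨p', hp'⟩ := exists_nat_ge (2 * (M * (T * (ε * c))) / a)
  set p := p' + 1 with hp
  have hp0 : (0 : ℝ) < p := by rw [hp]; positivity
  set τ := ε / p with hτd
  have hτ : 0 < τ := by positivity
  have hpτ : p * τ = ε := by rw [hτd]; field_simp
  refine ⟨fun k => eulerFlow η τ v (k * p), fun k => hv.continuous_eulerFlow hη hL hτ.le _, ?_,
    fun k x => ?_, fun k x => ?_, fun k hk ζ A b hA hb hζ => ?_⟩
  · simp [eulerFlow]
  · have := hv.norm_eulerFlow_add_sub_le hη hτ.le (k * p) p x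
    rw [show (p : ℝ) * (η * τ * K) = p * τ * (η * K) by ring, hpτ] at this
    simpa only [add_mul, one_mul] using this
  · have := hv.norm_eulerFlow_add_sub_sub_le hη hL hτ.le (k * p) p p le_rfl x
    rw [show (p : ℝ) * (η * τ) = η * (p * τ) by ring,
      show (p : ℝ) * (η * τ * (p * τ * (K' + L * (η * K)))) =
        η * (p * τ) * (p * τ * (K' + L * (η * K))) by ring,
      show ((k * p : ℕ) : ℝ) * τ = k * (p * τ) by push_cast; ring, hpτ] at this
    simpa only [add_mul, one_mul] using this
  · refine abs_integral_sub_integral_comp_le_of_bump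
      (hv.continuous_eulerFlow hη hL hτ.le _).measurable (fun A ζ hζ => ?_) hA hb hζ
    have hA := hζ.nonneg
    have hJ : ((k * p : ℕ) : ℝ) * τ = k * ε := by push_cast; rw [mul_assoc, hpτ]
    have hkT : k * ε ≤ T := by rw [hT]; gcongr
    have h1 := hv.abs_integral_mollify_sub_eulerFlow_le hη hL hτ.le hw hκ hC0 hC (k * p) hζ
    rw [hJ, ← hc] at h1
    have hpow : (1 + η * τ * L) ^ (k * p) ≤ M := by
      calc (1 + η * τ * L) ^ (k * p) ≤ Real.exp (η * τ * L) ^ (k * p) := by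
            gcongr
            rw [add_comm]
            exact Real.add_one_le_exp _
        _ = Real.exp (η * L * (k * ε)) := by rw [← Real.exp_nat_mul, ← hJ]; ring_nf
        _ ≤ M := Real.exp_le_exp.mpr (by gcongr)
    have hM1 : 1 ≤ M := Real.one_le_exp (by positivity)
    have hi : ∀ {A f} (q : ℝ), IsLipschitzBump A f →
        Integrable f (m q : Measure (Param D)) := fun q hf =>
      hf.continuous.integrable_of_hasCompactSupport hf.hasCompactSupport
    have hζX := hv.isLipschitzBump_comp_eulerFlow hη hL hτ.le hζ (k * p)
    have h2 := abs_integral_sub_integral_le (hi (k * ε) (hζ.isLipschitzBump_mollify hκ))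
      (hi (k * ε) hζ) (hζ.abs_mollify_sub_self_le hκ)
    have h3 := abs_integral_sub_integral_le (hi 0 (hζX.isLipschitzBump_mollify hκ))
      (hi 0 hζX) (hζX.abs_mollify_sub_self_le hκ)
    have h4 : A * (((k * p : ℕ) : ℝ) * (η * τ * L * κ + τ ^ 2 * c) * (1 + η * τ * L) ^ (k * p)) ≤
        A * (T * (η * L * κ + τ * c) * M) := by
      rw [show ((k * p : ℕ) : ℝ) * (η * τ * L * κ + τ ^ 2 * c) =
        ((k * p : ℕ) : ℝ) * τ * (η * L * κ + τ * c) by ring, hJ]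
      gcongr
    have h5 : A * κ ≤ A * (M * κ) := by
      gcongr; exact le_mul_of_one_le_left hκ.le hM1
    have h6 : A * (1 + η * τ * L) ^ (k * p) * κ ≤ A * (M * κ) := by
      rw [mul_assoc]; gcongr
    have h7 : M * κ * (2 + T * (η * L)) = a / 2 := by rw [hκd]; field_simp
    have h8 : T * (τ * c) * M ≤ a / 2 := by
      have hp'' : 2 * (M * (T * (ε * c))) / a ≤ p := hp'.trans (by rw [hp]; push_cast; linarith)
      rw [div_le_iff₀ ha] at hp''
      rw [hτd, show T * (ε / p * c) * M = M * (T * (ε * c)) / p by ring, div_le_iff₀ hp0]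
      linarith
    have h9 : A * (M * κ) + A * (M * κ) + A * (T * (η * L * κ + τ * c) * M) ≤ A * a := by
      rw [show A * (M * κ) + A * (M * κ) + A * (T * (η * L * κ + τ * c) * M) =
        A * (M * κ * (2 + T * (η * L)) + T * (τ * c) * M) by ring]
      gcongr
      linarith
    have g1 := abs_le.mp h1
    have g2 := abs_le.mp h2
    have g3 := abs_le.mp h3
    simp only [Function.comp_apply] at g3
    rw [abs_le]
    constructor <;> linarith

end RegularVelocity

end EulerFlow

/-! ### Integration against signed measures. -/

section SignedMeasures

variable {S : Type*} [MeasurableSpace S] {G : Type*} [NormedAddCommGroup G] [NormedSpace ℝ G]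

/-- The Jordan decomposition reduces inner products and Fubini for signed measures to ordinary
Bochner integrals. -/
theorem integral_signedMeasure_eq_sub [CompleteSpace G] (κ : SignedMeasure S) {f : S → G} {c : ℝ}
    (hf : StronglyMeasurable f) (hc : ∀ s, ‖f s‖ ≤ c) :
    ∫ᵛ s, f s ∂<•κ = ∫ s, f s ∂κ.toJordanDecomposition.posPart -
      ∫ s, f s ∂κ.toJordanDecomposition.negPart := by
  have h : ∀ m : Measure S, [IsFiniteMeasure m] → m.toSignedMeasure.Integrable f := fun m _ => by
    rw [VectorMeasure.Integrable, Measure.variation_toSignedMeasure]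
    exact Integrable.of_bound hf.aestronglyMeasurable c (Eventually.of_forall hc)
  conv_lhs => rw [← κ.toSignedMeasure_toJordanDecomposition, JordanDecomposition.toSignedMeasure]
  rw [VectorMeasure.integral_sub_vectorMeasure (h _) (h _), VectorMeasure.integral_toSignedMeasure,
    VectorMeasure.integral_toSignedMeasure]

instance isFiniteMeasure_variation_signedMeasure (κ : SignedMeasure S) :
    IsFiniteMeasure κ.variation := by
  rw [← κ.totalVariation_eq_variation, SignedMeasure.totalVariation]
  infer_instance

omit [NormedSpace ℝ G] in
theorem integrable_signedMeasure (κ : SignedMeasure S) {f : S → G} {c : ℝ}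
    (hf : StronglyMeasurable f) (hc : ∀ s, ‖f s‖ ≤ c) : κ.Integrable f :=
  Integrable.of_bound hf.aestronglyMeasurable c (Eventually.of_forall hc)

theorem norm_integral_signedMeasure_le {κ : SignedMeasure S} {C : ℝ} (hC : 0 ≤ C)
    (hκ : κ.variation Set.univ ≤ ENNReal.ofReal C) {f : S → G} {c : ℝ} (hc0 : 0 ≤ c)
    (hc : ∀ s, ‖f s‖ ≤ c) : ‖∫ᵛ s, f s ∂<•κ‖ ≤ c * C := by
  have h1 := VectorMeasure.norm_integral_le_of_norm_le_const (μ := κ) (f := f)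
    (B := (ContinuousLinearMap.lsmul ℝ ℝ (E := G)).flip) (Eventually.of_forall hc)
  have h2 : ‖(ContinuousLinearMap.lsmul ℝ ℝ (E := G)).flip‖ ≤ 1 := by
    rw [ContinuousLinearMap.opNorm_flip]
    exact ContinuousLinearMap.opNorm_lsmul_le
  have h3 : κ.variation.real Set.univ ≤ C := ENNReal.toReal_le_of_le_ofReal hC hκ
  calc _ ≤ _ := h1
    _ ≤ c * 1 * C := by gcongr
    _ = _ := by ring

theorem integral_signedMeasure_integral {Q : Type*} [MeasurableSpace Q] (π : Measure Q)
    [IsProbabilityMeasure π] (κ : SignedMeasure S) {f : S → Q → ℝ} {c : ℝ}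
    (hf : Measurable (Function.uncurry f)) (hc : ∀ s q, |f s q| ≤ c) :
    ∫ᵛ s, (∫ q, f s q ∂π) ∂<•κ = ∫ q, (∫ᵛ s, f s q ∂<•κ) ∂π := by
  have hm : StronglyMeasurable fun s => ∫ q, f s q ∂π :=
    (hf.stronglyMeasurable).integral_prod_right
  have hi : ∀ m : Measure S, [IsFiniteMeasure m] → Integrable (Function.uncurry f) (m.prod π) :=
    fun m _ => Integrable.of_bound hf.aestronglyMeasurable c
      (Eventually.of_forall fun p => hc p.1 p.2)
  have hI : ∀ m : Measure S, [IsFiniteMeasure m] → Integrable (fun q => ∫ s, f s q ∂m) π :=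
    fun m _ => (hi m).integral_prod_right
  have hq : ∀ q, ∫ᵛ s, f s q ∂<•κ = ∫ s, f s q ∂κ.toJordanDecomposition.posPart -
      ∫ s, f s q ∂κ.toJordanDecomposition.negPart := fun q =>
    integral_signedMeasure_eq_sub κ
      (hf.comp (by fun_prop : Measurable fun s => (s, q))).stronglyMeasurable fun s => hc s q
  simp only [hq]
  rw [integral_signedMeasure_eq_sub κ hm (c := c) fun s => abs_integral_le (hc s),
    integral_sub (hI _) (hI _),
    integral_integral_swap (hi _), integral_integral_swap (hi _)]

end SignedMeasures

/-! ### Neurons and pairings of their gradients with signed measures. -/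

section Neurons

variable {S : Type*} [MeasurableSpace S] {D : ℕ}

/-- Derivatives as limits along a fixed sequence, so that measurability passes from a function to
its derivative. -/
theorem tendsto_mul_sub_of_hasDerivAt {g : ℝ → ℝ} {d : ℝ} (hg : HasDerivAt g d 0) :
    Tendsto (fun n : ℕ => ((n : ℝ) + 1) * (g (1 / ((n : ℝ) + 1)) - g 0)) atTop (𝓝 d) := by
  have h := hg.tendsto_slope_zero.comp (tendsto_nhdsWithin_iff.mpr
    ⟨tendsto_one_div_add_atTop_nhds_zero_nat (𝕜 := ℝ), Eventually.of_forall fun n => by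
      simp only [Set.mem_compl_iff, Set.mem_singleton_iff]; positivity⟩)
  simpa [Function.comp_def] using h

theorem hasDerivAt_comp_add_smul {g : Param D → ℝ} (hg : Differentiable ℝ g) (θ e : Param D) :
    HasDerivAt (fun t : ℝ => g (θ + t • e)) (inner ℝ e (gradient g θ)) 0 := by
  have h1 : HasDerivAt (fun t : ℝ => θ + t • e) e 0 := by
    simpa using ((hasDerivAt_id (0 : ℝ)).smul_const e).const_add θ
  have h2 : HasFDerivAt g (fderiv ℝ g θ) (θ + (0 : ℝ) • e) := by
    simpa using (hg θ).hasFDerivAt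
  have h3 := h2.comp_hasDerivAt (0 : ℝ) h1
  rwa [real_inner_comm, gradient, InnerProductSpace.toDual_symm_apply]

theorem measurable_of_inner {f : S → Param D} (h : ∀ e, Measurable fun s => inner ℝ e (f s)) :
    Measurable f := by
  have : f = fun s => ∑ i, inner ℝ (EuclideanSpace.basisFun (Fin D) ℝ i) (f s) •
      EuclideanSpace.basisFun (Fin D) ℝ i := by
    ext1 s
    exact ((EuclideanSpace.basisFun (Fin D) ℝ).sum_repr' (f s)).symm
  rw [this]
  exact Finset.measurable_sum _ fun i _ => (h _).smul_const _

/-- The Frobenius norm dominates the operator norm, by Cauchy-Schwarz in the coordinates of `v`. -/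
theorem norm_apply_le_sqrt_sum (A : Param D →L[ℝ] Param D) (v : Param D) :
    ‖A v‖ ≤ √(∑ j, ‖A (EuclideanSpace.single j (1 : ℝ))‖ ^ 2) * ‖v‖ := by
  have hv : v = ∑ j, v j • EuclideanSpace.single j (1 : ℝ) := by
    have := (EuclideanSpace.basisFun (Fin D) ℝ).sum_repr v
    simpa using this.symm
  calc ‖A v‖ = ‖∑ j, v j • A (EuclideanSpace.single j (1 : ℝ))‖ := by
        conv_lhs => rw [hv]
        simp only [map_sum, map_smul]
    _ ≤ ∑ j, ‖A (EuclideanSpace.single j (1 : ℝ))‖ * ‖v j‖ :=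
        (norm_sum_le _ _).trans (Finset.sum_le_sum fun j _ => by rw [norm_smul, mul_comm])
    _ ≤ √(∑ j, ‖A (EuclideanSpace.single j (1 : ℝ))‖ ^ 2) * √(∑ j, ‖v j‖ ^ 2) :=
        Real.sum_mul_le_sqrt_mul_sqrt _ _ _
    _ = _ := by rw [EuclideanSpace.norm_eq]

namespace RegularNeuron

variable {B₀ B₁ B₂ : ℝ} {φ : S → Param D → ℝ} (hφ : RegularNeuron B₀ B₁ B₂ φ)
include hφ

theorem abs_sub_le (s : S) (θ θ' : Param D) : |φ s θ - φ s θ'| ≤ B₁ * ‖θ - θ'‖ :=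
  convex_univ.norm_image_sub_le_of_norm_fderiv_le (𝕜 := ℝ) (fun x _ => hφ.differentiable s x)
    (fun x _ => by
      have := hφ.bound_gradient s x
      rwa [gradient, LinearIsometryEquiv.norm_map] at this) (Set.mem_univ θ') (Set.mem_univ θ)

theorem norm_gradient_sub_le (s : S) (θ θ' : Param D) :
    ‖gradient (φ s) θ - gradient (φ s) θ'‖ ≤ B₂ * ‖θ - θ'‖ := by
  refine convex_univ.norm_image_sub_le_of_norm_fderiv_le (𝕜 := ℝ)
    (fun x _ => hφ.differentiable_gradient s x) (fun x _ => ?_) (Set.mem_univ θ') (Set.mem_univ θ)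
  have h0 := (Real.sqrt_nonneg _).trans (hφ.bound_hessian s x)
  exact ContinuousLinearMap.opNorm_le_bound _ h0 fun v => (norm_apply_le_sqrt_sum _ v).trans
    (mul_le_mul_of_nonneg_right (hφ.bound_hessian s x) (norm_nonneg v))

theorem measurable_uncurry : Measurable (Function.uncurry φ) := by
  have h := measurable_uncurry_of_continuous_of_measurable (u := fun θ s => φ s θ)
    (fun s => (hφ.differentiable s).continuous) hφ.measurable
  exact h.comp measurable_swap

theorem measurable_gradient (θ : Param D) : Measurable fun s => gradient (φ s) θ := by
  refine measurable_of_inner fun e => ?_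
  refine measurable_of_tendsto_metrizable (f := fun (n : ℕ) s =>
    ((n : ℝ) + 1) * (φ s (θ + (1 / ((n : ℝ) + 1)) • e) - φ s (θ + (0 : ℝ) • e))) (fun n => ?_) ?_
  · exact ((hφ.measurable _).sub (hφ.measurable _)).const_mul _
  · exact tendsto_pi_nhds.mpr fun s =>
      tendsto_mul_sub_of_hasDerivAt (hasDerivAt_comp_add_smul (hφ.differentiable s) θ e)

/-- The defining property of a variation concerns test functions in `𝓕`, and `∇φ` is not known to
have its components there. Difference quotients of neurons, dominated by `B₁ * ‖e‖`, recover the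
pairing with `∇φ` from pairings with neurons; its uniqueness and its measurability in the data both
follow. -/
theorem tendsto_integral_signedMeasure (κ : SignedMeasure S) (θ e : Param D) :
    Tendsto (fun n : ℕ => ((n : ℝ) + 1) * ((∫ᵛ s, φ s (θ + (1 / ((n : ℝ) + 1)) • e) ∂<•κ) -
      ∫ᵛ s, φ s θ ∂<•κ)) atTop (𝓝 (inner ℝ e (∫ᵛ s, gradient (φ s) θ ∂<•κ))) := by
  have hi : ∀ θ, κ.Integrable fun s => φ s θ := fun θ =>
    integrable_signedMeasure κ (hφ.measurable θ).stronglyMeasurable fun s => hφ.bound s θ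
  have hgm := (hφ.measurable_gradient θ).stronglyMeasurable
  have hgi : ∀ m : Measure S, [IsFiniteMeasure m] → Integrable (fun s => gradient (φ s) θ) m :=
    fun m _ => Integrable.of_bound hgm.aestronglyMeasurable B₁
      (Eventually.of_forall fun s => hφ.bound_gradient s θ)
  have hinner : inner ℝ e (∫ᵛ s, gradient (φ s) θ ∂<•κ) =
      ∫ᵛ s, inner ℝ e (gradient (φ s) θ) ∂<•κ := by
    rw [integral_signedMeasure_eq_sub κ hgm fun s => hφ.bound_gradient s θ,
      integral_signedMeasure_eq_sub κ (c := ‖e‖ * B₁)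
        (measurable_const.inner (hφ.measurable_gradient θ)).stronglyMeasurable
        (fun s => (norm_inner_le_norm _ _).trans
          (mul_le_mul_of_nonneg_left (hφ.bound_gradient s θ) (norm_nonneg _))),
      inner_sub_right, integral_inner (hgi _), integral_inner (hgi _)]
  have hq : ∀ n : ℕ, ((n : ℝ) + 1) * ((∫ᵛ s, φ s (θ + (1 / ((n : ℝ) + 1)) • e) ∂<•κ) -
      ∫ᵛ s, φ s θ ∂<•κ) =
      ∫ᵛ s, ((n : ℝ) + 1) * (φ s (θ + (1 / ((n : ℝ) + 1)) • e) - φ s θ) ∂<•κ := fun n => by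
    rw [← VectorMeasure.integral_fun_sub (hi _) (hi _)]
    exact (VectorMeasure.integral_fun_smul _ _ _ _).symm
  rw [hinner]
  simp only [hq]
  refine VectorMeasure.tendsto_integral_of_dominated_convergence (fun _ => B₁ * ‖e‖) (fun n => ?_)
    (integrable_const _) (fun n => Eventually.of_forall fun s => ?_)
    (Eventually.of_forall fun s => ?_)
  · exact (((hφ.measurable _).sub (hφ.measurable _)).const_mul _).aestronglyMeasurable
  · rw [norm_mul, Real.norm_of_nonneg (by positivity), Real.norm_eq_abs]
    have h1 := hφ.abs_sub_le s (θ + (1 / ((n : ℝ) + 1)) • e) θ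
    rw [add_sub_cancel_left, norm_smul, Real.norm_of_nonneg (by positivity)] at h1
    calc ((n : ℝ) + 1) * _ ≤ ((n : ℝ) + 1) * (B₁ * (1 / ((n : ℝ) + 1) * ‖e‖)) := by gcongr
      _ = B₁ * ‖e‖ := by field_simp
  · simpa using tendsto_mul_sub_of_hasDerivAt
      (hasDerivAt_comp_add_smul (hφ.differentiable s) θ e)

theorem integral_gradient_congr {κ κ' : SignedMeasure S}
    (h : ∀ θ, ∫ᵛ s, φ s θ ∂<•κ = ∫ᵛ s, φ s θ ∂<•κ') (θ : Param D) :
    ∫ᵛ s, gradient (φ s) θ ∂<•κ = ∫ᵛ s, gradient (φ s) θ ∂<•κ' := by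
  refine ext_inner_left ℝ fun e => tendsto_nhds_unique
    (hφ.tendsto_integral_signedMeasure κ θ e) ?_
  simp only [h]
  exact hφ.tendsto_integral_signedMeasure κ' θ e

theorem measurable_integral_gradient {U : Type*} [MeasurableSpace U] {κ : U → SignedMeasure S}
    (h : ∀ θ, Measurable fun u => ∫ᵛ s, φ s θ ∂<•(κ u)) (θ : Param D) :
    Measurable fun u => ∫ᵛ s, gradient (φ s) θ ∂<•(κ u) :=
  measurable_of_inner fun e => measurable_of_tendsto_metrizable
    (fun n : ℕ => ((h (θ + (1 / ((n : ℝ) + 1)) • e)).sub (h θ)).const_mul ((n : ℝ) + 1))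
    (tendsto_pi_nhds.mpr fun u => hφ.tendsto_integral_signedMeasure (κ u) θ e)

end RegularNeuron

end Neurons

/-! ### Structure and Lipschitz bounds of the stochastic directions. -/

section Model

variable {𝓧 𝓩 𝓦 : Type*} [MeasurableSpace 𝓧] [MeasurableSpace 𝓩] [MeasurableSpace 𝓦] {D : ℕ}

/-- The network with a single neuron. -/
def neuronNet {S : Type*} (α : ℝ) (φ : S → Param D → ℝ) (θ : Param D) : S → ℝ :=
  fun s => α * φ s θ

/-- The standing assumptions on the moment problem and the neurons. -/
structure RegularModel (P : MomentProblem 𝓧 𝓩 𝓦) (φ : 𝓦 → Param D → ℝ) (ψ : 𝓩 → Param D → ℝ)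
    (α lam B₀ B₁ B₂ C₀ C₂ CΨ : ℝ) : Prop where
  α_pos : 0 < α
  lam_nonneg : 0 ≤ lam
  B₀_pos : 0 < B₀
  B₁_pos : 0 < B₁
  B₂_pos : 0 < B₂
  C₀_pos : 0 < C₀
  C₂_pos : 0 < C₂
  CΨ_pos : 0 < CΨ
  neuron_φ : RegularNeuron B₀ B₁ B₂ φ
  neuron_ψ : RegularNeuron B₀ B₁ B₂ ψ
  functionals : BoundedFunctionals P φ α C₀ C₂ CΨ

theorem RegularNeuron.wideNet_dirac {S : Type*} [MeasurableSpace S] {B₀ B₁ B₂ : ℝ}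
    {φ : S → Param D → ℝ} (hφ : RegularNeuron B₀ B₁ B₂ φ) (α : ℝ) (θ : Param D) :
    wideNet α φ (Measure.dirac θ) = neuronNet α φ θ := by
  ext s
  rw [wideNet, neuronNet,
    integral_dirac' _ _ (hφ.differentiable s).continuous.stronglyMeasurable]

namespace RegularModel

variable {P : MomentProblem 𝓧 𝓩 𝓦} {φ : 𝓦 → Param D → ℝ} {ψ : 𝓩 → Param D → ℝ}
  {α lam B₀ B₁ B₂ C₀ C₂ CΨ : ℝ} (H : RegularModel P φ ψ α lam B₀ B₁ B₂ C₀ C₂ CΨ)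
include H

/-- A Dirac mass is an admissible law in `net_mem`; hence single neurons can serve as test functions
for the variations. -/
theorem neuronNet_mem (θ : Param D) : neuronNet α φ θ ∈ P.𝓕 := by
  have := H.functionals.net_mem ⟨Measure.dirac θ, inferInstance⟩
  rwa [ProbabilityMeasure.coe_mk, H.neuron_φ.wideNet_dirac] at this

theorem neuron_mem (θ : Param D) : (fun w => φ w θ) ∈ P.𝓕 := by
  have h := P.𝓕.smul_mem α⁻¹ (H.neuronNet_mem θ)
  have e : α⁻¹ • neuronNet α φ θ = fun w => φ w θ := by
    ext w
    simp [neuronNet, inv_mul_cancel_left₀ H.α_pos.ne']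
  rwa [e] at h

-- Along a line the affine functional is an affine function of `ε`, whose slope does not see the
-- base point `f`.
omit H in
theorem _root_.SGDAMeanField.MomentProblem.integral_δΦ (P : MomentProblem 𝓧 𝓩 𝓦) (x : 𝓧) (z : 𝓩)
    {f h : 𝓦 → ℝ} (hf : f ∈ P.𝓕) (hh : h ∈ P.𝓕) :
    ∫ᵛ w, h w ∂<•(P.δΦ x z f) = P.Φ x z h - P.Φ x z 0 := by
  refine (P.isVariation_Φ x z f hf h hh).2.unique ?_
  have e : (fun ε : ℝ => P.Φ x z (f + ε • h)) =
      fun ε => P.Φ x z f + ε * (P.Φ x z h - P.Φ x z 0) := by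
    ext ε
    have := P.affine_Φ x z f hf h hh 1 ε
    rw [one_smul] at this
    linarith
  rw [e]
  simpa using ((hasDerivAt_id (0 : ℝ)).mul_const (P.Φ x z h - P.Φ x z 0)).const_add (P.Φ x z f)

omit H in
theorem _root_.SGDAMeanField.MomentProblem.Φ_sub (P : MomentProblem 𝓧 𝓩 𝓦) (x : 𝓧) (z : 𝓩)
    {f f' : 𝓦 → ℝ} (hf : f ∈ P.𝓕) (hf' : f' ∈ P.𝓕) :
    P.Φ x z f - P.Φ x z f' = ∫ᵛ w, (f - f') w ∂<•(P.δΦ x z 0) := by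
  rw [P.integral_δΦ x z P.𝓕.zero_mem (P.𝓕.sub_mem hf hf')]
  have := P.affine_Φ x z f hf f' hf' 1 (-1)
  rw [one_smul, neg_one_smul, ← sub_eq_add_neg] at this
  linarith

omit H in
theorem _root_.SGDAMeanField.MomentProblem.δΨ_sub (P : MomentProblem 𝓧 𝓩 𝓦) (x : 𝓧) (z : 𝓩)
    {f f' : 𝓦 → ℝ} (hf : f ∈ P.𝓕) (hf' : f' ∈ P.𝓕) (c : ℝ) :
    P.δΨ x z (f - c • f') = P.δΨ x z f - c • P.δΨ x z f' := by
  have := P.linear_δΨ x z f hf f' hf' 1 (-c)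
  rw [one_smul, neg_smul, ← sub_eq_add_neg, one_smul] at this
  rw [this, sub_eq_add_neg]
  ext i hi
  simp

theorem abs_Φ_sub_le (x : 𝓧) (z : 𝓩) {f f' : 𝓦 → ℝ} (hf : f ∈ P.𝓕) (hf' : f' ∈ P.𝓕) {a : ℝ}
    (ha : 0 ≤ a) (h : ∀ w, |f w - f' w| ≤ a) : |P.Φ x z f - P.Φ x z f'| ≤ a * C₂ := by
  rw [P.Φ_sub x z hf hf']
  exact norm_integral_signedMeasure_le (f := fun w => (f - f') w) H.C₂_pos.le
    (H.functionals.bound_δΦ x z 0 P.𝓕.zero_mem) ha fun w => h w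

theorem abs_Φ_le (x : 𝓧) (z : 𝓩) {f : 𝓦 → ℝ} (hf : f ∈ P.𝓕) {a : ℝ}
    (ha : 0 ≤ a) (h : ∀ w, |f w| ≤ a) : |P.Φ x z f| ≤ C₀ + a * C₂ := by
  have h1 := H.abs_Φ_sub_le x z hf P.𝓕.zero_mem ha (by simpa using h)
  have h2 := H.functionals.bound_Φ_zero x z
  have h3 := abs_sub_abs_le_abs_sub (P.Φ x z f) (P.Φ x z 0)
  linarith

/-- The measures at `f` and `f'` may differ, but they agree on every neuron and therefore on
gradients of neurons. -/
theorem integral_gradient_δΦ (x : 𝓧) (z : 𝓩) {f f' : 𝓦 → ℝ} (hf : f ∈ P.𝓕) (hf' : f' ∈ P.𝓕)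
    (θ : Param D) :
    ∫ᵛ w, gradient (φ w) θ ∂<•(P.δΦ x z f) = ∫ᵛ w, gradient (φ w) θ ∂<•(P.δΦ x z f') :=
  H.neuron_φ.integral_gradient_congr (fun θ => by
    rw [P.integral_δΦ x z hf (H.neuron_mem θ), P.integral_δΦ x z hf' (H.neuron_mem θ)]) θ

theorem integrable_gradient (κ : SignedMeasure 𝓦) (θ : Param D) :
    κ.Integrable fun w => gradient (φ w) θ :=
  integrable_signedMeasure κ (H.neuron_φ.measurable_gradient θ).stronglyMeasurable
    fun w => H.neuron_φ.bound_gradient w θ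

theorem norm_integral_gradient_le {κ : SignedMeasure 𝓦} {C : ℝ} (hC : 0 ≤ C)
    (hκ : κ.variation Set.univ ≤ ENNReal.ofReal C) (θ : Param D) :
    ‖∫ᵛ w, gradient (φ w) θ ∂<•κ‖ ≤ B₁ * C :=
  norm_integral_signedMeasure_le hC hκ H.B₁_pos.le fun w => H.neuron_φ.bound_gradient w θ

theorem norm_integral_gradient_sub_le {κ : SignedMeasure 𝓦} {C : ℝ} (hC : 0 ≤ C)
    (hκ : κ.variation Set.univ ≤ ENNReal.ofReal C) (θ θ' : Param D) :
    ‖(∫ᵛ w, gradient (φ w) θ ∂<•κ) - ∫ᵛ w, gradient (φ w) θ' ∂<•κ‖ ≤ B₂ * ‖θ - θ'‖ * C := by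
  rw [← VectorMeasure.integral_fun_sub (H.integrable_gradient κ θ) (H.integrable_gradient κ θ')]
  exact norm_integral_signedMeasure_le hC hκ (mul_nonneg H.B₂_pos.le (norm_nonneg _))
    fun w => H.neuron_φ.norm_gradient_sub_le w θ θ'

theorem bound_δΨ (x : 𝓧) (z : 𝓩) {f : 𝓦 → ℝ} (hf : f ∈ P.𝓕) {a : ℝ} (h : ∀ w, |f w| ≤ a) :
    (P.δΨ x z f).variation Set.univ ≤ ENNReal.ofReal (CΨ * a) := by
  obtain ⟨w, hw⟩ := H.functionals.bound_δΨ x z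
  exact (hw f hf).trans (ENNReal.ofReal_le_ofReal (mul_le_mul_of_nonneg_left (h w) H.CΨ_pos.le))

theorem integral_gradient_δΨ_sub (x : 𝓧) (z : 𝓩) {f f' : 𝓦 → ℝ} (hf : f ∈ P.𝓕)
    (hf' : f' ∈ P.𝓕) (c : ℝ) (θ : Param D) :
    ∫ᵛ w, gradient (φ w) θ ∂<•(P.δΨ x z (f - c • f')) =
      (∫ᵛ w, gradient (φ w) θ ∂<•(P.δΨ x z f)) - c • ∫ᵛ w, gradient (φ w) θ ∂<•(P.δΨ x z f') := by
  rw [P.δΨ_sub x z hf hf', VectorMeasure.integral_sub_vectorMeasure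
    (H.integrable_gradient _ θ) (H.integrable_gradient _ θ),
    VectorMeasure.integral_smul_vectorMeasure]

/-- The variation of the regularizer, paired with `∇φ`, is a point evaluation. -/
theorem exists_integral_gradient_δΨ (x : 𝓧) (z : 𝓩) (θ : Param D) : ∃ (w : 𝓦) (r : Param D),
    ∀ f ∈ P.𝓕, ∫ᵛ w, gradient (φ w) θ ∂<•(P.δΨ x z f) = f w • r := by
  obtain ⟨w, hw⟩ := H.functionals.bound_δΨ x z
  -- The total variation bound by `CΨ * |f w|` kills the pairing whenever `f w = 0`. A linear map
  -- that vanishes on the kernel of evaluation at `w` is a multiple of that evaluation.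
  have h0 : ∀ f ∈ P.𝓕, f w = 0 → ∫ᵛ w, gradient (φ w) θ ∂<•(P.δΨ x z f) = 0 := fun f hf hfw => by
    have h1 := H.norm_integral_gradient_le le_rfl (by simpa [hfw] using hw f hf) θ
    rwa [mul_zero, norm_le_zero_iff] at h1
  by_cases h : ∃ f₀ ∈ P.𝓕, f₀ w ≠ 0
  · obtain ⟨f₀, hf₀, hne⟩ := h
    refine ⟨w, (f₀ w)⁻¹ • ∫ᵛ w, gradient (φ w) θ ∂<•(P.δΨ x z f₀), fun f hf => ?_⟩
    have h1 := H.integral_gradient_δΨ_sub x z hf hf₀ (f w / f₀ w) θ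
    rw [h0 _ (P.𝓕.sub_mem hf (P.𝓕.smul_mem _ hf₀)) (by simp [hne]), eq_comm, sub_eq_zero] at h1
    rw [h1, smul_smul, div_eq_mul_inv]
  · push Not at h
    exact ⟨w, 0, fun f hf => by rw [h0 f hf (h f hf), smul_zero]⟩

omit H in
theorem _root_.SGDAMeanField.MomentProblem.measurable_integral_δΨ (P : MomentProblem 𝓧 𝓩 𝓦)
    {f h : 𝓦 → ℝ} (hf : f ∈ P.𝓕) (hh : h ∈ P.𝓕) :
    Measurable fun u : 𝓧 × 𝓩 => ∫ᵛ w, h w ∂<•(P.δΨ u.1 u.2 f) := by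
  refine measurable_of_tendsto_metrizable (f := fun (n : ℕ) (u : 𝓧 × 𝓩) => ((n : ℝ) + 1) *
    (P.Ψ u.1 u.2 (f + (1 / ((n : ℝ) + 1)) • h) - P.Ψ u.1 u.2 (f + (0 : ℝ) • h))) (fun n => ?_) ?_
  · exact ((P.measurable_Ψ _ (P.𝓕.add_mem hf (P.𝓕.smul_mem _ hh))).sub
      (P.measurable_Ψ _ (P.𝓕.add_mem hf (P.𝓕.smul_mem _ hh)))).const_mul _
  · exact tendsto_pi_nhds.mpr fun u =>
      tendsto_mul_sub_of_hasDerivAt (P.isVariation_Ψ u.1 u.2 f hf h hh).2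

theorem measurable_dirF {f : 𝓦 → ℝ} {g : 𝓩 → ℝ} (hf : f ∈ P.𝓕) (hg : Measurable g)
    (θ : Param D) : Measurable fun u => dirF P φ α lam u f g θ := by
  have h1 : Measurable fun u : 𝓧 × 𝓩 => ∫ᵛ w, gradient (φ w) θ ∂<•(P.δΦ u.1 u.2 f) := by
    refine H.neuron_φ.measurable_integral_gradient (fun θ => ?_) θ
    simp only [fun u : 𝓧 × 𝓩 => P.integral_δΦ u.1 u.2 hf (H.neuron_mem θ)]
    exact (P.measurable_Φ _ (H.neuron_mem θ)).sub (P.measurable_Φ _ P.𝓕.zero_mem)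
  have h2 : Measurable fun u : 𝓧 × 𝓩 => ∫ᵛ w, gradient (φ w) θ ∂<•(P.δΨ u.1 u.2 f) :=
    H.neuron_φ.measurable_integral_gradient
      (fun θ => P.measurable_integral_δΨ hf (H.neuron_mem θ)) θ
  exact ((((hg.comp measurable_snd).smul h1).neg).sub (h2.const_smul lam)).const_smul α

theorem measurable_dirG {f : 𝓦 → ℝ} {g : 𝓩 → ℝ} (hf : f ∈ P.𝓕) (hg : Measurable g)
    (ω : Param D) : Measurable fun u => dirG P ψ α u f g ω := by
  have h1 : Measurable fun u : 𝓧 × 𝓩 => gradient (ψ u.2) ω :=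
    (H.neuron_ψ.measurable_gradient ω).comp measurable_snd
  exact (((P.measurable_Φ f hf).smul h1).sub
    ((hg.comp measurable_snd).smul h1)).const_smul α

variable (u : 𝓧 × 𝓩) {f f' : 𝓦 → ℝ} {g g' : 𝓩 → ℝ} (hf : f ∈ P.𝓕) (hf' : f' ∈ P.𝓕) {a : ℝ}
  (ha : 0 ≤ a)

include hf ha in
theorem norm_dirF_le (hfa : ∀ w, |f w| ≤ a) (hga : ∀ z, |g z| ≤ a) (θ : Param D) :
    ‖dirF P φ α lam u f g θ‖ ≤ α * (B₁ * (C₂ + lam * CΨ)) * a := by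
  have h1 := H.norm_integral_gradient_le H.C₂_pos.le (H.functionals.bound_δΦ u.1 u.2 f hf) θ
  have h2 := H.norm_integral_gradient_le (mul_nonneg H.CΨ_pos.le ha)
    (H.bound_δΨ u.1 u.2 hf hfa) θ
  have hα := H.α_pos.le
  have hl := H.lam_nonneg
  rw [dirF, norm_smul, Real.norm_of_nonneg hα, mul_assoc]
  refine mul_le_mul_of_nonneg_left ?_ hα
  calc _ ≤ |g u.2| * ‖∫ᵛ w, gradient (φ w) θ ∂<•(P.δΦ u.1 u.2 f)‖ +
        lam * ‖∫ᵛ w, gradient (φ w) θ ∂<•(P.δΨ u.1 u.2 f)‖ := by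
        refine (norm_sub_le _ _).trans_eq ?_
        rw [norm_neg, norm_smul, norm_smul, Real.norm_of_nonneg hl, Real.norm_eq_abs]
    _ ≤ a * (B₁ * C₂) + lam * (B₁ * (CΨ * a)) := by
        gcongr
        exact hga _
    _ = _ := by ring

include hf ha in
theorem norm_dirF_sub_le (hfa : ∀ w, |f w| ≤ a) (hga : ∀ z, |g z| ≤ a) (θ θ' : Param D) :
    ‖dirF P φ α lam u f g θ - dirF P φ α lam u f g θ'‖ ≤
      α * (B₂ * (C₂ + lam * CΨ)) * a * ‖θ - θ'‖ := by
  have h1 := H.norm_integral_gradient_sub_le H.C₂_pos.le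
    (H.functionals.bound_δΦ u.1 u.2 f hf) θ θ'
  have h2 := H.norm_integral_gradient_sub_le (mul_nonneg H.CΨ_pos.le ha)
    (H.bound_δΨ u.1 u.2 hf hfa) θ θ'
  have hα := H.α_pos.le
  have hl := H.lam_nonneg
  rw [dirF, dirF, ← smul_sub, norm_smul, Real.norm_of_nonneg hα, mul_assoc, mul_assoc]
  refine mul_le_mul_of_nonneg_left ?_ hα
  generalize (∫ᵛ w, gradient (φ w) θ ∂<•(P.δΦ u.1 u.2 f)) = p at *
  generalize (∫ᵛ w, gradient (φ w) θ' ∂<•(P.δΦ u.1 u.2 f)) = p' at *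
  generalize (∫ᵛ w, gradient (φ w) θ ∂<•(P.δΨ u.1 u.2 f)) = q at *
  generalize (∫ᵛ w, gradient (φ w) θ' ∂<•(P.δΨ u.1 u.2 f)) = q' at *
  have e : (-(g u.2 • p) - lam • q) - (-(g u.2 • p') - lam • q') =
      -(g u.2 • (p - p')) - lam • (q - q') := by module
  rw [e]
  calc _ ≤ |g u.2| * ‖p - p'‖ + lam * ‖q - q'‖ := by
        refine (norm_sub_le _ _).trans_eq ?_
        rw [norm_neg, norm_smul, norm_smul, Real.norm_of_nonneg hl, Real.norm_eq_abs]
    _ ≤ a * (B₂ * ‖θ - θ'‖ * C₂) + lam * (B₂ * ‖θ - θ'‖ * (CΨ * a)) := by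
        gcongr
        exact hga _
    _ = _ := by ring

include hf hf' ha in
theorem norm_dirF_sub_net_le (hfa : ∀ w, |f w - f' w| ≤ a) (hga : ∀ z, |g z - g' z| ≤ a)
    (θ : Param D) :
    ‖dirF P φ α lam u f g θ - dirF P φ α lam u f' g' θ‖ ≤ α * (B₁ * (C₂ + lam * CΨ)) * a := by
  -- For fixed data and `θ` the direction is linear in the pair `(f, g)`, so the size bound applied
  -- to differences is the Lipschitz bound.
  have e : dirF P φ α lam u f g θ - dirF P φ α lam u f' g' θ =
      dirF P φ α lam u (f - f') (g - g') θ := by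
    have h1 := H.integral_gradient_δΨ_sub u.1 u.2 hf hf' 1 θ
    rw [one_smul, one_smul] at h1
    rw [dirF, dirF, dirF, h1, H.integral_gradient_δΦ u.1 u.2 hf (P.𝓕.sub_mem hf hf'),
      H.integral_gradient_δΦ u.1 u.2 hf' (P.𝓕.sub_mem hf hf'), Pi.sub_apply]
    module
  rw [e]
  exact H.norm_dirF_le u (P.𝓕.sub_mem hf hf') ha hfa hga θ

include hf ha in
theorem abs_Φ_sub_dual_le (hfa : ∀ w, |f w| ≤ a) (hga : ∀ z, |g z| ≤ a) :
    |P.Φ u.1 u.2 f - g u.2| ≤ C₀ + (C₂ + 1) * a := by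
  have h1 := H.abs_Φ_le u.1 u.2 hf ha hfa
  have h2 := hga u.2
  have h3 := abs_sub (P.Φ u.1 u.2 f) (g u.2)
  linarith

include hf ha in
theorem norm_dirG_le (hfa : ∀ w, |f w| ≤ a) (hga : ∀ z, |g z| ≤ a) (ω : Param D) :
    ‖dirG P ψ α u f g ω‖ ≤ α * (B₁ * (C₀ + (C₂ + 1) * a)) := by
  have hα := H.α_pos.le
  have h1 := H.abs_Φ_sub_dual_le u hf ha hfa hga
  rw [dirG, ← sub_smul, norm_smul, norm_smul, Real.norm_of_nonneg hα, Real.norm_eq_abs, mul_comm B₁]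
  gcongr
  · exact (abs_nonneg _).trans h1
  · exact H.neuron_ψ.bound_gradient _ _

include hf ha in
theorem norm_dirG_sub_le (hfa : ∀ w, |f w| ≤ a) (hga : ∀ z, |g z| ≤ a) (ω ω' : Param D) :
    ‖dirG P ψ α u f g ω - dirG P ψ α u f g ω'‖ ≤
      α * (B₂ * (C₀ + (C₂ + 1) * a)) * ‖ω - ω'‖ := by
  have hα := H.α_pos.le
  have h1 := H.abs_Φ_sub_dual_le u hf ha hfa hga
  rw [dirG, dirG, ← sub_smul, ← sub_smul, ← smul_sub, ← smul_sub, norm_smul, norm_smul,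
    Real.norm_of_nonneg hα, Real.norm_eq_abs, mul_assoc]
  refine mul_le_mul_of_nonneg_left ?_ hα
  calc _ ≤ (C₀ + (C₂ + 1) * a) * (B₂ * ‖ω - ω'‖) := by
        gcongr
        · exact (abs_nonneg _).trans h1
        · exact H.neuron_ψ.norm_gradient_sub_le _ _ _
    _ = _ := by ring

include hf hf' ha in
theorem norm_dirG_sub_net_le (hfa : ∀ w, |f w - f' w| ≤ a) (hga : ∀ z, |g z - g' z| ≤ a)
    (ω : Param D) :
    ‖dirG P ψ α u f g ω - dirG P ψ α u f' g' ω‖ ≤ α * (B₁ * (C₂ + 1)) * a := by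
  have hα := H.α_pos.le
  have h1 := H.abs_Φ_sub_le u.1 u.2 hf hf' ha hfa
  have h2 : |(P.Φ u.1 u.2 f - g u.2) - (P.Φ u.1 u.2 f' - g' u.2)| ≤ (C₂ + 1) * a := by
    have h3 := hga u.2
    have e : (P.Φ u.1 u.2 f - g u.2) - (P.Φ u.1 u.2 f' - g' u.2) =
      (P.Φ u.1 u.2 f - P.Φ u.1 u.2 f') - (g u.2 - g' u.2) := by ring
    rw [e]
    have := abs_sub (P.Φ u.1 u.2 f - P.Φ u.1 u.2 f') (g u.2 - g' u.2)
    linarith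
  rw [dirG, dirG, ← sub_smul, ← sub_smul, ← smul_sub, ← sub_smul, norm_smul, norm_smul,
    Real.norm_of_nonneg hα, Real.norm_eq_abs, mul_assoc]
  refine mul_le_mul_of_nonneg_left ?_ hα
  calc _ ≤ ((C₂ + 1) * a) * B₁ := by
        gcongr
        · exact (abs_nonneg _).trans h2
        · exact H.neuron_ψ.bound_gradient _ _
    _ = _ := by ring

end RegularModel

end Model

/-! ### Pair interaction, averaging identities and the mean-field velocity. -/

section MeanField

variable {𝓧 𝓩 𝓦 : Type*} [MeasurableSpace 𝓧] [MeasurableSpace 𝓩] [MeasurableSpace 𝓦] {D : ℕ}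

/-- The bound for the stochastic directions. -/
noncomputable def dirBound (α lam B₀ B₁ C₀ C₂ CΨ : ℝ) : ℝ :=
  α * (B₁ * (C₂ + lam * CΨ)) * (α * B₀) + α * (B₁ * (C₀ + (C₂ + 1) * (α * B₀)))

/-- The Lipschitz constant of the stochastic directions in the neuron. -/
noncomputable def dirLip (α lam B₀ B₂ C₀ C₂ CΨ : ℝ) : ℝ :=
  α * (B₂ * (C₂ + lam * CΨ)) * (α * B₀) + α * (B₂ * (C₀ + (C₂ + 1) * (α * B₀)))

/-- The Lipschitz constant of the stochastic directions in the law of the neurons. -/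
noncomputable def dirLawLip (α lam B₁ C₂ CΨ : ℝ) : ℝ :=
  (α * (B₁ * (C₂ + lam * CΨ)) + α * (B₁ * (C₂ + 1))) * (α * B₁)

namespace RegularNeuron

variable {S : Type*} [MeasurableSpace S] {B₀ B₁ B₂ α : ℝ} {φ : S → Param D → ℝ}
  (hφ : RegularNeuron B₀ B₁ B₂ φ)
include hφ

theorem continuous_neuron (s : S) : Continuous (φ s) := (hφ.differentiable s).continuous

theorem abs_wideNet_le (hα : 0 ≤ α) (μ : Measure (Param D)) [IsProbabilityMeasure μ] (s : S) :
    |wideNet α φ μ s| ≤ α * B₀ := by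
  rw [wideNet, abs_mul, abs_of_nonneg hα]
  exact mul_le_mul_of_nonneg_left (abs_integral_le (hφ.bound s)) hα

theorem abs_neuronNet_le (hα : 0 ≤ α) (θ : Param D) (s : S) : |neuronNet α φ θ s| ≤ α * B₀ := by
  rw [← hφ.wideNet_dirac]
  exact hφ.abs_wideNet_le hα _ s

theorem abs_neuronNet_sub_le (hα : 0 ≤ α) (θ θ' : Param D) (s : S) :
    |neuronNet α φ θ s - neuronNet α φ θ' s| ≤ α * B₁ * ‖θ - θ'‖ := by
  rw [neuronNet, neuronNet, ← mul_sub, abs_mul, abs_of_nonneg hα, mul_assoc]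
  exact mul_le_mul_of_nonneg_left (hφ.abs_sub_le s θ θ') hα

theorem measurable_wideNet (α : ℝ) (μ : Measure (Param D)) [SFinite μ] :
    Measurable (wideNet α φ μ) :=
  (hφ.measurable_uncurry.stronglyMeasurable.integral_prod_right (ν := μ)).measurable.const_mul α

theorem measurable_neuronNet (α : ℝ) (θ : Param D) : Measurable (neuronNet α φ θ) :=
  (hφ.measurable θ).const_mul α

theorem integral_neuronNet {Q : Type*} [MeasurableSpace Q] (π : Measure Q) {X : Q → Param D}
    (hX : Measurable X) (s : S) :
    ∫ q, neuronNet α φ (X q) s ∂π = wideNet α φ (π.map X) s := by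
  simp only [neuronNet, wideNet]
  rw [integral_const_mul, integral_map hX.aemeasurable
    (hφ.continuous_neuron s).aestronglyMeasurable]

theorem continuousOn_wideNet {m : ℝ → ProbabilityMeasure (Param D)}
    (hm : ContinuousOn m (Set.Ici 0)) (s : S) :
    ContinuousOn (fun t => wideNet α φ (m t : Measure (Param D)) s) (Set.Ici 0) :=
  ((ProbabilityMeasure.continuous_integral_boundedContinuousFunction
    (BoundedContinuousFunction.ofNormedAddCommGroup (φ s) (hφ.continuous_neuron s) B₀
      (hφ.bound s))).comp_continuousOn hm).const_mul α |>.congr fun _ _ => rfl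

end RegularNeuron

namespace RegularModel

variable {P : MomentProblem 𝓧 𝓩 𝓦} {φ : 𝓦 → Param D → ℝ} {ψ : 𝓩 → Param D → ℝ}
  {α lam B₀ B₁ B₂ C₀ C₂ CΨ : ℝ} (H : RegularModel P φ ψ α lam B₀ B₁ B₂ C₀ C₂ CΨ)
include H

theorem wideNet_mem (μ : Measure (Param D)) [hμ : IsProbabilityMeasure μ] :
    wideNet α φ μ ∈ P.𝓕 :=
  H.functionals.net_mem ⟨μ, hμ⟩

theorem net_bound_nonneg : 0 ≤ α * B₀ := mul_nonneg H.α_pos.le H.B₀_pos.le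

theorem dirBound_parts_pos : 0 < α * (B₁ * (C₂ + lam * CΨ)) * (α * B₀) ∧
    0 < α * (B₁ * (C₀ + (C₂ + 1) * (α * B₀))) := by
  obtain ⟨h1, h2, h3, h4, h5, h6, h7, h8, -, -, -⟩ := H
  constructor <;> positivity

theorem dirLip_parts_pos : 0 < α * (B₂ * (C₂ + lam * CΨ)) * (α * B₀) ∧
    0 < α * (B₂ * (C₀ + (C₂ + 1) * (α * B₀))) := by
  obtain ⟨h1, h2, h3, h4, h5, h6, h7, h8, -, -, -⟩ := H
  constructor <;> positivity

theorem dirLawLip_parts_pos : 0 < α * (B₁ * (C₂ + lam * CΨ)) ∧ 0 < α * (B₁ * (C₂ + 1)) ∧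
    0 < α * B₁ := by
  obtain ⟨h1, h2, h3, h4, h5, h6, h7, h8, -, -, -⟩ := H
  refine ⟨?_, ?_, ?_⟩ <;> positivity

theorem dirBound_pos : 0 < dirBound α lam B₀ B₁ C₀ C₂ CΨ :=
  add_pos H.dirBound_parts_pos.1 H.dirBound_parts_pos.2

theorem dirLip_pos : 0 < dirLip α lam B₀ B₂ C₀ C₂ CΨ :=
  add_pos H.dirLip_parts_pos.1 H.dirLip_parts_pos.2

theorem dirLawLip_pos : 0 < dirLawLip α lam B₁ C₂ CΨ :=
  mul_pos (add_pos H.dirLawLip_parts_pos.1 H.dirLawLip_parts_pos.2.1) H.dirLawLip_parts_pos.2.2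

/-! ### The pair interaction -/

omit H in
/-- The interaction of two neuron pairs in stochastic gradient descent-ascent. -/
noncomputable def _root_.SGDAMeanField.pairInteraction (P : MomentProblem 𝓧 𝓩 𝓦)
    (φ : 𝓦 → Param D → ℝ) (ψ : 𝓩 → Param D → ℝ) (α lam : ℝ) (u : 𝓧 × 𝓩)
    (s s' : WithLp 2 (Param D × Param D)) : WithLp 2 (Param D × Param D) :=
  WithLp.toLp 2 (dirF P φ α lam u (neuronNet α φ s'.fst) (neuronNet α ψ s'.snd) s.fst,
    dirG P ψ α u (neuronNet α φ s'.fst) (neuronNet α ψ s'.snd) s.snd)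

omit H in
theorem _root_.SGDAMeanField.norm_toLp_pair_le (x y : Param D) :
    ‖(WithLp.toLp 2 (x, y) : WithLp 2 (Param D × Param D))‖ ≤ ‖x‖ + ‖y‖ := by
  rw [WithLp.prod_norm_eq_of_L2]
  refine (Real.sqrt_le_sqrt (y := (‖x‖ + ‖y‖) ^ 2) ?_).trans_eq (Real.sqrt_sq (by positivity))
  change ‖x‖ ^ 2 + ‖y‖ ^ 2 ≤ _
  nlinarith [norm_nonneg x, norm_nonneg y]

/-- The neuron is changed first with the networks fixed, at cost `dirLip`; then the single-neuron
networks are changed, at cost `dirLawLip`. The sum of the two constants serves for both arguments.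
-/
theorem lipschitzInteraction : LipschitzInteraction (pairInteraction P φ ψ α lam)
    (dirBound α lam B₀ B₁ C₀ C₂ CΨ)
    (dirLip α lam B₀ B₂ C₀ C₂ CΨ + dirLawLip α lam B₁ C₂ CΨ) where
  measurable s s' := (WithLp.measurable_toLp _ _).comp
    ((H.measurable_dirF (H.neuronNet_mem _) (H.neuron_ψ.measurable_neuronNet _ _) _).prodMk
      (H.measurable_dirG (H.neuronNet_mem _) (H.neuron_ψ.measurable_neuronNet _ _) _))
  bound u s s' := (norm_toLp_pair_le _ _).trans (add_le_add
    (H.norm_dirF_le u (H.neuronNet_mem _) H.net_bound_nonneg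
      (H.neuron_φ.abs_neuronNet_le H.α_pos.le _) (H.neuron_ψ.abs_neuronNet_le H.α_pos.le _) _)
    (H.norm_dirG_le u (H.neuronNet_mem _) H.net_bound_nonneg
      (H.neuron_φ.abs_neuronNet_le H.α_pos.le _) (H.neuron_ψ.abs_neuronNet_le H.α_pos.le _) _))
  lipschitz u s s' t t' := by
    have hl1 := H.dirLip_parts_pos.1
    have hl2 := H.dirLip_parts_pos.2
    obtain ⟨hm1, hm2, hm3⟩ := H.dirLawLip_parts_pos
    have hd1 : ‖s.fst - t.fst‖ ≤ ‖s - t‖ := WithLp.norm_fst_le _ (s - t)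
    have hd2 : ‖s.snd - t.snd‖ ≤ ‖s - t‖ := WithLp.norm_snd_le _ (s - t)
    have hd1' : ‖s'.fst - t'.fst‖ ≤ ‖s' - t'‖ := WithLp.norm_fst_le _ (s' - t')
    have hd2' : ‖s'.snd - t'.snd‖ ≤ ‖s' - t'‖ := WithLp.norm_snd_le _ (s' - t')
    have ha : 0 ≤ α * B₁ * ‖s' - t'‖ := mul_nonneg hm3.le (norm_nonneg _)
    have hφa : ∀ w, |neuronNet α φ s'.fst w - neuronNet α φ t'.fst w| ≤ α * B₁ * ‖s' - t'‖ :=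
      fun w => (H.neuron_φ.abs_neuronNet_sub_le H.α_pos.le _ _ w).trans (by gcongr)
    have hψa : ∀ z, |neuronNet α ψ s'.snd z - neuronNet α ψ t'.snd z| ≤ α * B₁ * ‖s' - t'‖ :=
      fun z => (H.neuron_ψ.abs_neuronNet_sub_le H.α_pos.le _ _ z).trans (by gcongr)
    have h1 := H.norm_dirF_sub_le u (H.neuronNet_mem s'.fst) H.net_bound_nonneg
      (H.neuron_φ.abs_neuronNet_le H.α_pos.le _)
      (H.neuron_ψ.abs_neuronNet_le H.α_pos.le s'.snd) s.fst t.fst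
    have h2 := H.norm_dirG_sub_le u (H.neuronNet_mem s'.fst) H.net_bound_nonneg
      (H.neuron_φ.abs_neuronNet_le H.α_pos.le _)
      (H.neuron_ψ.abs_neuronNet_le H.α_pos.le s'.snd) s.snd t.snd
    have h3 := H.norm_dirF_sub_net_le u (H.neuronNet_mem s'.fst) (H.neuronNet_mem t'.fst) ha
      hφa hψa t.fst
    have h4 := H.norm_dirG_sub_net_le u (H.neuronNet_mem s'.fst) (H.neuronNet_mem t'.fst) ha
      hφa hψa t.snd
    have h5 : pairInteraction P φ ψ α lam u s s' - pairInteraction P φ ψ α lam u t t' =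
        WithLp.toLp 2
          (dirF P φ α lam u (neuronNet α φ s'.fst) (neuronNet α ψ s'.snd) s.fst -
            dirF P φ α lam u (neuronNet α φ t'.fst) (neuronNet α ψ t'.snd) t.fst,
          dirG P ψ α u (neuronNet α φ s'.fst) (neuronNet α ψ s'.snd) s.snd -
            dirG P ψ α u (neuronNet α φ t'.fst) (neuronNet α ψ t'.snd) t.snd) := rfl
    rw [h5]
    refine (norm_toLp_pair_le _ _).trans ?_
    have h6 := norm_sub_le_norm_sub_add_norm_sub
      (dirF P φ α lam u (neuronNet α φ s'.fst) (neuronNet α ψ s'.snd) s.fst)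
      (dirF P φ α lam u (neuronNet α φ s'.fst) (neuronNet α ψ s'.snd) t.fst)
      (dirF P φ α lam u (neuronNet α φ t'.fst) (neuronNet α ψ t'.snd) t.fst)
    have h7 := norm_sub_le_norm_sub_add_norm_sub
      (dirG P ψ α u (neuronNet α φ s'.fst) (neuronNet α ψ s'.snd) s.snd)
      (dirG P ψ α u (neuronNet α φ s'.fst) (neuronNet α ψ s'.snd) t.snd)
      (dirG P ψ α u (neuronNet α φ t'.fst) (neuronNet α ψ t'.snd) t.snd)
    have h8 := mul_le_mul_of_nonneg_left hd1 hl1.le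
    have h9 := mul_le_mul_of_nonneg_left hd2 hl2.le
    have e : (dirLip α lam B₀ B₂ C₀ C₂ CΨ + dirLawLip α lam B₁ C₂ CΨ) *
        (‖s - t‖ + ‖s' - t'‖) = dirLip α lam B₀ B₂ C₀ C₂ CΨ * ‖s - t‖ +
        dirLawLip α lam B₁ C₂ CΨ * ‖s' - t'‖ + dirLawLip α lam B₁ C₂ CΨ * ‖s - t‖ +
        dirLip α lam B₀ B₂ C₀ C₂ CΨ * ‖s' - t'‖ := by ring
    have h10 := mul_nonneg H.dirLawLip_pos.le (norm_nonneg (s - t))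
    have h11 := mul_nonneg H.dirLip_pos.le (norm_nonneg (s' - t'))
    have e1 : dirLip α lam B₀ B₂ C₀ C₂ CΨ * ‖s - t‖ =
      α * (B₂ * (C₂ + lam * CΨ)) * (α * B₀) * ‖s - t‖ +
      α * (B₂ * (C₀ + (C₂ + 1) * (α * B₀))) * ‖s - t‖ := by rw [dirLip]; ring
    have e2 : dirLawLip α lam B₁ C₂ CΨ * ‖s' - t'‖ =
      α * (B₁ * (C₂ + lam * CΨ)) * (α * B₁ * ‖s' - t'‖) +
      α * (B₁ * (C₂ + 1)) * (α * B₁ * ‖s' - t'‖) := by rw [dirLawLip]; ring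
    linarith

/-- Averaging the directions of single-neuron networks gives the direction of the averaged
networks. -/
theorem integral_dirF_neuronNet {Q : Type*} [MeasurableSpace Q] (π : Measure Q)
    [IsProbabilityMeasure π] {X Y : Q → Param D} (hX : Measurable X) (hY : Measurable Y)
    (u : 𝓧 × 𝓩) (θ : Param D) :
    Integrable (fun q => dirF P φ α lam u (neuronNet α φ (X q)) (neuronNet α ψ (Y q)) θ) π ∧
    ∫ q, dirF P φ α lam u (neuronNet α φ (X q)) (neuronNet α ψ (Y q)) θ ∂π =
      dirF P φ α lam u (wideNet α φ (π.map X)) (wideNet α ψ (π.map Y)) θ := by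
  have := Measure.isProbabilityMeasure_map hX.aemeasurable (μ := π)
  obtain ⟨w, r, hr⟩ := H.exists_integral_gradient_δΨ u.1 u.2 θ
  set A := ∫ᵛ w, gradient (φ w) θ ∂<•(P.δΦ u.1 u.2 0)
  -- In this form the direction depends on the networks only through the two numbers `g u.2` and `f
  -- w`, and linearly, so it commutes with averaging.
  have hdir : ∀ f ∈ P.𝓕, ∀ g : 𝓩 → ℝ, dirF P φ α lam u f g θ =
      α • (-(g u.2 • A) - lam • (f w • r)) := fun f hf g => by
    rw [dirF, hr f hf, H.integral_gradient_δΦ u.1 u.2 hf P.𝓕.zero_mem]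
  have hiφ : Integrable (fun q => neuronNet α φ (X q) w) π :=
    Integrable.of_bound ((((H.neuron_φ.continuous_neuron w).measurable.comp
      hX).const_mul α).aestronglyMeasurable) (α * B₀)
      (Eventually.of_forall fun q => H.neuron_φ.abs_neuronNet_le H.α_pos.le _ _)
  have hiψ : Integrable (fun q => neuronNet α ψ (Y q) u.2) π :=
    Integrable.of_bound ((((H.neuron_ψ.continuous_neuron u.2).measurable.comp
      hY).const_mul α).aestronglyMeasurable) (α * B₀)
      (Eventually.of_forall fun q => H.neuron_ψ.abs_neuronNet_le H.α_pos.le _ _)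
  have h1 : Integrable (fun q => -(neuronNet α ψ (Y q) u.2 • A)) π := (hiψ.smul_const A).neg
  have h2 : Integrable (fun q => lam • (neuronNet α φ (X q) w • r)) π :=
    (hiφ.smul_const r).smul lam
  simp only [fun q => hdir _ (H.neuronNet_mem (X q)) (neuronNet α ψ (Y q))]
  refine ⟨(h1.sub h2).smul α, ?_⟩
  rw [integral_smul, integral_sub h1 h2, integral_neg, integral_smul, integral_smul_const,
    integral_smul_const, H.neuron_φ.integral_neuronNet π hX, H.neuron_ψ.integral_neuronNet π hY,
    hdir _ (H.wideNet_mem _)]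

theorem integral_dirG_neuronNet {Q : Type*} [MeasurableSpace Q] (π : Measure Q)
    [IsProbabilityMeasure π] {X Y : Q → Param D} (hX : Measurable X) (hY : Measurable Y)
    (u : 𝓧 × 𝓩) (ω : Param D) :
    Integrable (fun q => dirG P ψ α u (neuronNet α φ (X q)) (neuronNet α ψ (Y q)) ω) π ∧
    ∫ q, dirG P ψ α u (neuronNet α φ (X q)) (neuronNet α ψ (Y q)) ω ∂π =
      dirG P ψ α u (wideNet α φ (π.map X)) (wideNet α ψ (π.map Y)) ω := by
  have := Measure.isProbabilityMeasure_map hX.aemeasurable (μ := π)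
  have hΦc : Continuous fun θ => P.Φ u.1 u.2 (neuronNet α φ θ) :=
    continuous_of_abs_sub_le (A := α * B₁ * C₂) fun θ θ' => by
      refine (H.abs_Φ_sub_le u.1 u.2 (H.neuronNet_mem θ) (H.neuronNet_mem θ')
        (a := α * B₁ * ‖θ - θ'‖) (mul_nonneg H.dirLawLip_parts_pos.2.2.le (norm_nonneg _))
        (H.neuron_φ.abs_neuronNet_sub_le H.α_pos.le θ θ')).trans_eq ?_
      rw [dist_eq_norm]; ring
  have hiΦ : Integrable (fun q => P.Φ u.1 u.2 (neuronNet α φ (X q))) π :=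
    Integrable.of_bound (hΦc.measurable.comp hX).aestronglyMeasurable _
      (Eventually.of_forall fun q => H.abs_Φ_le u.1 u.2 (H.neuronNet_mem (X q))
        H.net_bound_nonneg (H.neuron_φ.abs_neuronNet_le H.α_pos.le _))
  have hiψ : Integrable (fun q => neuronNet α ψ (Y q) u.2) π :=
    Integrable.of_bound ((((H.neuron_ψ.continuous_neuron u.2).measurable.comp
      hY).const_mul α).aestronglyMeasurable) (α * B₀)
      (Eventually.of_forall fun q => H.neuron_ψ.abs_neuronNet_le H.α_pos.le _ _)
  -- Affinity in finite combinations does not suffice for a general law. The representation of `Φ -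
  -- Φ(0)` as an integral against `δΦ` and Fubini give the identity.
  have hΦ : ∫ q, P.Φ u.1 u.2 (neuronNet α φ (X q)) ∂π =
      P.Φ u.1 u.2 (wideNet α φ (π.map X)) := by
    have h1 : ∫ᵛ w, (∫ q, neuronNet α φ (X q) w ∂π) ∂<•(P.δΦ u.1 u.2 0) =
        ∫ q, (∫ᵛ w, neuronNet α φ (X q) w ∂<•(P.δΦ u.1 u.2 0)) ∂π :=
      integral_signedMeasure_integral π _ (c := α * B₀)
        ((H.neuron_φ.measurable_uncurry.comp
          (measurable_fst.prodMk (hX.comp measurable_snd))).const_mul α)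
        fun w q => H.neuron_φ.abs_neuronNet_le H.α_pos.le _ _
    simp only [H.neuron_φ.integral_neuronNet π hX] at h1
    rw [P.integral_δΦ u.1 u.2 P.𝓕.zero_mem (H.wideNet_mem _)] at h1
    simp only [fun q => P.integral_δΦ u.1 u.2 P.𝓕.zero_mem (H.neuronNet_mem (X q))] at h1
    rw [integral_sub hiΦ (integrable_const _)] at h1
    simp only [integral_const, probReal_univ, one_smul] at h1
    linarith
  have h1 : Integrable (fun q => P.Φ u.1 u.2 (neuronNet α φ (X q)) • gradient (ψ u.2) ω) π :=
    hiΦ.smul_const _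
  have h2 : Integrable (fun q => neuronNet α ψ (Y q) u.2 • gradient (ψ u.2) ω) π :=
    hiψ.smul_const _
  simp only [dirG]
  refine ⟨(h1.sub h2).smul α, ?_⟩
  rw [integral_smul, integral_sub h1 h2, integral_smul_const, integral_smul_const, hΦ,
    H.neuron_ψ.integral_neuronNet π hY]

omit H in
theorem _root_.SGDAMeanField.integral_toLp_pair {Q : Type*} [MeasurableSpace Q] {π : Measure Q}
    {F G : Q → Param D} (hF : Integrable F π) (hG : Integrable G π) :
    ∫ q, (WithLp.toLp 2 (F q, G q) : WithLp 2 (Param D × Param D)) ∂π =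
      WithLp.toLp 2 (∫ q, F q ∂π, ∫ q, G q ∂π) := by
  rw [← integral_pair hF hG]
  exact (WithLp.prodContinuousLinearEquiv 2 ℝ (Param D) (Param D)).symm.integral_comp_comm
    fun q => (F q, G q)

theorem integral_pairInteraction {Q : Type*} [MeasurableSpace Q] (π : Measure Q)
    [IsProbabilityMeasure π] {X Y : Q → Param D} (hX : Measurable X) (hY : Measurable Y)
    (u : 𝓧 × 𝓩) (s : WithLp 2 (Param D × Param D)) :
    ∫ q, pairInteraction P φ ψ α lam u s (WithLp.toLp 2 (X q, Y q)) ∂π =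
      WithLp.toLp 2 (dirF P φ α lam u (wideNet α φ (π.map X)) (wideNet α ψ (π.map Y)) s.fst,
        dirG P ψ α u (wideNet α φ (π.map X)) (wideNet α ψ (π.map Y)) s.snd) := by
  have h1 := H.integral_dirF_neuronNet π hX hY u s.fst
  have h2 := H.integral_dirG_neuronNet π hX hY u s.snd
  rw [← h1.2, ← h2.2, ← integral_toLp_pair h1.1 h2.1]
  rfl

/-! ### The mean-field velocity -/

variable {𝓓 : Measure (𝓧 × 𝓩)} [IsProbabilityMeasure 𝓓] (μ ν μ' ν' : Measure (Param D))
  [IsProbabilityMeasure μ] [IsProbabilityMeasure ν] [IsProbabilityMeasure μ']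
  [IsProbabilityMeasure ν']

theorem norm_dirF_wideNet_le (u : 𝓧 × 𝓩) (θ : Param D) :
    ‖dirF P φ α lam u (wideNet α φ μ) (wideNet α ψ ν) θ‖ ≤ dirBound α lam B₀ B₁ C₀ C₂ CΨ :=
  (H.norm_dirF_le u (H.wideNet_mem μ) H.net_bound_nonneg (H.neuron_φ.abs_wideNet_le H.α_pos.le μ)
    (H.neuron_ψ.abs_wideNet_le H.α_pos.le ν) θ).trans
      (le_add_of_nonneg_right H.dirBound_parts_pos.2.le)

theorem norm_dirG_wideNet_le (u : 𝓧 × 𝓩) (ω : Param D) :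
    ‖dirG P ψ α u (wideNet α φ μ) (wideNet α ψ ν) ω‖ ≤ dirBound α lam B₀ B₁ C₀ C₂ CΨ :=
  (H.norm_dirG_le u (H.wideNet_mem μ) H.net_bound_nonneg (H.neuron_φ.abs_wideNet_le H.α_pos.le μ)
    (H.neuron_ψ.abs_wideNet_le H.α_pos.le ν) ω).trans
      (le_add_of_nonneg_left H.dirBound_parts_pos.1.le)

theorem integrable_dirF (θ : Param D) :
    Integrable (fun u => dirF P φ α lam u (wideNet α φ μ) (wideNet α ψ ν) θ) 𝓓 :=
  Integrable.of_bound (H.measurable_dirF (H.wideNet_mem μ)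
    (H.neuron_ψ.measurable_wideNet α ν) θ).aestronglyMeasurable _
    (Eventually.of_forall fun u => H.norm_dirF_wideNet_le μ ν u θ)

theorem integrable_dirG (ω : Param D) :
    Integrable (fun u => dirG P ψ α u (wideNet α φ μ) (wideNet α ψ ν) ω) 𝓓 :=
  Integrable.of_bound (H.measurable_dirG (H.wideNet_mem μ)
    (H.neuron_ψ.measurable_wideNet α ν) ω).aestronglyMeasurable _
    (Eventually.of_forall fun u => H.norm_dirG_wideNet_le μ ν u ω)

omit H in
theorem _root_.SGDAMeanField.norm_integral_le_const {X : Type*} [MeasurableSpace X]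
    {m : Measure X} [IsProbabilityMeasure m] {f : X → Param D} {a : ℝ} (h : ∀ x, ‖f x‖ ≤ a) :
    ‖∫ x, f x ∂m‖ ≤ a := by
  simpa using norm_integral_le_of_norm_le_const (μ := m) (Eventually.of_forall h)

omit H in
theorem _root_.SGDAMeanField.norm_integral_sub_integral_le {X : Type*} [MeasurableSpace X]
    {m : Measure X} [IsProbabilityMeasure m] {f g : X → Param D} {a : ℝ} (hf : Integrable f m)
    (hg : Integrable g m) (h : ∀ x, ‖f x - g x‖ ≤ a) :
    ‖(∫ x, f x ∂m) - ∫ x, g x ∂m‖ ≤ a := by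
  rw [← integral_sub hf hg]
  exact norm_integral_le_const h

theorem norm_velF_le (θ : Param D) :
    ‖velF P 𝓓 φ ψ α lam μ ν θ‖ ≤ dirBound α lam B₀ B₁ C₀ C₂ CΨ :=
  norm_integral_le_const fun u => H.norm_dirF_wideNet_le μ ν u θ

theorem norm_velG_le (ω : Param D) :
    ‖velG P 𝓓 φ ψ α μ ν ω‖ ≤ dirBound α lam B₀ B₁ C₀ C₂ CΨ :=
  norm_integral_le_const fun u => H.norm_dirG_wideNet_le μ ν u ω

theorem norm_velF_sub_le (θ θ' : Param D) :
    ‖velF P 𝓓 φ ψ α lam μ ν θ - velF P 𝓓 φ ψ α lam μ ν θ'‖ ≤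
      dirLip α lam B₀ B₂ C₀ C₂ CΨ * ‖θ - θ'‖ :=
  norm_integral_sub_integral_le (H.integrable_dirF μ ν θ) (H.integrable_dirF μ ν θ') fun u =>
    (H.norm_dirF_sub_le u (H.wideNet_mem μ) H.net_bound_nonneg
      (H.neuron_φ.abs_wideNet_le H.α_pos.le μ) (H.neuron_ψ.abs_wideNet_le H.α_pos.le ν) θ θ').trans
      (mul_le_mul_of_nonneg_right (le_add_of_nonneg_right H.dirLip_parts_pos.2.le)
        (norm_nonneg _))

theorem norm_velG_sub_le (ω ω' : Param D) :
    ‖velG P 𝓓 φ ψ α μ ν ω - velG P 𝓓 φ ψ α μ ν ω'‖ ≤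
      dirLip α lam B₀ B₂ C₀ C₂ CΨ * ‖ω - ω'‖ :=
  norm_integral_sub_integral_le (H.integrable_dirG μ ν ω) (H.integrable_dirG μ ν ω') fun u =>
    (H.norm_dirG_sub_le u (H.wideNet_mem μ) H.net_bound_nonneg
      (H.neuron_φ.abs_wideNet_le H.α_pos.le μ) (H.neuron_ψ.abs_wideNet_le H.α_pos.le ν) ω ω').trans
      (mul_le_mul_of_nonneg_right (le_add_of_nonneg_left H.dirLip_parts_pos.1.le)
        (norm_nonneg _))

omit H in
theorem _root_.SGDAMeanField.abs_wideNet_sub_le {S : Type*} {φ : S → Param D → ℝ} (hα : 0 ≤ α)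
    {μ μ' : Measure (Param D)} {c : ℝ}
    (h : ∀ s, |(∫ θ, φ s θ ∂μ) - ∫ θ, φ s θ ∂μ'| ≤ c) (s : S) :
    |wideNet α φ μ s - wideNet α φ μ' s| ≤ α * c := by
  rw [wideNet, wideNet, ← mul_sub, abs_mul, abs_of_nonneg hα]
  exact mul_le_mul_of_nonneg_left (h s) hα

variable {μ ν μ' ν'} {a : ℝ} (ha : 0 ≤ a)
  (hμ : ∀ w, |(∫ θ, φ w θ ∂μ) - ∫ θ, φ w θ ∂μ'| ≤ B₁ * a)
  (hν : ∀ z, |(∫ ω, ψ z ω ∂ν) - ∫ ω, ψ z ω ∂ν'| ≤ B₁ * a)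
include ha hμ hν

/-- The laws enter only through the networks, so it suffices to compare them on neurons. Since
neurons are `B₁`-Lipschitz, `a` plays the role of a transport distance. -/
theorem norm_velF_sub_law_le (θ : Param D) :
    ‖velF P 𝓓 φ ψ α lam μ ν θ - velF P 𝓓 φ ψ α lam μ' ν' θ‖ ≤ dirLawLip α lam B₁ C₂ CΨ * a := by
  obtain ⟨h1, h2, h3⟩ := H.dirLawLip_parts_pos
  refine norm_integral_sub_integral_le (H.integrable_dirF μ ν θ) (H.integrable_dirF μ' ν' θ)
    fun u => (H.norm_dirF_sub_net_le u (H.wideNet_mem μ) (H.wideNet_mem μ') (a := α * (B₁ * a))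
      (mul_nonneg H.α_pos.le (mul_nonneg H.B₁_pos.le ha)) (abs_wideNet_sub_le H.α_pos.le hμ)
      (abs_wideNet_sub_le H.α_pos.le hν) θ).trans ?_
  rw [dirLawLip, ← mul_assoc α B₁ a, mul_assoc (_ + _)]
  exact mul_le_mul_of_nonneg_right (le_add_of_nonneg_right h2.le) (mul_nonneg h3.le ha)

theorem norm_velG_sub_law_le (ω : Param D) :
    ‖velG P 𝓓 φ ψ α μ ν ω - velG P 𝓓 φ ψ α μ' ν' ω‖ ≤ dirLawLip α lam B₁ C₂ CΨ * a := by
  obtain ⟨h1, h2, h3⟩ := H.dirLawLip_parts_pos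
  refine norm_integral_sub_integral_le (H.integrable_dirG μ ν ω) (H.integrable_dirG μ' ν' ω)
    fun u => (H.norm_dirG_sub_net_le u (H.wideNet_mem μ) (H.wideNet_mem μ') (a := α * (B₁ * a))
      (mul_nonneg H.α_pos.le (mul_nonneg H.B₁_pos.le ha)) (abs_wideNet_sub_le H.α_pos.le hμ)
      (abs_wideNet_sub_le H.α_pos.le hν) ω).trans ?_
  rw [dirLawLip, ← mul_assoc α B₁ a, mul_assoc (_ + _)]
  exact mul_le_mul_of_nonneg_right (le_add_of_nonneg_left h1.le) (mul_nonneg h3.le ha)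

end RegularModel

end MeanField

/-! ### Time regularity of the mean-field velocity. -/

section MeanFieldRegularity

variable {𝓧 𝓩 𝓦 : Type*} [MeasurableSpace 𝓧] [MeasurableSpace 𝓩] [MeasurableSpace 𝓦] {D : ℕ}

namespace RegularModel

variable {P : MomentProblem 𝓧 𝓩 𝓦} {φ : 𝓦 → Param D → ℝ} {ψ : 𝓩 → Param D → ℝ}
  {α lam B₀ B₁ B₂ C₀ C₂ CΨ : ℝ} (H : RegularModel P φ ψ α lam B₀ B₁ B₂ C₀ C₂ CΨ)
  {μ ν : ℝ → ProbabilityMeasure (Param D)} {𝓓 : Measure (𝓧 × 𝓩)} [IsProbabilityMeasure 𝓓]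
include H

/-- Narrow continuity of the laws gives continuity of the velocity in time. This qualitative fact
gives access to the speed bound for weak solutions, which then upgrades it to a Lipschitz bound. -/
theorem continuousOn_velF (hμ : ContinuousOn μ (Set.Ici 0)) (hν : ContinuousOn ν (Set.Ici 0))
    (θ : Param D) : ContinuousOn (fun t => velF P 𝓓 φ ψ α lam (μ t) (ν t) θ) (Set.Ici 0) := by
  refine continuousOn_of_dominated (bound := fun _ => dirBound α lam B₀ B₁ C₀ C₂ CΨ)
    (fun t _ => (H.integrable_dirF (μ t : Measure (Param D)) (ν t) θ).aestronglyMeasurable)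
    (fun t _ => Eventually.of_forall fun u => H.norm_dirF_wideNet_le _ _ u θ)
    (integrable_const _) (Eventually.of_forall fun u => ?_)
  obtain ⟨w, r, hr⟩ := H.exists_integral_gradient_δΨ u.1 u.2 θ
  have e : ∀ t, dirF P φ α lam u (wideNet α φ (μ t : Measure (Param D)))
      (wideNet α ψ (ν t : Measure (Param D))) θ =
      α • (-(wideNet α ψ (ν t : Measure (Param D)) u.2 •
        ∫ᵛ w, gradient (φ w) θ ∂<•(P.δΦ u.1 u.2 0)) -
        lam • (wideNet α φ (μ t : Measure (Param D)) w • r)) := fun t => by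
    rw [dirF, hr _ (H.wideNet_mem _),
      H.integral_gradient_δΦ u.1 u.2 (H.wideNet_mem _) P.𝓕.zero_mem]
  simp only [e]
  exact ((((H.neuron_ψ.continuousOn_wideNet hν u.2).smul continuousOn_const).neg).sub
    (((H.neuron_φ.continuousOn_wideNet hμ w).smul continuousOn_const).const_smul lam)).const_smul α

theorem continuousOn_velG (hμ : ContinuousOn μ (Set.Ici 0)) (hν : ContinuousOn ν (Set.Ici 0))
    (ω : Param D) : ContinuousOn (fun t => velG P 𝓓 φ ψ α (μ t) (ν t) ω) (Set.Ici 0) := by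
  refine continuousOn_of_dominated (bound := fun _ => dirBound α lam B₀ B₁ C₀ C₂ CΨ)
    (fun t _ => (H.integrable_dirG (μ t : Measure (Param D)) (ν t) ω).aestronglyMeasurable)
    (fun t _ => Eventually.of_forall fun u => H.norm_dirG_wideNet_le _ _ u ω)
    (integrable_const _) (Eventually.of_forall fun u => ?_)
  have hΦ : ContinuousOn
      (fun t => P.Φ u.1 u.2 (wideNet α φ (μ t : Measure (Param D)))) (Set.Ici 0) := by
    have e : ∀ t, P.Φ u.1 u.2 (wideNet α φ (μ t : Measure (Param D))) =
        (∫ᵛ w, wideNet α φ (μ t : Measure (Param D)) w ∂<•(P.δΦ u.1 u.2 0)) +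
          P.Φ u.1 u.2 0 := fun t => by
      rw [P.integral_δΦ u.1 u.2 P.𝓕.zero_mem (H.wideNet_mem _), sub_add_cancel]
    simp only [e]
    refine ContinuousOn.add ?_ continuousOn_const
    exact VectorMeasure.continuousOn_of_dominated (bound := fun _ => α * B₀)
      (fun t _ => (H.neuron_φ.measurable_wideNet α _).aestronglyMeasurable)
      (fun t _ => Eventually.of_forall fun w => H.neuron_φ.abs_wideNet_le H.α_pos.le _ w)
      (integrable_const _)
      (Eventually.of_forall fun w => H.neuron_φ.continuousOn_wideNet hμ w)
  exact ((hΦ.smul continuousOn_const).sub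
    ((H.neuron_ψ.continuousOn_wideNet hν u.2).smul continuousOn_const)).const_smul α

theorem continuous_velF (μ ν : Measure (Param D)) [IsProbabilityMeasure μ]
    [IsProbabilityMeasure ν] : Continuous (velF P 𝓓 φ ψ α lam μ ν) :=
  (LipschitzWith.of_dist_le' fun x y => by
    rw [dist_eq_norm, dist_eq_norm]; exact H.norm_velF_sub_le μ ν x y).continuous

theorem continuous_velG (μ ν : Measure (Param D)) [IsProbabilityMeasure μ]
    [IsProbabilityMeasure ν] : Continuous (velG P 𝓓 φ ψ α μ ν) :=
  (LipschitzWith.of_dist_le' fun x y => by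
    rw [dist_eq_norm, dist_eq_norm]; exact H.norm_velG_sub_le μ ν x y).continuous

variable {η : ℝ} (hη : 0 ≤ η) (hS : IsMeanFieldSolution P 𝓓 φ ψ α lam η μ ν)
include hη hS

theorem abs_integral_μ_sub_le {s t : ℝ} (hs : 0 ≤ s) (ht : 0 ≤ t) {ζ : Param D → ℝ} {A b : ℝ}
    (hA : 0 ≤ A) (hb : ∀ x, |ζ x| ≤ b) (hζ : ∀ x y, |ζ x - ζ y| ≤ A * ‖x - y‖) :
    |(∫ θ, ζ θ ∂(μ t : Measure (Param D))) - ∫ θ, ζ θ ∂(μ s : Measure (Param D))| ≤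
      A * (η * dirBound α lam B₀ B₁ C₀ C₂ CΨ * |t - s|) :=
  hS.pde_μ.abs_integral_sub_le hη (fun _ => H.norm_velF_le _ _) (fun _ => H.continuous_velF _ _)
    (H.continuousOn_velF hS.pde_μ.1 hS.pde_ν.1) hs ht hA hb hζ

theorem abs_integral_ν_sub_le {s t : ℝ} (hs : 0 ≤ s) (ht : 0 ≤ t) {ζ : Param D → ℝ} {A b : ℝ}
    (hA : 0 ≤ A) (hb : ∀ x, |ζ x| ≤ b) (hζ : ∀ x y, |ζ x - ζ y| ≤ A * ‖x - y‖) :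
    |(∫ θ, ζ θ ∂(ν t : Measure (Param D))) - ∫ θ, ζ θ ∂(ν s : Measure (Param D))| ≤
      A * (η * dirBound α lam B₀ B₁ C₀ C₂ CΨ * |t - s|) :=
  hS.pde_ν.abs_integral_sub_le hη (fun _ => H.norm_velG_le _ _) (fun _ => H.continuous_velG _ _)
    (H.continuousOn_velG hS.pde_μ.1 hS.pde_ν.1) hs ht hA hb hζ

/-- The law moves at speed at most `η * dirBound`, and the velocity is `dirLawLip`-Lipschitz in the
law; their product is the Lipschitz constant in time. -/
theorem regularVelocity_velF : RegularVelocity (fun t => velF P 𝓓 φ ψ α lam (μ t) (ν t))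
    (dirBound α lam B₀ B₁ C₀ C₂ CΨ) (dirLip α lam B₀ B₂ C₀ C₂ CΨ)
    (dirLawLip α lam B₁ C₂ CΨ * (η * dirBound α lam B₀ B₁ C₀ C₂ CΨ)) where
  bound t := H.norm_velF_le _ _
  lipschitz t := H.norm_velF_sub_le _ _
  time s t x hs ht := by
    rw [mul_assoc]
    exact H.norm_velF_sub_law_le
      (mul_nonneg (mul_nonneg hη H.dirBound_pos.le) (abs_nonneg _))
      (fun w => H.abs_integral_μ_sub_le hη hS hs ht H.B₁_pos.le (H.neuron_φ.bound w)
        (H.neuron_φ.abs_sub_le w))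
      (fun z => H.abs_integral_ν_sub_le hη hS hs ht H.B₁_pos.le (H.neuron_ψ.bound z)
        (H.neuron_ψ.abs_sub_le z)) x

theorem regularVelocity_velG : RegularVelocity (fun t => velG P 𝓓 φ ψ α (μ t) (ν t))
    (dirBound α lam B₀ B₁ C₀ C₂ CΨ) (dirLip α lam B₀ B₂ C₀ C₂ CΨ)
    (dirLawLip α lam B₁ C₂ CΨ * (η * dirBound α lam B₀ B₁ C₀ C₂ CΨ)) where
  bound t := H.norm_velG_le _ _
  lipschitz t := H.norm_velG_sub_le _ _
  time s t x hs ht := by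
    rw [mul_assoc]
    exact H.norm_velG_sub_law_le
      (mul_nonneg (mul_nonneg hη H.dirBound_pos.le) (abs_nonneg _))
      (fun w => H.abs_integral_μ_sub_le hη hS hs ht H.B₁_pos.le (H.neuron_φ.bound w)
        (H.neuron_φ.abs_sub_le w))
      (fun z => H.abs_integral_ν_sub_le hη hS hs ht H.B₁_pos.le (H.neuron_ψ.bound z)
        (H.neuron_ψ.abs_sub_le z)) x

end RegularModel

end MeanFieldRegularity

/-! ### Test functions on pairs and product laws. -/

section Product

variable {D : ℕ}

/-- `h` is 1-Lipschitz for the Euclidean distance on pairs. -/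
def PairLipschitz (h : Param D × Param D → ℝ) : Prop :=
  ∀ p q, |h p - h q| ≤ √(‖p.1 - q.1‖ ^ 2 + ‖p.2 - q.2‖ ^ 2)

theorem PairLipschitz.toLp {h : Param D × Param D → ℝ} (hh : PairLipschitz h)
    (s t : WithLp 2 (Param D × Param D)) : |h s.ofLp - h t.ofLp| ≤ ‖s - t‖ := by
  rw [WithLp.prod_norm_eq_of_L2]
  exact hh s.ofLp t.ofLp

theorem PairLipschitz.continuous {h : Param D × Param D → ℝ} (hh : PairLipschitz h) :
    Continuous h := by
  have h1 : Continuous fun s : WithLp 2 (Param D × Param D) => h s.ofLp :=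
    continuous_of_abs_sub_le (A := 1) fun s t => by
      rw [one_mul, dist_eq_norm]; exact hh.toLp s t
  exact h1.comp (WithLp.prodContinuousLinearEquiv 2 ℝ (Param D) (Param D)).symm.continuous

theorem PairLipschitz.fst {h : Param D × Param D → ℝ} (hh : PairLipschitz h) (x x' y : Param D) :
    |h (x, y) - h (x', y)| ≤ ‖x - x'‖ := by
  simpa [Real.sqrt_sq] using hh (x, y) (x', y)

theorem PairLipschitz.snd {h : Param D × Param D → ℝ} (hh : PairLipschitz h) (x y y' : Param D) :
    |h (x, y) - h (x, y')| ≤ ‖y - y'‖ := by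
  simpa [Real.sqrt_sq] using hh (x, y) (x, y')

/-- Estimates for the two marginals give an estimate for the product measures. -/
theorem abs_integral_prod_sub_le {m₁ m₂ n₁ n₂ : Measure (Param D)} [IsProbabilityMeasure m₁]
    [IsProbabilityMeasure m₂] [IsProbabilityMeasure n₁] [IsProbabilityMeasure n₂]
    {X Y : Param D → Param D} (hX : Measurable X) (hY : Measurable Y) {a a' : ℝ}
    (hm : ∀ ζ : Param D → ℝ, (∀ x, |ζ x| ≤ 1) → (∀ x y, |ζ x - ζ y| ≤ 1 * ‖x - y‖) →
      |(∫ x, ζ x ∂m₁) - ∫ x, ζ (X x) ∂m₂| ≤ a)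
    (hn : ∀ ζ : Param D → ℝ, (∀ x, |ζ x| ≤ 1) → (∀ x y, |ζ x - ζ y| ≤ 1 * ‖x - y‖) →
      |(∫ x, ζ x ∂n₁) - ∫ x, ζ (Y x) ∂n₂| ≤ a')
    {h : Param D × Param D → ℝ} (hh : ∀ p, |h p| ≤ 1) (hlip : PairLipschitz h) :
    |(∫ p, h p ∂(m₁.prod n₁)) - ∫ p, h (X p.1, Y p.2) ∂(m₂.prod n₂)| ≤ a + a' := by
  have hc : Measurable h := hlip.continuous.measurable
  have hbd : ∀ {Z : Type} [MeasurableSpace Z] {f : Z → ℝ} {m : Measure Z} [IsFiniteMeasure m],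
      Measurable f → (∀ z, |f z| ≤ 1) → Integrable f m := fun hf hb =>
    Integrable.of_bound hf.aestronglyMeasurable 1 (Eventually.of_forall hb)
  -- Integration in the second variable against the law of `Y` leaves an admissible test function of
  -- the first, so one marginal is replaced at a time.
  set ζ : Param D → ℝ := fun x => ∫ y, h (x, Y y) ∂n₂ with hζ
  have hm1 : Measurable fun p : Param D × Param D => h (p.1, Y p.2) :=
    hc.comp (measurable_fst.prodMk (hY.comp measurable_snd))
  have hm2 : Measurable fun p : Param D × Param D => h (X p.1, Y p.2) :=
    hc.comp ((hX.comp measurable_fst).prodMk (hY.comp measurable_snd))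
  have hζ1 : ∀ x, |ζ x| ≤ 1 := fun x => abs_integral_le fun y => hh _
  have hζl : ∀ x x', |ζ x - ζ x'| ≤ 1 * ‖x - x'‖ := fun x x' => by
    rw [one_mul]
    exact abs_integral_sub_integral_le
      (hbd (hm1.comp (measurable_const.prodMk measurable_id)) fun y => hh _)
      (hbd (hm1.comp (measurable_const.prodMk measurable_id)) fun y => hh _)
      fun y => hlip.fst x x' (Y y)
  have e1 : ∫ p, h p ∂(m₁.prod n₁) = ∫ x, ∫ y, h (x, y) ∂n₁ ∂m₁ :=
    integral_prod _ (hbd hc hh)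
  have e2 : ∫ p, h (X p.1, Y p.2) ∂(m₂.prod n₂) = ∫ x, ζ (X x) ∂m₂ :=
    integral_prod _ (hbd hm2 fun p => hh _)
  have h1 : |(∫ x, ∫ y, h (x, y) ∂n₁ ∂m₁) - ∫ x, ζ x ∂m₁| ≤ a' :=
    abs_integral_sub_integral_le
      (hbd (StronglyMeasurable.integral_prod_right (f := fun x y => h (x, y))
        hc.stronglyMeasurable).measurable fun x =>
        abs_integral_le fun y => hh _)
      (hbd (StronglyMeasurable.integral_prod_right (f := fun x y => h (x, Y y))
        hm1.stronglyMeasurable).measurable hζ1)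
      fun x => hn (fun y => h (x, y)) (fun y => hh _) fun y y' => by
        rw [one_mul]; exact hlip.snd x y y'
  have h2 := hm ζ hζ1 hζl
  rw [e1, e2]
  have := abs_sub_le (∫ x, ∫ y, h (x, y) ∂n₁ ∂m₁) (∫ x, ζ x ∂m₁) (∫ x, ζ (X x) ∂m₂)
  linarith

theorem integral_empirical {N : ℕ} (s : Fin N → Param D × Param D) {F : Param D × Param D → ℝ}
    (hF : Continuous F) : ∫ p, F p ∂(empirical s) = (N : ℝ)⁻¹ * ∑ i, F (s i) := by
  rw [empirical, integral_smul_measure, integral_finsetSum_measure fun i _ =>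
    integrable_dirac' hF.stronglyMeasurable (by simp)]
  simp only [integral_dirac' _ _ hF.stronglyMeasurable, smul_eq_mul]
  simp

end Product

/-! ### SGDA as a particle system, and its reference trajectories. -/

section Particles

variable {𝓧 𝓩 𝓦 : Type*} [MeasurableSpace 𝓧] [MeasurableSpace 𝓩] [MeasurableSpace 𝓦] {D : ℕ}

/-- The uniform measure on the indices of the neurons. -/
noncomputable def uniformIndex (N : ℕ) : Measure (Fin N) := (N : ℝ≥0∞)⁻¹ • Measure.count

theorem isProbabilityMeasure_uniformIndex {N : ℕ} (hN : 0 < N) :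
    IsProbabilityMeasure (uniformIndex N) := ⟨by
  rw [uniformIndex, Measure.smul_apply, Measure.count_univ]
  simp [ENNReal.inv_mul_cancel, hN.ne']⟩

theorem integral_uniformIndex {N : ℕ} {G : Type*} [NormedAddCommGroup G] [NormedSpace ℝ G]
    [CompleteSpace G] (f : Fin N → G) : ∫ i, f i ∂(uniformIndex N) = (N : ℝ)⁻¹ • ∑ i, f i := by
  rw [uniformIndex, integral_smul_measure, integral_count]
  simp

/-- A network of finite width is an infinitely wide one for the empirical law. The averaging
identities, proved for arbitrary probability spaces, thereby cover both the algorithm and its limit.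
-/
theorem RegularNeuron.wideNet_map_uniformIndex {S : Type*} [MeasurableSpace S] {B₀ B₁ B₂ : ℝ}
    {φ : S → Param D → ℝ} (hφ : RegularNeuron B₀ B₁ B₂ φ) (α : ℝ) {N : ℕ}
    (θ : Fin N → Param D) : wideNet α φ ((uniformIndex N).map θ) = finNet α φ θ := by
  ext s
  rw [← hφ.integral_neuronNet _ (measurable_of_finite θ), integral_uniformIndex, finNet,
    smul_eq_mul]
  simp only [neuronNet]
  rw [← Finset.mul_sum]
  ring

namespace RegularModel

variable {P : MomentProblem 𝓧 𝓩 𝓦} {φ : 𝓦 → Param D → ℝ} {ψ : 𝓩 → Param D → ℝ}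
  {α lam B₀ B₁ B₂ C₀ C₂ CΨ : ℝ} (H : RegularModel P φ ψ α lam B₀ B₁ B₂ C₀ C₂ CΨ)
include H

/-- Stochastic gradient descent-ascent is an interacting particle system with pair interaction. -/
theorem chain_eq_sgda {N : ℕ} (hN : 0 < N) (η ε : ℝ) (s : Fin N → Param D × Param D)
    (u : ℕ → 𝓧 × 𝓩) (k : ℕ) (i : Fin N) :
    chain (interactStep (η * ε) (pairInteraction P φ ψ α lam))
      (fun i => WithLp.toLp 2 (s i)) u k i = WithLp.toLp 2 (sgda P φ ψ α lam η ε s u k i) := by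
  have := isProbabilityMeasure_uniformIndex hN
  induction k generalizing i with
  | zero => rfl
  | succ k ih =>
    set σ := sgda P φ ψ α lam η ε s u k with hσ
    have hc : chain (interactStep (η * ε) (pairInteraction P φ ψ α lam))
      (fun i => WithLp.toLp 2 (s i)) u k = fun i => WithLp.toLp 2 (σ i) := funext ih
    have h1 := H.integral_pairInteraction (uniformIndex N) (X := fun j => (σ j).1)
      (Y := fun j => (σ j).2) (measurable_of_finite _) (measurable_of_finite _) (u k)
      (WithLp.toLp 2 (σ i))
    rw [integral_uniformIndex, H.neuron_φ.wideNet_map_uniformIndex,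
      H.neuron_ψ.wideNet_map_uniformIndex] at h1
    rw [chain, hc, interactStep]
    change WithLp.toLp 2 (σ i) + (η * ε) • ((N : ℝ)⁻¹ • ∑ j, pairInteraction P φ ψ α lam (u k)
      (WithLp.toLp 2 (σ i)) (WithLp.toLp 2 ((σ j).1, (σ j).2))) = _
    rw [h1]
    rfl

variable {μ ν : ℝ → ProbabilityMeasure (Param D)} {𝓓 : Measure (𝓧 × 𝓩)} [IsProbabilityMeasure 𝓓]

theorem integral_meanInteraction {Q : Type*} [MeasurableSpace Q] (π : Measure Q)
    [IsProbabilityMeasure π] {X Y : Q → Param D} (hX : Measurable X) (hY : Measurable Y)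
    (s : WithLp 2 (Param D × Param D)) :
    ∫ q, meanInteraction 𝓓 (pairInteraction P φ ψ α lam) s (WithLp.toLp 2 (X q, Y q)) ∂π =
      WithLp.toLp 2 (velF P 𝓓 φ ψ α lam (π.map X) (π.map Y) s.fst,
        velG P 𝓓 φ ψ α (π.map X) (π.map Y) s.snd) := by
  have hpX := Measure.isProbabilityMeasure_map hX.aemeasurable (μ := π)
  have hpY := Measure.isProbabilityMeasure_map hY.aemeasurable (μ := π)
  have hb := H.lipschitzInteraction
  have hm : Measurable fun p : Q × (𝓧 × 𝓩) =>
      pairInteraction P φ ψ α lam p.2 s (WithLp.toLp 2 (X p.1, Y p.1)) := by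
    have h1 : Measurable fun p : Q × (𝓧 × 𝓩) =>
        ((s, (WithLp.toLp 2 (X p.1, Y p.1) : WithLp 2 (Param D × Param D))), p.2) :=
      (measurable_const.prodMk ((WithLp.measurable_toLp _ _).comp
        ((hX.prodMk hY).comp measurable_fst))).prodMk measurable_snd
    have h2 := hb.measurable_joint.comp h1
    exact h2
  calc ∫ q, meanInteraction 𝓓 (pairInteraction P φ ψ α lam) s (WithLp.toLp 2 (X q, Y q)) ∂π
      = ∫ u, ∫ q, pairInteraction P φ ψ α lam u s (WithLp.toLp 2 (X q, Y q)) ∂π ∂𝓓 :=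
        integral_integral_swap (Integrable.of_bound hm.aestronglyMeasurable _
          (Eventually.of_forall fun p => hb.bound _ _ _))
    _ = _ := by
        simp only [H.integral_pairInteraction π hX hY]
        exact integral_toLp_pair (H.integrable_dirF _ _ _) (H.integrable_dirG _ _ _)

variable {η : ℝ} (hη : 0 < η) (hS : IsMeanFieldSolution P 𝓓 φ ψ α lam η μ ν)
include hη hS

theorem abs_integral_prod_time_sub_le {s t : ℝ} (hs : 0 ≤ s) (ht : 0 ≤ t)
    {h : Param D × Param D → ℝ} (hh : ∀ p, |h p| ≤ 1) (hlip : PairLipschitz h) :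
    |(∫ p, h p ∂((μ t : Measure (Param D)).prod (ν t))) -
      ∫ p, h p ∂((μ s : Measure (Param D)).prod (ν s))| ≤
      2 * (η * dirBound α lam B₀ B₁ C₀ C₂ CΨ * |t - s|) := by
  have := abs_integral_prod_sub_le (X := id) (Y := id) measurable_id measurable_id
    (m₁ := μ t) (m₂ := μ s) (n₁ := ν t) (n₂ := ν s)
    (fun ζ hb hl => H.abs_integral_μ_sub_le hη.le hS hs ht zero_le_one hb hl)
    (fun ζ hb hl => H.abs_integral_ν_sub_le hη.le hS hs ht zero_le_one hb hl) hh hlip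
  simp only [id] at this
  linarith

/-- The rate at which the mean-field flow is consistent with its time discretization. -/
theorem exists_reference_maps {ε : ℝ} (hε : 0 < ε) (n : ℕ) :
    ∃ S : ℕ → Param D × Param D → WithLp 2 (Param D × Param D),
      (∀ k, Measurable (S k)) ∧ (∀ q, S 0 q = WithLp.toLp 2 q) ∧
      (∀ k q, ‖S (k + 1) q - S k q‖ ≤ ε * (η * (2 * dirBound α lam B₀ B₁ C₀ C₂ CΨ))) ∧
      (∀ k < n, ∀ q, ‖S (k + 1) q - S k q - (η * ε) •
          ∫ q', meanInteraction 𝓓 (pairInteraction P φ ψ α lam) (S k q) (S k q')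
            ∂((stdGaussian (Param D)).prod (stdGaussian (Param D)))‖ ≤ η * ε * (ε * (2 *
        (dirLawLip α lam B₁ C₂ CΨ * (η * dirBound α lam B₀ B₁ C₀ C₂ CΨ) +
          dirLip α lam B₀ B₂ C₀ C₂ CΨ * (η * dirBound α lam B₀ B₁ C₀ C₂ CΨ) +
          dirLawLip α lam B₁ C₂ CΨ)))) ∧
      ∀ k ≤ n, ∀ h : Param D × Param D → ℝ, (∀ p, |h p| ≤ 1) → PairLipschitz h →
        |(∫ p, h p ∂((μ (k * ε) : Measure (Param D)).prod (ν (k * ε)))) -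
          ∫ q, h (S k q).ofLp ∂((stdGaussian (Param D)).prod (stdGaussian (Param D)))| ≤
          2 * ε := by
  -- The accuracy demanded of the flow is `ε` itself, so that replacing the solution by the
  -- pushed-forward Gaussian costs no more than the order of the time discretization.
  obtain ⟨X, hXc, hX0, hX1, hX2, hX3⟩ := (H.regularVelocity_velF hη.le hS).exists_flow hη.le
    H.dirLip_pos.le hS.pde_μ hε n hε
  obtain ⟨Y, hYc, hY0, hY1, hY2, hY3⟩ := (H.regularVelocity_velG hη.le hS).exists_flow hη.le
    H.dirLip_pos.le hS.pde_ν hε n hε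
  rw [hS.init_μ] at hX3
  rw [hS.init_ν] at hY3
  set γ := stdGaussian (Param D) with hγ
  have hb := H.lipschitzInteraction
  refine ⟨fun k q => WithLp.toLp 2 (X k q.1, Y k q.2), fun k => ?_, fun q => ?_, fun k q => ?_,
    fun k hk q => ?_, fun k hk h hh hlip => ?_⟩
  · exact (WithLp.measurable_toLp _ _).comp (((hXc k).measurable.comp measurable_fst).prodMk
      ((hYc k).measurable.comp measurable_snd))
  · change WithLp.toLp 2 (X 0 q.1, Y 0 q.2) = _
    rw [hX0, hY0]; rfl
  · refine (norm_toLp_pair_le (X (k + 1) q.1 - X k q.1) (Y (k + 1) q.2 - Y k q.2)).trans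
      ((add_le_add (hX1 k q.1) (hY1 k q.2)).trans_eq (by ring))
  · have hmX : (γ.prod γ).map (fun q => X k q.1) = γ.map (X k) := by
      rw [← Function.comp_def, ← Measure.map_map (hXc k).measurable measurable_fst,
        Measure.map_fst_prod, measure_univ, one_smul]
    have hmY : (γ.prod γ).map (fun q => Y k q.2) = γ.map (Y k) := by
      rw [← Function.comp_def, ← Measure.map_map (hYc k).measurable measurable_snd,
        Measure.map_snd_prod, measure_univ, one_smul]
    have hpX := Measure.isProbabilityMeasure_map (hXc k).measurable.aemeasurable (μ := γ)
    have hpY := Measure.isProbabilityMeasure_map (hYc k).measurable.aemeasurable (μ := γ)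
    have hXm : Measurable fun q : Param D × Param D => X k q.1 :=
      (hXc k).measurable.comp measurable_fst
    have hYm : Measurable fun q : Param D × Param D => Y k q.2 :=
      (hYc k).measurable.comp measurable_snd
    have hmean := H.integral_meanInteraction (𝓓 := 𝓓) (γ.prod γ) hXm hYm
      (WithLp.toLp 2 (X k q.1, Y k q.2))
    rw [hmX, hmY] at hmean
    -- The reference step has to be consistent with the law of the reference points, not with the
    -- solution. Exchanging the two inside the velocity produces the last summand `dirLawLip` of the
    -- consistency constant.
    have hlawX : ∀ w, |(∫ θ, φ w θ ∂(μ (k * ε) : Measure (Param D))) -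
        ∫ θ, φ w θ ∂(γ.map (X k))| ≤ B₁ * ε := fun w => by
      rw [integral_map (hXc k).measurable.aemeasurable
        (H.neuron_φ.continuous_neuron w).aestronglyMeasurable]
      exact hX3 k hk.le _ _ _ H.B₁_pos.le (H.neuron_φ.bound w) (H.neuron_φ.abs_sub_le w)
    have hlawY : ∀ z, |(∫ θ, ψ z θ ∂(ν (k * ε) : Measure (Param D))) -
        ∫ θ, ψ z θ ∂(γ.map (Y k))| ≤ B₁ * ε := fun z => by
      rw [integral_map (hYc k).measurable.aemeasurable
        (H.neuron_ψ.continuous_neuron z).aestronglyMeasurable]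
      exact hY3 k hk.le _ _ _ H.B₁_pos.le (H.neuron_ψ.bound z) (H.neuron_ψ.abs_sub_le z)
    have hvF := H.norm_velF_sub_law_le (𝓓 := 𝓓) hε.le hlawX hlawY (X k q.1)
    have hvG := H.norm_velG_sub_law_le (𝓓 := 𝓓) hε.le hlawX hlawY (Y k q.2)
    have hηε : 0 < η * ε := mul_pos hη hε
    have key : ∀ {x x' v v' : Param D} {c d : ℝ}, ‖x' - x - (η * ε) • v‖ ≤ η * ε * c →
        ‖v - v'‖ ≤ d → ‖x' - x - (η * ε) • v'‖ ≤ η * ε * (c + d) := by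
      intro x x' v v' c d h1 h2
      have e : x' - x - (η * ε) • v' = (x' - x - (η * ε) • v) + (η * ε) • (v - v') := by module
      rw [e, mul_add]
      refine (norm_add_le _ _).trans (add_le_add h1 ?_)
      rw [norm_smul, Real.norm_of_nonneg hηε.le]
      exact mul_le_mul_of_nonneg_left h2 hηε.le
    rw [hmean]
    refine (norm_toLp_pair_le (X (k + 1) q.1 - X k q.1 - (η * ε) • velF P 𝓓 φ ψ α lam
      (γ.map (X k)) (γ.map (Y k)) (X k q.1)) (Y (k + 1) q.2 - Y k q.2 - (η * ε) •
        velG P 𝓓 φ ψ α (γ.map (X k)) (γ.map (Y k)) (Y k q.2))).trans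
      ((add_le_add (key (hX2 k q.1) hvF) (key (hY2 k q.2) hvG)).trans_eq (by ring))
  · have := abs_integral_prod_sub_le (hXc k).measurable (hYc k).measurable
      (m₁ := μ (k * ε)) (m₂ := γ) (n₁ := ν (k * ε)) (n₂ := γ)
      (fun ζ hb hl => hX3 k hk ζ 1 1 zero_le_one hb hl)
      (fun ζ hb hl => hY3 k hk ζ 1 1 zero_le_one hb hl) hh hlip
    exact this.trans_eq (by ring)

end RegularModel

end Particles

/-! ### The explicit error: exponential bound and convergence to zero. -/

section ErrorBound

/-- The error of the particle approximation, in probability at least `1 - 3 δ`. -/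
noncomputable def particleError (η K L κ : ℝ) (N : ℕ) (ε T δ : ℝ) : ℝ :=
  4 * 1 * √(2 * (3 + 2 * T) * (Real.log (N / δ) / N)) + 4 * 1 * (η * K) / √N +
      (2 * η * K * √(2 * T * (ε * Real.log (2 / δ))) +
        η * T * (4 * K * √(2 * (3 + 2 * T) * (Real.log (N / δ) / N)) + 4 * L * (η * K) / √N +
          ε * κ)) * Real.exp (2 * L * η * T) + 2 * ε

theorem one_le_log_div {N : ℕ} (hN : 0 < N) {δ : ℝ} (hδ : 0 < δ) (hδ' : δ ≤ 1 / 5) :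
    1 ≤ Real.log (N / δ) := by
  have hN1 : (1 : ℝ) ≤ N := by exact_mod_cast hN
  rw [Real.le_log_iff_exp_le (by positivity), le_div_iff₀ hδ]
  have := Real.exp_one_lt_d9
  have h2 : Real.exp 1 * δ ≤ 3 * (1 / 5) := by gcongr; linarith
  linarith

/-- The error is at most exponential in the time horizon. -/
theorem particleError_le {η K L κ : ℝ} (hη : 0 ≤ η) (hK : 0 ≤ K) (hL : 0 ≤ L) (hκ : 0 ≤ κ)
    {N D : ℕ} (hN : 0 < N) {ε T δ : ℝ} (hε : 0 < ε) (hεT : ε ≤ T) (hδ : 0 < δ) (hδ' : δ ≤ 1 / 5) :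
    particleError η K L κ N ε T δ ≤
      (14 + 8 * (η * K) + η * (12 * K + 4 * L * (η * K) + κ)) * Real.exp ((2 + 2 * L * η) * T) *
        (√(Real.log (N / δ) / N) + √(ε * (D + Real.log (N / δ)))) := by
  have hT : 0 < T := hε.trans_le hεT
  have hN1 : (1 : ℝ) ≤ N := by exact_mod_cast hN
  have hN0 : (0 : ℝ) < N := by linarith
  have hΛ := one_le_log_div hN hδ hδ'
  -- Because `δ ≤ 1 / 2` and `N ≥ 1`, one has `2 / δ ≤ (N / δ) ^ 2`.
  have hlog2 : Real.log (2 / δ) ≤ 2 * Real.log (N / δ) := by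
    have e : 2 * Real.log (N / δ) = Real.log ((N / δ) ^ 2) := by rw [Real.log_pow]; norm_num
    rw [e]
    refine Real.log_le_log (by positivity) ?_
    rw [div_pow, div_le_div_iff₀ hδ (by positivity)]
    have h1 : 2 * δ ^ 2 ≤ 1 * δ := by nlinarith
    have h2 : 1 * δ ≤ (N : ℝ) ^ 2 * δ := by
      gcongr
      nlinarith
    linarith
  set Λ := Real.log (N / δ) with hΛd
  set x := √(Λ / N) with hx
  set y := √(ε * (D + Λ)) with hy
  have hx0 : 0 ≤ x := Real.sqrt_nonneg _
  have hy0 : 0 ≤ y := Real.sqrt_nonneg _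
  have hD0 : (0 : ℝ) ≤ D := Nat.cast_nonneg _
  have hsqrtT : √T ≤ 1 + T := by
    rw [Real.sqrt_le_left (by positivity)]; nlinarith
  have h1 : √(2 * (3 + 2 * T) * (Λ / N)) ≤ (3 + 2 * T) * x := by
    rw [Real.sqrt_mul (by positivity)]
    gcongr
    rw [Real.sqrt_le_left (by positivity)]
    nlinarith
  have h2 : 1 / √N ≤ x := by
    rw [hx, Real.sqrt_div (by linarith)]
    gcongr
    exact Real.one_le_sqrt.mpr hΛ
  have h3 : √ε ≤ y := by
    refine Real.sqrt_le_sqrt ?_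
    nlinarith
  -- Here `ε ≤ T` is essential: it turns an error linear in `ε` into one of order `√ε`.
  have h4 : ε ≤ (1 + T) * y := by
    calc ε = √ε * √ε := (Real.mul_self_sqrt hε.le).symm
      _ ≤ √T * y := by gcongr
      _ ≤ _ := by gcongr
  have h5 : √(2 * T * (ε * Real.log (2 / δ))) ≤ 2 * (1 + T) * y := by
    calc √(2 * T * (ε * Real.log (2 / δ))) ≤ √((4 * T) * (ε * (D + Λ))) := by
          refine Real.sqrt_le_sqrt ?_
          have : ε * Real.log (2 / δ) ≤ ε * (2 * (D + Λ)) := by gcongr; linarith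
          have := mul_le_mul_of_nonneg_left this hT.le
          linarith
      _ = √(4 * T) * y := by rw [Real.sqrt_mul (by positivity)]
      _ ≤ _ := by
          gcongr
          rw [show (4 : ℝ) * T = 2 ^ 2 * T by norm_num, Real.sqrt_mul (by positivity),
            Real.sqrt_sq (by norm_num)]
          gcongr
  have hE1 : 1 + T ≤ Real.exp T := by rw [add_comm]; exact Real.add_one_le_exp T
  have hE0 : 1 ≤ Real.exp T := by linarith
  set E := Real.exp T with hE
  have hE3 : 3 + 2 * T ≤ 3 * E := by linarith
  have hET : T ≤ E := by linarith
  set G := Real.exp (2 * L * η * T) with hG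
  have hG1 : 1 ≤ G := Real.one_le_exp (by positivity)
  have hG0 : 0 ≤ G := by linarith
  -- Each term carries at most two factors that grow linearly in `T`; each factor is absorbed into
  -- one `exp T`, beside the Grönwall exponential.
  have hEG : Real.exp ((2 + 2 * L * η) * T) = E * E * G := by
    rw [hE, hG, ← Real.exp_add, ← Real.exp_add]; ring_nf
  have hE00 : 0 ≤ E := by linarith
  have hEE : E ≤ E * E * G := by
    calc E = E * 1 * 1 := by ring
      _ ≤ _ := by gcongr
  have h1EE : 1 ≤ E * E * G := hE0.trans hEE
  have hEEG : E * G ≤ E * E * G := by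
    gcongr
    exact le_mul_of_one_le_left hE00 hE0
  have hηK : 0 ≤ η * K := by positivity
  rw [hEG]
  set M := E * E * G with hM
  have hM0 : 0 ≤ M := by linarith
  have g1 : 4 * 1 * √(2 * (3 + 2 * T) * (Λ / N)) ≤ 12 * M * x := by
    have : (3 + 2 * T) * x ≤ 3 * M * x := by gcongr; linarith
    linarith
  have g2 : 4 * 1 * (η * K) / √N ≤ 4 * (η * K) * M * x := by
    rw [div_eq_mul_one_div]
    have : 4 * 1 * (η * K) * (1 / √N) ≤ 4 * (η * K) * x := by
      rw [mul_one]; gcongr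
    exact this.trans
      (mul_le_mul_of_nonneg_right (le_mul_of_one_le_right (by positivity) h1EE) hx0)
  have g3 : 2 * η * K * √(2 * T * (ε * Real.log (2 / δ))) * G ≤ 4 * (η * K) * M * y := by
    calc 2 * η * K * √(2 * T * (ε * Real.log (2 / δ))) * G
        ≤ 2 * η * K * (2 * E * y) * G := by
          gcongr
          exact h5.trans (by gcongr)
      _ = 4 * (η * K) * (E * G) * y := by ring
      _ ≤ _ := by gcongr
  have g4 : η * T * (4 * K * √(2 * (3 + 2 * T) * (Λ / N))) * G ≤ η * (12 * K) * M * x := by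
    calc η * T * (4 * K * √(2 * (3 + 2 * T) * (Λ / N))) * G
        ≤ η * E * (4 * K * (3 * E * x)) * G := by
          gcongr
          exact h1.trans (by gcongr)
      _ = _ := by rw [hM]; ring
  have g5 : η * T * (4 * L * (η * K) / √N) * G ≤ η * (4 * L * (η * K)) * M * x := by
    calc η * T * (4 * L * (η * K) / √N) * G
        ≤ η * E * (4 * L * (η * K) * x) * G := by
          rw [div_eq_mul_one_div (4 * L * (η * K))]
          gcongr
      _ = η * (4 * L * (η * K)) * (E * G) * x := by ring
      _ ≤ _ := by gcongr
  have g6 : η * T * (ε * κ) * G ≤ η * κ * M * y := by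
    calc η * T * (ε * κ) * G ≤ η * E * (E * y * κ) * G := by
          gcongr
          exact h4.trans (by gcongr)
      _ = _ := by rw [hM]; ring
  have g7 : 2 * ε ≤ 2 * M * y := by
    have : (1 + T) * y ≤ M * y := by gcongr; linarith
    linarith
  have p1 : 0 ≤ M * x := by positivity
  have p2 : 0 ≤ M * y := by positivity
  have e : particleError η K L κ N ε T δ = 4 * 1 * √(2 * (3 + 2 * T) * (Λ / N)) +
      4 * 1 * (η * K) / √N + 2 * η * K * √(2 * T * (ε * Real.log (2 / δ))) * G +
      η * T * (4 * K * √(2 * (3 + 2 * T) * (Λ / N))) * G +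
      η * T * (4 * L * (η * K) / √N) * G + η * T * (ε * κ) * G + 2 * ε := by
    rw [particleError]; ring
  rw [e]
  refine (add_le_add (add_le_add (add_le_add (add_le_add (add_le_add (add_le_add g1 g2) g3) g4)
    g5) g6) g7).trans ?_
  have q1 : 0 ≤ (2 + 4 * (η * K) + η * κ) * (M * x) := by positivity
  have q2 : 0 ≤ (12 + 4 * (η * K) + η * (12 * K + 4 * L * (η * K))) * (M * y) := by positivity
  linarith

/-- For fixed `T` and `δ` the error is a continuous function of `log (N / δ) / N`, `1 / √N` and `ε`
that vanishes at the origin. -/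
theorem tendsto_particleError (η K L κ T : ℝ) {δ : ℝ} (hδ : 0 < δ) :
    Tendsto (fun q : ℝ × ℕ => particleError η K L κ q.2 q.1 T δ) (𝓝[>] (0 : ℝ) ×ˢ atTop)
      (𝓝 0) := by
  set G : ℝ × ℝ × ℝ → ℝ := fun p =>
    4 * 1 * √(2 * (3 + 2 * T) * p.1) + 4 * 1 * (η * K) * p.2.1 +
      (2 * η * K * √(2 * T * (p.2.2 * Real.log (2 / δ))) +
        η * T * (4 * K * √(2 * (3 + 2 * T) * p.1) + 4 * L * (η * K) * p.2.1 +
          p.2.2 * κ)) * Real.exp (2 * L * η * T) + 2 * p.2.2 with hG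
  have hGc : Continuous G := by fun_prop
  have h1 : Tendsto (fun q : ℝ × ℕ => Real.log (q.2 / δ) / q.2) (𝓝[>] (0 : ℝ) ×ˢ atTop)
      (𝓝 0) := by
    have h2 : Tendsto (fun n : ℕ => (n : ℝ) / δ) atTop atTop :=
      tendsto_natCast_atTop_atTop.atTop_div_const hδ
    have h3 := (Real.isLittleO_log_id_atTop.tendsto_div_nhds_zero.comp h2).mul_const (1 / δ)
    rw [zero_mul] at h3
    have h4 : Tendsto (fun n : ℕ => Real.log (n / δ) / n) atTop (𝓝 0) := by
      refine h3.congr fun n => ?_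
      simp only [Function.comp_apply, id]
      field_simp
    exact h4.comp tendsto_snd
  have h2 : Tendsto (fun q : ℝ × ℕ => (√(q.2 : ℝ))⁻¹) (𝓝[>] (0 : ℝ) ×ˢ atTop) (𝓝 0) :=
    (tendsto_inv_atTop_zero.comp
      (Real.tendsto_sqrt_atTop.comp tendsto_natCast_atTop_atTop)).comp tendsto_snd
  have h3 : Tendsto (fun q : ℝ × ℕ => q.1) (𝓝[>] (0 : ℝ) ×ˢ atTop) (𝓝 0) :=
    (tendsto_nhdsWithin_of_tendsto_nhds tendsto_id).comp tendsto_fst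
  have h4 := (hGc.tendsto (0, 0, 0)).comp (h1.prodMk_nhds (h2.prodMk_nhds h3))
  have h5 : G (0, 0, 0) = 0 := by simp [hG]
  rw [h5] at h4
  exact h4

end ErrorBound

/-! ### Lipschitz minorants of bounded continuous functions. -/

section LowerEnvelope

variable {X : Type*} [PseudoMetricSpace X]

/-- The largest `n`-Lipschitz function below `F`. -/
noncomputable def lowerEnvelope (F : BoundedContinuousFunction X ℝ) (n : ℕ) (p : X) : ℝ :=
  ⨅ q, (F q + n * dist p q)

variable (F : BoundedContinuousFunction X ℝ) (n : ℕ)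

theorem neg_norm_le_add_mul_dist (p q : X) : -‖F‖ ≤ F q + n * dist p q := by
  have h1 := (abs_le.mp (F.norm_coe_le_norm q)).1
  have h2 : 0 ≤ (n : ℝ) * dist p q := by positivity
  linarith

theorem lowerEnvelope_le_add (p q : X) : lowerEnvelope F n p ≤ F q + n * dist p q :=
  ciInf_le ⟨-‖F‖, by rintro _ ⟨q, rfl⟩; exact neg_norm_le_add_mul_dist F n p q⟩ q

theorem lowerEnvelope_le (p : X) : lowerEnvelope F n p ≤ F p := by
  simpa using lowerEnvelope_le_add F n p p

variable [Nonempty X]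

theorem abs_lowerEnvelope_le (p : X) : |lowerEnvelope F n p| ≤ ‖F‖ :=
  abs_le.mpr ⟨le_ciInf fun q => neg_norm_le_add_mul_dist F n p q,
    (lowerEnvelope_le F n p).trans (abs_le.mp (F.norm_coe_le_norm p)).2⟩

theorem abs_lowerEnvelope_sub_le (p p' : X) :
    |lowerEnvelope F n p - lowerEnvelope F n p'| ≤ n * dist p p' := by
  have key : ∀ p p' : X, lowerEnvelope F n p - n * dist p p' ≤ lowerEnvelope F n p' := fun p p' =>
    le_ciInf fun q => by
      have h1 := lowerEnvelope_le_add F n p q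
      have h2 := mul_le_mul_of_nonneg_left (dist_triangle p p' q) (Nat.cast_nonneg (α := ℝ) n)
      linarith
  have h1 := key p p'
  have h2 := key p' p
  rw [dist_comm] at h2
  rw [abs_le]
  constructor <;> linarith

/-- Points near `p` contribute values close to `F p` by continuity, and at distance at least `d` the
penalty `n * d` exceeds the oscillation `2 * ‖F‖` once `n` is large. -/
theorem tendsto_lowerEnvelope (p : X) :
    Tendsto (fun n => lowerEnvelope F n p) atTop (𝓝 (F p)) := by
  refine Metric.tendsto_atTop.mpr fun e he => ?_
  obtain ⟨d, hd, hF⟩ := Metric.continuousAt_iff.mp F.continuous.continuousAt (e / 2) (half_pos he)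
  obtain ⟨n₀, hn₀⟩ := exists_nat_ge (2 * ‖F‖ / d)
  refine ⟨n₀, fun n hn => ?_⟩
  have h1 : F p - e / 2 ≤ lowerEnvelope F n p := le_ciInf fun q => by
    by_cases hq : dist q p < d
    · have h2 := hF hq
      rw [Real.dist_eq] at h2
      have h3 : 0 ≤ (n : ℝ) * dist p q := by positivity
      linarith [(abs_lt.mp h2).1]
    · push Not at hq
      rw [div_le_iff₀ hd] at hn₀
      have h2 : (n₀ : ℝ) * d ≤ n * dist p q := by
        rw [dist_comm p q]
        gcongr
      have h3 := (abs_le.mp (F.norm_coe_le_norm q)).1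
      have h4 := (abs_le.mp (F.norm_coe_le_norm p)).2
      linarith
  have h2 := lowerEnvelope_le F n p
  rw [Real.dist_eq, abs_lt]
  constructor <;> linarith

theorem continuous_lowerEnvelope : Continuous (lowerEnvelope F n) :=
  continuous_of_abs_sub_le (abs_lowerEnvelope_sub_le F n)

theorem tendsto_integral_lowerEnvelope [MeasurableSpace X] [OpensMeasurableSpace X]
    (m : Measure X) [IsFiniteMeasure m] :
    Tendsto (fun n => ∫ p, lowerEnvelope F n p ∂m) atTop (𝓝 (∫ p, F p ∂m)) :=
  tendsto_integral_of_dominated_convergence (fun _ => ‖F‖)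
    (fun n => (continuous_lowerEnvelope F n).measurable.aestronglyMeasurable) (integrable_const _)
    (fun n => Eventually.of_forall (abs_lowerEnvelope_le F n))
    (Eventually.of_forall (tendsto_lowerEnvelope F))

end LowerEnvelope

/-! ### Assembly of the quantitative estimate and weak convergence in probability. -/

section Convergence

variable {𝓧 𝓩 𝓦 : Type*} [MeasurableSpace 𝓧] [MeasurableSpace 𝓩] [MeasurableSpace 𝓦] {D : ℕ}

instance isProbabilityMeasure_sampleLaw (N D : ℕ) (𝓓 : Measure (𝓧 × 𝓩))
    [IsProbabilityMeasure 𝓓] : IsProbabilityMeasure (sampleLaw N D 𝓓) := by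
  unfold sampleLaw
  infer_instance

/-- The constant in the consistency error of the time discretization. -/
noncomputable def consistencyConst (η α lam B₀ B₁ B₂ C₀ C₂ CΨ : ℝ) : ℝ :=
  2 * (dirLawLip α lam B₁ C₂ CΨ * (η * dirBound α lam B₀ B₁ C₀ C₂ CΨ) +
    dirLip α lam B₀ B₂ C₀ C₂ CΨ * (η * dirBound α lam B₀ B₁ C₀ C₂ CΨ) +
    dirLawLip α lam B₁ C₂ CΨ)

/-- `particleError` for stochastic gradient descent-ascent. -/
noncomputable def sgdaError (η α lam B₀ B₁ B₂ C₀ C₂ CΨ : ℝ) : ℕ → ℝ → ℝ → ℝ → ℝ :=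
  particleError η (2 * dirBound α lam B₀ B₁ C₀ C₂ CΨ)
    (dirLip α lam B₀ B₂ C₀ C₂ CΨ + dirLawLip α lam B₁ C₂ CΨ)
    (consistencyConst η α lam B₀ B₁ B₂ C₀ C₂ CΨ)

namespace RegularModel

variable {P : MomentProblem 𝓧 𝓩 𝓦} {φ : 𝓦 → Param D → ℝ} {ψ : 𝓩 → Param D → ℝ}
  {α lam B₀ B₁ B₂ C₀ C₂ CΨ : ℝ} (H : RegularModel P φ ψ α lam B₀ B₁ B₂ C₀ C₂ CΨ)
  {μ ν : ℝ → ProbabilityMeasure (Param D)} {𝓓 : Measure (𝓧 × 𝓩)} [IsProbabilityMeasure 𝓓]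
  {η : ℝ} (hη : 0 < η) (hS : IsMeanFieldSolution P 𝓓 φ ψ α lam η μ ν)
include H hη

theorem consistencyConst_nonneg : 0 ≤ consistencyConst η α lam B₀ B₁ B₂ C₀ C₂ CΨ := by
  have h1 := H.dirBound_pos
  have h2 := H.dirLip_pos
  have h3 := H.dirLawLip_pos
  unfold consistencyConst
  positivity

include hS

theorem sampleLaw_exists_lt_le {N : ℕ} (hN : 0 < N) {ε T δ : ℝ} (hε : 0 < ε) (hT : 0 < T)
    (hδ : 0 < δ) (hδ' : δ ≤ 1 / 5) {h : Param D × Param D → ℝ} (hh : ∀ p, |h p| ≤ 1)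
    (hlip : PairLipschitz h) :
    sampleLaw N D 𝓓 {s | ∃ k : ℕ, (k : ℝ) ≤ T / ε ∧
      sgdaError η α lam B₀ B₁ B₂ C₀ C₂ CΨ N ε T δ <
        |(∫ p, h p ∂((μ (k * ε) : Measure (Param D)).prod (ν (k * ε)))) -
          ∫ p, h p ∂(empirical (sgda P φ ψ α lam η ε s.1 s.2 k))|} ≤ ENNReal.ofReal (3 * δ) := by
  have hK := H.dirBound_pos
  set n := ⌊T / ε⌋₊ with hn
  have hnT : n * ε ≤ T := by
    rw [← le_div_iff₀ hε]
    exact Nat.floor_le (by positivity)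
  obtain ⟨S, hSm, hS0, hS1, hS2, hS3⟩ := H.exists_reference_maps hη hS hε n
  -- The bound is doubled to match the speed of the reference pairs, whose two components are each
  -- estimated by `dirBound`.
  have hb : LipschitzInteraction (pairInteraction P φ ψ α lam)
      (2 * dirBound α lam B₀ B₁ C₀ C₂ CΨ)
      (dirLip α lam B₀ B₂ C₀ C₂ CΨ + dirLawLip α lam B₁ C₂ CΨ) :=
    { H.lipschitzInteraction with
      bound := fun u s s' => (H.lipschitzInteraction.bound u s s').trans (by linarith) }
  have key := hb.measure_exists_lt_abs_sub_le (𝓓 := 𝓓)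
    (γ := (stdGaussian (Param D)).prod (stdGaussian (Param D))) hN (η := η) (ε := ε) (T := T)
    (δ := δ) (κ := ε * consistencyConst η α lam B₀ B₁ B₂ C₀ C₂ CΨ) (by positivity)
    (add_pos H.dirLip_pos H.dirLawLip_pos).le hη hε hT hδ (by linarith)
    (one_le_log_div hN hδ hδ') (mul_nonneg hε.le (H.consistencyConst_nonneg hη)) hnT hSm
    (fun k _ q => hS1 k q) hS2 (h := fun s => h s.ofLp) (fun s => hh _) hlip.toLp
  refine (measure_mono ?_).trans key
  rintro s ⟨k, hk, hlt⟩
  have hkn : k ≤ n := Nat.le_floor hk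
  refine ⟨k, hkn, ?_⟩
  have h1 := hS3 k hkn h hh hlip
  have h2 : (fun i => S 0 (s.1 i)) = fun i => WithLp.toLp 2 (s.1 i) := funext fun i => hS0 _
  rw [h2]
  simp only [H.chain_eq_sgda hN]
  rw [integral_empirical _ hlip.continuous] at hlt
  have h3 := abs_sub_le (∫ p, h p ∂((μ (k * ε) : Measure (Param D)).prod (ν (k * ε))))
    (∫ q, h (S k q).ofLp ∂((stdGaussian (Param D)).prod (stdGaussian (Param D))))
    ((N : ℝ)⁻¹ * ∑ i, h (sgda P φ ψ α lam η ε s.1 s.2 k i))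
  rw [sgdaError, particleError] at hlt
  linarith

theorem tendsto_sampleLaw_of_pairLipschitz {h : Param D × Param D → ℝ} (hh : ∀ p, |h p| ≤ 1)
    (hlip : PairLipschitz h) {t r : ℝ} (ht : 0 ≤ t) (hr : 0 < r) :
    Tendsto (fun q : ℝ × ℕ => sampleLaw q.2 D 𝓓
        {s | r ≤ |(∫ p, h p ∂(empirical (sgda P φ ψ α lam η q.1 s.1 s.2 ⌊t / q.1⌋₊))) -
          ∫ p, h p ∂((μ t : Measure (Param D)).prod (ν t))|})
      (𝓝[>] (0 : ℝ) ×ˢ atTop) (𝓝 0) := by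
  refine ENNReal.tendsto_nhds_zero.mpr fun e he => ?_
  -- The target probability may be `∞`; truncation at `1` makes it a real number before `δ` is
  -- chosen with `3 * δ` below it.
  set e' := (min e 1).toReal with he'
  have hfin : min e 1 ≠ ∞ := ((min_le_right _ _).trans_lt ENNReal.one_lt_top).ne
  have he'0 : 0 < e' := ENNReal.toReal_pos (lt_min he one_pos).ne' hfin
  set δ := min (1 / 5) (e' / 3) with hδd
  have hδ : 0 < δ := lt_min (by norm_num) (by positivity)
  have hδ' : δ ≤ 1 / 5 := min_le_left _ _
  have hδe : ENNReal.ofReal (3 * δ) ≤ e := by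
    calc ENNReal.ofReal (3 * δ) ≤ ENNReal.ofReal e' :=
          ENNReal.ofReal_le_ofReal (by linarith [min_le_right (1 / 5) (e' / 3)])
      _ = min e 1 := ENNReal.ofReal_toReal hfin
      _ ≤ e := min_le_left _ _
  have hK := H.dirBound_pos
  -- The horizon is `t + 1`, so that it is positive even for `t = 0`. The second summand is the
  -- motion of the limit law between the last step time and `t`.
  have h1 : Tendsto (fun q : ℝ × ℕ => sgdaError η α lam B₀ B₁ B₂ C₀ C₂ CΨ q.2 q.1 (t + 1) δ +
      2 * (η * dirBound α lam B₀ B₁ C₀ C₂ CΨ * q.1)) (𝓝[>] (0 : ℝ) ×ˢ atTop) (𝓝 0) := by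
    have h2 : Tendsto (fun q : ℝ × ℕ => q.1) (𝓝[>] (0 : ℝ) ×ˢ atTop) (𝓝 0) :=
      (tendsto_nhdsWithin_of_tendsto_nhds tendsto_id).comp tendsto_fst
    have h3 := (h2.const_mul (η * dirBound α lam B₀ B₁ C₀ C₂ CΨ)).const_mul 2
    simpa [sgdaError] using (tendsto_particleError η _ _ _ (t + 1) hδ).add h3
  have hε : ∀ᶠ q : ℝ × ℕ in 𝓝[>] (0 : ℝ) ×ˢ atTop, 0 < q.1 :=
    tendsto_fst.eventually self_mem_nhdsWithin
  have hN : ∀ᶠ q : ℝ × ℕ in 𝓝[>] (0 : ℝ) ×ˢ atTop, 0 < q.2 :=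
    tendsto_snd.eventually (eventually_gt_atTop 0)
  filter_upwards [hε, hN, h1.eventually_lt_const hr] with q hε hN hq
  refine (measure_mono ?_).trans ((H.sampleLaw_exists_lt_le hη hS hN hε
    (by linarith : 0 < t + 1) hδ hδ' hh hlip).trans hδe)
  intro s hs
  change r ≤ _ at hs
  set k := ⌊t / q.1⌋₊ with hk
  have hkt : (k : ℝ) ≤ t / q.1 := Nat.floor_le (by positivity)
  have hkt' : t / q.1 < k + 1 := Nat.lt_floor_add_one _
  refine ⟨k, hkt.trans (by gcongr; linarith), ?_⟩
  rw [le_div_iff₀ hε] at hkt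
  rw [div_lt_iff₀ hε] at hkt'
  have h2 := H.abs_integral_prod_time_sub_le hη hS (s := t) (t := k * q.1) ht (by positivity)
    hh hlip
  have h3 : |k * q.1 - t| ≤ q.1 := by
    rw [abs_le]; constructor <;> linarith
  have h4 : 2 * (η * dirBound α lam B₀ B₁ C₀ C₂ CΨ * |k * q.1 - t|) ≤
      2 * (η * dirBound α lam B₀ B₁ C₀ C₂ CΨ * q.1) := by gcongr
  have h5 := abs_sub_le (∫ p, h p ∂(empirical (sgda P φ ψ α lam η q.1 s.1 s.2 k)))
    (∫ p, h p ∂((μ (k * q.1) : Measure (Param D)).prod (ν (k * q.1))))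
    (∫ p, h p ∂((μ t : Measure (Param D)).prod (ν t)))
  rw [abs_sub_comm (∫ p, h p ∂(empirical (sgda P φ ψ α lam η q.1 s.1 s.2 k)))
    (∫ p, h p ∂((μ (k * q.1) : Measure (Param D)).prod (ν (k * q.1))))] at h5
  linarith

theorem tendsto_sampleLaw_of_lipschitz {F : Param D × Param D → ℝ} {b A : ℝ}
    (hb : ∀ p, |F p| ≤ b) (hA : 0 ≤ A) (hF : ∀ p q, |F p - F q| ≤ A * dist p q) {t r : ℝ}
    (ht : 0 ≤ t) (hr : 0 < r) :
    Tendsto (fun q : ℝ × ℕ => sampleLaw q.2 D 𝓓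
        {s | r ≤ |(∫ p, F p ∂(empirical (sgda P φ ψ α lam η q.1 s.1 s.2 ⌊t / q.1⌋₊))) -
          ∫ p, F p ∂((μ t : Measure (Param D)).prod (ν t))|})
      (𝓝[>] (0 : ℝ) ×ˢ atTop) (𝓝 0) := by
  have hb0 : 0 ≤ b := (abs_nonneg _).trans (hb 0)
  -- This scaling brings both the sup norm and the Lipschitz constant below `1`. The product metric
  -- is the maximum of the two distances, hence at most the Euclidean one.
  set c := (1 + b + A)⁻¹ with hc
  have hc0 : 0 < c := by positivity
  have hcb : c * b ≤ 1 := by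
    rw [hc, inv_mul_le_iff₀ (by positivity)]; linarith
  have hcA : c * A ≤ 1 := by
    rw [hc, inv_mul_le_iff₀ (by positivity)]; linarith
  have h1 := H.tendsto_sampleLaw_of_pairLipschitz hη hS (h := fun p => c * F p) (fun p => by
      rw [abs_mul, abs_of_pos hc0]
      exact (mul_le_mul_of_nonneg_left (hb p) hc0.le).trans hcb) (fun p q => by
      rw [← mul_sub, abs_mul, abs_of_pos hc0]
      have h2 : dist p q ≤ √(‖p.1 - q.1‖ ^ 2 + ‖p.2 - q.2‖ ^ 2) := by
        rw [Prod.dist_eq, dist_eq_norm, dist_eq_norm]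
        exact max_le (Real.le_sqrt_of_sq_le (by nlinarith [sq_nonneg ‖p.2 - q.2‖]))
          (Real.le_sqrt_of_sq_le (by nlinarith [sq_nonneg ‖p.1 - q.1‖]))
      calc c * |F p - F q| ≤ c * (A * dist p q) := by gcongr; exact hF p q
        _ = c * A * dist p q := by ring
        _ ≤ 1 * dist p q := by gcongr
        _ ≤ _ := by rwa [one_mul]) ht (mul_pos hc0 hr)
  refine h1.congr fun q => ?_
  congr 1
  ext s
  simp only [Set.mem_ofPred_eq]
  rw [integral_const_mul, integral_const_mul, ← mul_sub, abs_mul, abs_of_pos hc0,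
    mul_le_mul_iff_right₀ hc0]

/-- Weak convergence in probability of the empirical distributions. -/
theorem tendsto_sampleLaw (F : BoundedContinuousFunction (Param D × Param D) ℝ) {t r : ℝ}
    (ht : 0 ≤ t) (hr : 0 < r) :
    Tendsto (fun q : ℝ × ℕ => sampleLaw q.2 D 𝓓
        {s | r ≤ |(∫ p, F p ∂(empirical (sgda P φ ψ α lam η q.1 s.1 s.2 ⌊t / q.1⌋₊))) -
          ∫ p, F p ∂((μ t : Measure (Param D)).prod (ν t))|})
      (𝓝[>] (0 : ℝ) ×ˢ atTop) (𝓝 0) := by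
  set m := (μ t : Measure (Param D)).prod (ν t : Measure (Param D)) with hm
  -- A Lipschitz minorant within `r / 2` in mean under the limit law. A deficit of `r` in the
  -- empirical mean of `F` forces a deficit of `r / 2` for the minorant; an excess is a deficit of
  -- `-F`. Closeness under the random empirical law is never needed.
  have hex : ∀ F : BoundedContinuousFunction (Param D × Param D) ℝ, ∃ n : ℕ,
      (∫ p, F p ∂m) - r / 2 < ∫ p, lowerEnvelope F n p ∂m := fun F =>
    ((tendsto_integral_lowerEnvelope F m).eventually_const_lt
      (by linarith : (∫ p, F p ∂m) - r / 2 < ∫ p, F p ∂m)).exists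
  obtain ⟨n₁, hn₁⟩ := hex F
  obtain ⟨n₂, hn₂⟩ := hex (-F)
  have hlim : ∀ (F : BoundedContinuousFunction (Param D × Param D) ℝ) (n : ℕ), _ := fun F n =>
    H.tendsto_sampleLaw_of_lipschitz hη hS (abs_lowerEnvelope_le F n) (Nat.cast_nonneg n)
      (abs_lowerEnvelope_sub_le F n) ht (half_pos hr)
  have h0 := (hlim F n₁).add (hlim (-F) n₂)
  rw [add_zero] at h0
  refine tendsto_of_tendsto_of_tendsto_of_le_of_le tendsto_const_nhds h0 (fun q => zero_le)
    fun q => ?_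
  refine (measure_mono ?_).trans (measure_union_le _ _)
  intro s hs
  set σ := sgda P φ ψ α lam η q.1 s.1 s.2 ⌊t / q.1⌋₊ with hσ
  have hs' : r ≤ |(∫ p, F p ∂(empirical σ)) - ∫ p, F p ∂m| := hs
  have hmono : ∀ (F : BoundedContinuousFunction (Param D × Param D) ℝ) (n : ℕ),
      ∫ p, lowerEnvelope F n p ∂(empirical σ) ≤ ∫ p, F p ∂(empirical σ) := fun F n => by
    rw [integral_empirical _ F.continuous, integral_empirical _ (continuous_lowerEnvelope F n)]
    gcongr
    exact lowerEnvelope_le F n _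
  have hneg : ∀ m' : Measure (Param D × Param D), ∫ p, (-F) p ∂m' = -∫ p, F p ∂m' := fun m' => by
    simp only [BoundedContinuousFunction.coe_neg, Pi.neg_apply]
    exact integral_neg _
  have h1 := hmono F n₁
  have h2 := hmono (-F) n₂
  rw [hneg] at h2 hn₂
  rcases le_abs.mp hs' with h | h
  · right
    change r / 2 ≤ |(∫ p, lowerEnvelope (-F) n₂ p ∂(empirical σ)) -
      ∫ p, lowerEnvelope (-F) n₂ p ∂m|
    exact le_abs.mpr (Or.inr (by linarith))
  · left
    change r / 2 ≤ |(∫ p, lowerEnvelope F n₁ p ∂(empirical σ)) - ∫ p, lowerEnvelope F n₁ p ∂m|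
    exact le_abs.mpr (Or.inr (by linarith))

/-- The quantitative propagation of chaos estimate. -/
theorem ofReal_le_sampleLaw {N : ℕ} (hN : 0 < N) {ε T δ : ℝ} (hε : 0 < ε) (hT : 0 < T)
    (hδ : 0 < δ) {h : Param D × Param D → ℝ} (hh : ∀ p, |h p| ≤ 1) (hlip : PairLipschitz h)
    {R : ℝ} (hR : δ ≤ 1 / 5 → sgdaError η α lam B₀ B₁ B₂ C₀ C₂ CΨ N (min ε T) T δ ≤ R) :
    ENNReal.ofReal (1 - 5 * δ) ≤ sampleLaw N D 𝓓 {s | ∀ k : ℕ, (k : ℝ) ≤ T / ε →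
      |(∫ p, h p ∂((μ (k * ε) : Measure (Param D)).prod (ν (k * ε)))) -
        ∫ p, h p ∂(empirical (sgda P φ ψ α lam η ε s.1 s.2 k))| ≤ R} := by
  rcases le_or_gt δ (1 / 5) with hδ' | hδ'
  swap
  · rw [ENNReal.ofReal_of_nonpos (by linarith)]
    exact zero_le
  have hbad := H.sampleLaw_exists_lt_le hη hS hN (lt_min hε hT) hT hδ hδ' hh hlip
  set good := {s : (Fin N → Param D × Param D) × (ℕ → 𝓧 × 𝓩) | ∀ k : ℕ, (k : ℝ) ≤ T / ε →
      |(∫ p, h p ∂((μ (k * ε) : Measure (Param D)).prod (ν (k * ε)))) -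
        ∫ p, h p ∂(empirical (sgda P φ ψ α lam η ε s.1 s.2 k))| ≤ R} with hgood
  have hcompl : sampleLaw N D 𝓓 goodᶜ ≤ ENNReal.ofReal (3 * δ) := by
    refine (measure_mono fun s hs => ?_).trans hbad
    rw [hgood, Set.mem_compl_iff, Set.mem_ofPred_eq] at hs
    push Not at hs
    obtain ⟨k, hk, hlt⟩ := hs
    -- For `ε > T` only `k = 0` is admissible, and the initial particles do not depend on the
    -- stepsize. The event is then read with stepsize `T`, for which the error bound is available.
    rcases le_or_gt ε T with hεT | hεT
    · rw [min_eq_left hεT] at *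
      exact ⟨k, hk, (hR hδ').trans_lt hlt⟩
    · have hk0 : k = 0 := by
        have h1 : (k : ℝ) < 1 := hk.trans_lt ((div_lt_one hε).mpr hεT)
        exact Nat.lt_one_iff.mp (by exact_mod_cast h1)
      subst hk0
      refine ⟨0, by simp only [Nat.cast_zero]; positivity, (hR hδ').trans_lt ?_⟩
      simpa only [Nat.cast_zero, zero_mul, sgda] using hlt
  have h1 : 1 ≤ sampleLaw N D 𝓓 good + ENNReal.ofReal (3 * δ) := by
    calc (1 : ℝ≥0∞) = sampleLaw N D 𝓓 Set.univ := measure_univ.symm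
      _ ≤ sampleLaw N D 𝓓 good + sampleLaw N D 𝓓 goodᶜ := by
          rw [← Set.union_compl_self good]; exact measure_union_le _ _
      _ ≤ _ := by gcongr
  calc ENNReal.ofReal (1 - 5 * δ) ≤ ENNReal.ofReal (1 - 3 * δ) :=
        ENNReal.ofReal_le_ofReal (by linarith)
    _ = 1 - ENNReal.ofReal (3 * δ) := by
        rw [ENNReal.ofReal_sub _ (by positivity), ENNReal.ofReal_one]
    _ ≤ _ := tsub_le_iff_right.mpr h1

end RegularModel

end Convergence

end SGDAMeanField

/-! ### The proposition. -/

theorem proposition4p2 (α η lam B₀ B₁ B₂ C₀ C₂ CΨ : ℝ) (hα : 0 < α) (hη : 0 < η)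
    (hlam : 0 ≤ lam) (hB₀ : 0 < B₀) (hB₁ : 0 < B₁) (hB₂ : 0 < B₂) (hC₀ : 0 < C₀) (hC₂ : 0 < C₂)
    (hCΨ : 0 < CΨ) :
    ∃ B : ℝ, 0 < B ∧
      ∀ (𝓧 : Type*) (𝓩 : Type*) (𝓦 : Type*) [MeasurableSpace 𝓧] [MeasurableSpace 𝓩]
        [MeasurableSpace 𝓦] (D : ℕ) (P : SGDAMeanField.MomentProblem 𝓧 𝓩 𝓦)
        (𝓓 : Measure (𝓧 × 𝓩)) [IsProbabilityMeasure 𝓓]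
        (φ : 𝓦 → SGDAMeanField.Param D → ℝ) (ψ : 𝓩 → SGDAMeanField.Param D → ℝ)
        (μ ν : ℝ → ProbabilityMeasure (SGDAMeanField.Param D)),
        SGDAMeanField.RegularNeuron B₀ B₁ B₂ φ →
        SGDAMeanField.RegularNeuron B₀ B₁ B₂ ψ →
        SGDAMeanField.BoundedFunctionals P φ α C₀ C₂ CΨ →
        SGDAMeanField.IsMeanFieldSolution P 𝓓 φ ψ α lam η μ ν →
        -- weak convergence, in probability, as `ε → 0⁺` and `N → ∞`
        (∀ F : BoundedContinuousFunction (SGDAMeanField.Param D × SGDAMeanField.Param D) ℝ,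
          ∀ t : ℝ, 0 ≤ t → ∀ r : ℝ, 0 < r →
          Tendsto (fun q : ℝ × ℕ => SGDAMeanField.sampleLaw q.2 D 𝓓
              {s | r ≤ |(∫ p, F p ∂(SGDAMeanField.empirical
                    (SGDAMeanField.sgda P φ ψ α lam η q.1 s.1 s.2 ⌊t / q.1⌋₊)))
                  - ∫ p, F p ∂((μ t : Measure (SGDAMeanField.Param D)).prod (ν t))|})
            (𝓝[>] (0 : ℝ) ×ˢ atTop) (𝓝 0)) ∧
        -- the quantitative bound
        (∀ (N : ℕ) (ε T δ : ℝ), 0 < N → 0 < ε → 0 < T → 0 < δ →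
          ∀ h : SGDAMeanField.Param D × SGDAMeanField.Param D → ℝ,
          (∀ p, |h p| ≤ 1) →
          (∀ p q, |h p - h q| ≤ √(‖p.1 - q.1‖ ^ 2 + ‖p.2 - q.2‖ ^ 2)) →
          ENNReal.ofReal (1 - 5 * δ) ≤ SGDAMeanField.sampleLaw N D 𝓓
            {s | ∀ k : ℕ, (k : ℝ) ≤ T / ε →
              |(∫ p, h p ∂((μ (k * ε) : Measure (SGDAMeanField.Param D)).prod (ν (k * ε))))
                - ∫ p, h p ∂(SGDAMeanField.empirical
                    (SGDAMeanField.sgda P φ ψ α lam η ε s.1 s.2 k))|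
              ≤ B * Real.exp (B * T) * (√(Real.log (N / δ) / N)
                  + √(ε * (D + Real.log (N / δ))))}) := by
  set K := 2 * SGDAMeanField.dirBound α lam B₀ B₁ C₀ C₂ CΨ with hK
  set L := SGDAMeanField.dirLip α lam B₀ B₂ C₀ C₂ CΨ +
    SGDAMeanField.dirLawLip α lam B₁ C₂ CΨ with hL
  set κ := SGDAMeanField.consistencyConst η α lam B₀ B₁ B₂ C₀ C₂ CΨ with hκ
  have hK0 : 0 ≤ K := by rw [hK, SGDAMeanField.dirBound]; positivity
  have hL0 : 0 ≤ L := by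
    rw [hL, SGDAMeanField.dirLip, SGDAMeanField.dirLawLip]; positivity
  have hκ0 : 0 ≤ κ := by
    rw [hκ, SGDAMeanField.consistencyConst, SGDAMeanField.dirLip, SGDAMeanField.dirLawLip,
      SGDAMeanField.dirBound]
    positivity
  set C := 14 + 8 * (η * K) + η * (12 * K + 4 * L * (η * K) + κ) with hC
  have hC0 : 0 < C := by positivity
  -- One constant dominates both the prefactor `C` and the exponential rate `2 + 2 * L * η`. It is
  -- fixed before the spaces, the dimension and the functionals.
  refine ⟨C + (2 + 2 * L * η), by positivity, ?_⟩
  intro 𝓧 𝓩 𝓦 _ _ _ D P 𝓓 _ φ ψ μ ν hφ hψ hP hS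
  have H : SGDAMeanField.RegularModel P φ ψ α lam B₀ B₁ B₂ C₀ C₂ CΨ :=
    ⟨hα, hlam, hB₀, hB₁, hB₂, hC₀, hC₂, hCΨ, hφ, hψ, hP⟩
  refine ⟨fun F t ht r hr => H.tendsto_sampleLaw hη hS F ht hr,
    fun N ε T δ hN hε hT hδ h hh hlip => H.ofReal_le_sampleLaw hη hS hN hε hT hδ hh hlip
      fun hδ' => ?_⟩
  have hΛ := SGDAMeanField.one_le_log_div hN hδ hδ'
  refine (SGDAMeanField.particleError_le (D := D) hη.le hK0 hL0 hκ0 hN (lt_min hε hT)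
    (min_le_right ε T) hδ hδ').trans ?_
  have hLη : 0 ≤ 2 * L * η := by positivity
  have hC2 : 2 + 2 * L * η ≤ C + (2 + 2 * L * η) := by linarith
  have hCB : C ≤ C + (2 + 2 * L * η) := by linarith
  refine mul_le_mul (mul_le_mul hCB (Real.exp_le_exp.mpr
    (mul_le_mul_of_nonneg_right hC2 hT.le)) (Real.exp_nonneg _) (by positivity)) ?_
    (by positivity) (by positivity)
  gcongr
  exact min_le_left ε T
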